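/- \textbf{Setting.} Let $n$ agents minimise $\psi=f+\varphi$ over $\mathbb{R}^p$, $f=\frac1n\sum_{i=1}^n f_i$. Assume: (a) there is an open set $\mathcal U\supseteq\operatorname{dom}\varphi$ on which every $f_i:\mathbb{R}^p\to\mathbb{R}$ is differentiable with $\|\nabla f_i(x)-\nabla f_i(x')\|\le L\|x-x'\|$ ($L>0$); $f_i(x)\ge f_i^*:=\inf_{\operatorname{dom}\varphi}f_i>-\infty$ for all $x\in\mathbb{R}^p$; and $x-t\nabla f_i(x)\in\mathcal U$ for all $x\in\operatorname{dom}\varphi$, $t\in[0,1/L]$ (automatic if $\mathcal U=\mathbb{R}^p$). Put $f^*:=\inf_{\operatorname{dom}\varphi}f$, $\sigma_f^*:=f^*-\frac1n\sum_i f_i^*$. (b) $\varphi:\mathbb{R}^p\to(-\infty,\infty]$ is proper, lower semicontinuous, $\rho$-weakly convex ($\varphi+\frac\rho2\|\cdot\|^2$ is convex, $\rho>0$), and $\varphi^*:=\inf\varphi>-\infty$. Put $\bar\psi:=f^*+\varphi^*$. (c) the stochastic gradients $g_i(x;\xi_{i,k})$ use independent samples $\xi_{i,k}$ ($1\le i\le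 n$, $k\ge0$) and satisfy $\mathbb{E}\,g_i(x;\xi_{i,k})=\nabla f_i(x)$ and $\mathbb{E}\|g_i(x;\xi_{i,k})-\nabla f_i(x)\|^2\le C_0[f_i(x)-f_i^*]+\sigma^2$ for $x\in\operatorname{dom}\varphi$, with $C_0,\sigma\ge0$. (d) $W\in\mathbb{R}^{n\times n}$ is nonnegative, symmetric, stochastic, with $w_{ij}>0$ for $i\ne j$ exactly when $\{i,j\}$ is an edge of a connected undirected graph, and $W$ is positive semidefinite. Let $\lambda:=\|W-\mathbf 1\mathbf 1^{\top}/n\|$ and assume $\lambda>0$. (Matrix norms are spectral norms.) Let $W=\mathbf 1\mathbf 1^\top/n+\hat U\hat\Lambda\hat U^\top$ with $\hat\Lambda=\operatorname{diag}(\lambda_2,\dots,\lambda_n)$, $\lambda_2\ge\dots\ge\lambda_n$, $\hat U^\top\hat U=I_{n-1}$, $\hat U\hat U^\top=I-\mathbf 1\mathbf 1^\top/n$. Take $A=W$, $B=(I-W)^{1/2}$, $C=I$, so that $\hat\Lambda_a=\hat\Lambda$, $\hat\Lambda_b=(I-\hat\Lambda)^{1/2}$, $\hat\Lambda_c=I$.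 For an invertible $V\in\mathbb{R}^{2(n-1)\times2(n-1)}$ put $$\Gamma:=V^{-1}\begin{pmatrix}\hat\Lambda_a\hat\Lambda_c-\hat\Lambda_b^2&-\hat\Lambda_b\\ \hat\Lambda_b&I\end{pmatrix}V,\quad \beta:=\|\Gamma\|,\quad D_1:=\|V^{-1}\|\|\hat\Lambda_a\hat U^\top\|,\quad D_2:=\|V^{-1}\|\|\hat\Lambda_b^{-1}\hat\Lambda_a\hat U^\top\|.$$ \textbf{Part 1.} There is an invertible real $V$ with $$\|V\|^2\le4,\quad\|V^{-1}\|^2\le\frac2{\underline\lambda},\quad D_1^2\le1,\quad D_2^2\le\frac1{1-\lambda},\quad\beta=\sqrt\lambda,\tag{1}$$ where $\underline\lambda$ is the smallest nonzero eigenvalue of $W$. \textbf{Part 2.} Let $V$ be any matrix satisfying (1). norM-ED with deterministic $\mathbf z_0\in\mathbb{R}^{n\times p}$ and $\mathbf d_0=0$ is $$\mathbf z_{k+1}=W\{\mathbf z_k-\alpha[\mathbf g_k+\gamma^{-1}(\mathbf z_k-\mathbf x_k)]\}-B\mathbf d_k,\quad \mathbf d_{k+1}=\mathbf d_k+B\mathbf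 z_{k+1},\quad x_{i,k}=\operatorname{prox}_{\gamma\varphi}(z_{i,k}),$$ where $z_{i,k}$, $x_{i,k}$ are the $i$th rows of $\mathbf z_k$, $\mathbf x_k$, the $i$th row of $\mathbf g_k$ is $g_i(x_{i,k};\xi_{i,k})$, and $\operatorname{prox}_{\gamma\varphi}(x)=\arg\min_y\{\varphi(y)+\frac1{2\gamma}\|y-x\|^2\}$. For a horizon $K\ge1$ choose $m=\lceil\sqrt{K/n}\rceil+432$, $\gamma=1/(4[\rho+L+(D_1^2+1)C_0])$, $\alpha=1/(114(C_0+L)\sqrt{K/n}+\eta)$ with $$\begin{aligned}\eta={}&\sqrt{16mC_0\gamma^{-1}(8+3D_1^2)(\|V\|^2+1)}+2\sqrt2\,m\|V\|\mathcal T_1+\tfrac{\mathcal T_3}{1-\beta^2}\sqrt{\tfrac{600m}{\sum_{t<m}\beta^{2t}}}+144m\mathcal T_2+\tfrac{294(D_2+1)\mathcal T_2}{\sqrt{1-\beta^2}}\\&+24D_1L_F\sqrt{\|V\|^2+1}+\Big(\tfrac{5460D_1^2C_0\mathcal T_2^2K}{1-\beta^2}\Big)^{1/3}+\Big(\tfrac{5460m^2D_2^2C_0\mathcal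 T_2^2L_F^2K}{n}\Big)^{1/5},\end{aligned}$$ $L_F=\frac{L-\rho+2/\gamma}{1-\gamma\rho}$, $\mathcal T_1^2=(D_1^2+1)L_F^2+\frac{16}3(\gamma^{-2}+2L^2)+\frac{4C_0L}{3n}$, $\mathcal T_2^2=L_F^2+2(2L^2+\gamma^{-2})\|V\|^2+4C_0L\|V\|^2+4C_0\gamma^{-1}$, $\mathcal T_3^2=\|V\|^2[L_F^2D_1^2+2L(L+C_0)+\gamma^{-2}+4D_1^2C_0L]+L_F^2+2\gamma^{-2}$. Let $F_{\rm nat}(x)=x-\operatorname{prox}_{\gamma\varphi}(x-\gamma\nabla f(x))$, $F_{\rm nor}(z)=\nabla f(\operatorname{prox}_{\gamma\varphi}(z))+\gamma^{-1}(z-\operatorname{prox}_{\gamma\varphi}(z))$ and $\bar z_0=\frac1n\sum_iz_{i,0}$. Then all the expectations below are finite, and for every $K\ge1$ $$\begin{aligned}S_K:=\frac1{nK}\sum_{k=0}^{K-1}\sum_{i=1}^n\mathbb{E}\|\gamma^{-1}F_{\rm nat}(x_{i,k})\|^2=\mathcal O\Big(&\frac1{\sqrt{nK}}+\frac1{\sqrt{1-\lambda}(nK^3)^{1/4}}+\Big(\frac1{(1-\lambda)K^2}\Big)^{1/3}\\&+\Big(\frac1{n^2(1-\lambda)K^3}\Big)^{1/5}+\frac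 n{(1-\lambda)K}\Big),\end{aligned}$$ and the transient time $\inf\{K\ge1: S_k\le\mathcal O(1/\sqrt{nk})\ \forall k\ge K\}$ is $\mathcal O(n^3/(1-\lambda)^2)$ (each horizon $k$ is run with its own step size). The constants in $\mathcal O(\cdot)$ depend only on $L,\rho,C_0,\sigma$ and on a common upper bound for $\sigma_f^*$, $\psi(\operatorname{prox}_{\gamma\varphi}(\bar z_0))-\bar\psi$, $\|F_{\rm nor}(\bar z_0)\|^2$ and $\frac1n\|V^{-1}\|^2\sum_i\|z_{i,0}-\bar z_0\|^2$; in particular not on $n$, $p$, $W$, $\lambda$, $K$. -/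

import Mathlib

open MeasureTheory ProbabilityTheory

noncomputable section

namespace NormED

/-! ### Spectral quantities of matrices -/

open scoped Matrix.Norms.L2Operator in
/-- The spectral norm (largest singular value) of a real matrix. -/
def specNorm {ι κ : Type} [Fintype ι] [Fintype κ] [DecidableEq ι] [DecidableEq κ]
    (M : Matrix ι κ ℝ) : ℝ := ‖M‖

/-- The averaging matrix `𝟏𝟏ᵀ / n`. -/
def avgMat (n : ℕ) : Matrix (Fin n) (Fin n) ℝ := Matrix.of fun _ _ => (n : ℝ)⁻¹

/-- The spectral norm `λ` of `W - 𝟏𝟏ᵀ / n`. -/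
def lam {n : ℕ} (W : Matrix (Fin n) (Fin n) ℝ) : ℝ := specNorm (W - avgMat n)

/-- The smallest nonzero eigenvalue of `W`. -/
def lamMinPos {n : ℕ} (W : Matrix (Fin n) (Fin n) ℝ) : ℝ :=
  sInf {t : ℝ | t ∈ spectrum ℝ W ∧ t ≠ 0}

/-- The communication graph is undirected and connected, and `W` is a nonnegative symmetric
stochastic matrix whose off-diagonal support is the set of edges. -/
structure IsMixing {n : ℕ} (G : SimpleGraph (Fin n)) (W : Matrix (Fin n) (Fin n) ℝ) : Prop where
  connected : G.Connected
  adj_iff : ∀ i j, i ≠ j → (G.Adj i j ↔ 0 < W i j)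
  nonneg : ∀ i j, 0 ≤ W i j
  symm : W.transpose = W
  row_sum : ∀ i, ∑ j, W i j = 1

/-- The spectral decomposition `W = 𝟏𝟏ᵀ / n + Û diag(μ) Ûᵀ`, with `μ = (λ₂ ≥ ⋯ ≥ λₙ)`. -/
structure IsSpectralDecomp {n : ℕ} (W : Matrix (Fin n) (Fin n) ℝ)
    (U : Matrix (Fin n) (Fin (n - 1)) ℝ) (μ : Fin (n - 1) → ℝ) : Prop where
  decomp : W = avgMat n + U * Matrix.diagonal μ * U.transpose
  mul_transpose : U * U.transpose = 1 - avgMat n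
  transpose_mul : U.transpose * U = 1
  antitone : Antitone μ

/-! ### The transformed consensus dynamics

Here `a`, `b`, `c` are the diagonals of `Λ̂_a`, `Λ̂_b`, `Λ̂_c`. -/

/-- `Γ = V⁻¹ [[Λ̂_a Λ̂_c - Λ̂_b², -Λ̂_b], [Λ̂_b, I]] V`. -/
def gammaMat {ι : Type} [Fintype ι] [DecidableEq ι] (a b c : ι → ℝ)
    (V : Matrix (ι ⊕ ι) (ι ⊕ ι) ℝ) : Matrix (ι ⊕ ι) (ι ⊕ ι) ℝ :=
  V⁻¹ * Matrix.fromBlocks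
    (Matrix.diagonal a * Matrix.diagonal c - Matrix.diagonal b ^ 2) (-Matrix.diagonal b)
    (Matrix.diagonal b) 1 * V

/-- `D₁ = ‖V⁻¹‖ ‖Λ̂_a Ûᵀ‖`. -/
def D1 {n : ℕ} {ι : Type} [Fintype ι] [DecidableEq ι] (U : Matrix (Fin n) ι ℝ) (a : ι → ℝ)
    (V : Matrix (ι ⊕ ι) (ι ⊕ ι) ℝ) : ℝ :=
  specNorm V⁻¹ * specNorm (Matrix.diagonal a * U.transpose)

/-- `D₂ = ‖V⁻¹‖ ‖Λ̂_b⁻¹ Λ̂_a Ûᵀ‖`. -/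
def D2 {n : ℕ} {ι : Type} [Fintype ι] [DecidableEq ι] (U : Matrix (Fin n) ι ℝ) (a b : ι → ℝ)
    (V : Matrix (ι ⊕ ι) (ι ⊕ ι) ℝ) : ℝ :=
  specNorm V⁻¹ * specNorm ((Matrix.diagonal b)⁻¹ * Matrix.diagonal a * U.transpose)

/-- For `A = W`, `B = (I - W)^{1/2}`, `C = I`: the diagonal of `Λ̂_b`. -/
def edB {ι : Type} (μ : ι → ℝ) : ι → ℝ := fun i => √(1 - μ i)

/-- `β = ‖Γ‖` for `A = W`, `B = (I - W)^{1/2}`, `C = I`. -/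
def edBeta {ι : Type} [Fintype ι] [DecidableEq ι] (μ : ι → ℝ)
    (V : Matrix (ι ⊕ ι) (ι ⊕ ι) ℝ) : ℝ :=
  specNorm (gammaMat μ (edB μ) (fun _ => 1) V)

/-- The bounds on the transformation `V` and the value of `β` for `A = W`, `B = (I - W)^{1/2}`,
`C = I`. -/
structure IsEDTransform {n : ℕ} (W : Matrix (Fin n) (Fin n) ℝ)
    (U : Matrix (Fin n) (Fin (n - 1)) ℝ) (μ : Fin (n - 1) → ℝ)
    (V : Matrix (Fin (n - 1) ⊕ Fin (n - 1)) (Fin (n - 1) ⊕ Fin (n - 1)) ℝ) : Prop where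
  isUnit : IsUnit V
  norm_sq_le : specNorm V ^ 2 ≤ 4
  norm_inv_sq_le : specNorm V⁻¹ ^ 2 ≤ 2 / lamMinPos W
  D1_sq_le : D1 U μ V ^ 2 ≤ 1
  D2_sq_le : D2 U μ (edB μ) V ^ 2 ≤ 1 / (1 - lam W)
  beta_eq : edBeta μ V = √(lam W)

/-! ### Step size and parameters

`v` stands for `‖V‖`, `d1`, `d2` for `D₁`, `D₂`. -/

/-- `γ = 1 / (4 [ρ + L + (D₁² + 1) C₀])`. -/
def gammaPar (L ρ C₀ d1 : ℝ) : ℝ := 1 / (4 * (ρ + L + (d1 ^ 2 + 1) * C₀))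

/-- The Lipschitz constant `L_F` of the normal map. -/
def LF (L ρ γ : ℝ) : ℝ := (L - ρ + 2 / γ) / (1 - γ * ρ)

/-- The constant `𝒯₁`. -/
def T1 (n : ℕ) (L ρ C₀ γ d1 : ℝ) : ℝ :=
  √((d1 ^ 2 + 1) * LF L ρ γ ^ 2 + 16 * ((γ ^ 2)⁻¹ + 2 * L ^ 2) / 3 + 4 * C₀ * L / (3 * n))

/-- The constant `𝒯₂`. -/
def T2 (L ρ C₀ γ v : ℝ) : ℝ :=
  √(LF L ρ γ ^ 2 + 2 * (2 * L ^ 2 + (γ ^ 2)⁻¹) * v ^ 2 + 4 * C₀ * L * v ^ 2 + 4 * C₀ * γ⁻¹)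

/-- The constant `𝒯₃`. -/
def T3 (L ρ C₀ γ v d1 : ℝ) : ℝ :=
  √(v ^ 2 * (LF L ρ γ ^ 2 * d1 ^ 2 + 2 * L * (L + C₀) + (γ ^ 2)⁻¹ + 4 * d1 ^ 2 * C₀ * L)
    + LF L ρ γ ^ 2 + 2 * (γ ^ 2)⁻¹)

/-- `m = ⌈√(K / n)⌉ + 432`. -/
def mPar (n K : ℕ) : ℕ := ⌈√((K : ℝ) / n)⌉₊ + 432

/-- The quantity `η` in the step size. -/
def etaPar (n K : ℕ) (L ρ C₀ v d1 d2 β : ℝ) : ℝ :=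
  let γ := gammaPar L ρ C₀ d1
  let m : ℝ := mPar n K
  let t2 := T2 L ρ C₀ γ v
  √(16 * m * C₀ * γ⁻¹ * (8 + 3 * d1 ^ 2) * (v ^ 2 + 1))
    + 2 * √2 * m * v * T1 n L ρ C₀ γ d1
    + T3 L ρ C₀ γ v d1 / (1 - β ^ 2)
        * √(600 * m / ∑ t ∈ Finset.range (mPar n K), β ^ (2 * t))
    + 144 * m * t2
    + 294 * (d2 + 1) * t2 / √(1 - β ^ 2)
    + 24 * d1 * LF L ρ γ * √(v ^ 2 + 1)
    + (5460 * d1 ^ 2 * C₀ * t2 ^ 2 * K / (1 - β ^ 2)) ^ (1 / 3 : ℝ)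
    + (5460 * m ^ 2 * d2 ^ 2 * C₀ * t2 ^ 2 * LF L ρ γ ^ 2 * K / n) ^ (1 / 5 : ℝ)

/-- The step size `α = 1 / (114 (C₀ + L) √(K / n) + η)` for the horizon `K`. -/
def alphaPar (n K : ℕ) (L ρ C₀ v d1 d2 β : ℝ) : ℝ :=
  1 / (114 * (C₀ + L) * √((K : ℝ) / n) + etaPar n K L ρ C₀ v d1 d2 β)

/-- The parameter `γ` of norM-ED. -/
def edGamma {n : ℕ} (U : Matrix (Fin n) (Fin (n - 1)) ℝ) (μ : Fin (n - 1) → ℝ)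
    (V : Matrix (Fin (n - 1) ⊕ Fin (n - 1)) (Fin (n - 1) ⊕ Fin (n - 1)) ℝ) (L ρ C₀ : ℝ) : ℝ :=
  gammaPar L ρ C₀ (D1 U μ V)

/-- The step size `α` of norM-ED for the horizon `K`. -/
def edAlpha {n : ℕ} (U : Matrix (Fin n) (Fin (n - 1)) ℝ) (μ : Fin (n - 1) → ℝ)
    (V : Matrix (Fin (n - 1) ⊕ Fin (n - 1)) (Fin (n - 1) ⊕ Fin (n - 1)) ℝ)
    (L ρ C₀ : ℝ) (K : ℕ) : ℝ :=
  alphaPar n K L ρ C₀ (specNorm V) (D1 U μ V) (D2 U μ (edB μ) V) (edBeta μ V)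

/-! ### The composite optimization problem -/

/-- The effective domain of `φ`. -/
def dom {p : ℕ} (φ : EuclideanSpace ℝ (Fin p) → EReal) : Set (EuclideanSpace ℝ (Fin p)) :=
  {x | φ x < ⊤}

/-- The proximal operator: a minimizer of `y ↦ φ y + ‖y - x‖² / (2γ)`. -/
def prox {p : ℕ} (φ : EuclideanSpace ℝ (Fin p) → EReal) (γ : ℝ)
    (x : EuclideanSpace ℝ (Fin p)) : EuclideanSpace ℝ (Fin p) :=
  Classical.epsilon fun y => ∀ w,
    φ y + ((‖y - x‖ ^ 2 / (2 * γ) : ℝ) : EReal) ≤ φ w + ((‖w - x‖ ^ 2 / (2 * γ) : ℝ) : EReal)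

/-- The average of `n` vectors. -/
def mean {n p : ℕ} (z : Fin n → EuclideanSpace ℝ (Fin p)) : EuclideanSpace ℝ (Fin p) :=
  (n : ℝ)⁻¹ • ∑ i, z i

/-- `f = (1/n) ∑ fᵢ`. -/
def avgFun {n p : ℕ} (f : Fin n → EuclideanSpace ℝ (Fin p) → ℝ) :
    EuclideanSpace ℝ (Fin p) → ℝ :=
  fun x => (n : ℝ)⁻¹ * ∑ i, f i x

/-- The infimum of `h` over the effective domain of `φ`. -/
def infOnDom {p : ℕ} (φ : EuclideanSpace ℝ (Fin p) → EReal)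
    (h : EuclideanSpace ℝ (Fin p) → ℝ) : ℝ :=
  sInf (h '' dom φ)

/-- `σ_f* = f* - (1/n) ∑ fᵢ*`. -/
def sigmaF {n p : ℕ} (f : Fin n → EuclideanSpace ℝ (Fin p) → ℝ)
    (φ : EuclideanSpace ℝ (Fin p) → EReal) : ℝ :=
  infOnDom φ (avgFun f) - (n : ℝ)⁻¹ * ∑ i, infOnDom φ (f i)

/-- `ψ(x) - ψ̄`, for `x` in the effective domain, where `ψ = f + φ` and `ψ̄ = f* + φ*`. -/
def psiGap {n p : ℕ} (f : Fin n → EuclideanSpace ℝ (Fin p) → ℝ)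
    (φ : EuclideanSpace ℝ (Fin p) → EReal) (x : EuclideanSpace ℝ (Fin p)) : ℝ :=
  (avgFun f x + (φ x).toReal) - (infOnDom φ (avgFun f) + infOnDom φ fun y => (φ y).toReal)

/-- The normal map of `h + φ`. -/
def Fnor {p : ℕ} (h : EuclideanSpace ℝ (Fin p) → ℝ) (φ : EuclideanSpace ℝ (Fin p) → EReal)
    (γ : ℝ) (z : EuclideanSpace ℝ (Fin p)) : EuclideanSpace ℝ (Fin p) :=
  gradient h (prox φ γ z) + γ⁻¹ • (z - prox φ γ z)

/-- The natural residual `x - prox_{γφ}(x - γ ∇h(x))`. -/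
def Fnat {p : ℕ} (h : EuclideanSpace ℝ (Fin p) → ℝ) (φ : EuclideanSpace ℝ (Fin p) → EReal)
    (γ : ℝ) (x : EuclideanSpace ℝ (Fin p)) : EuclideanSpace ℝ (Fin p) :=
  x - prox φ γ (x - γ • gradient h x)

/-- Each `fᵢ` is `L`-smooth on the open set `S ⊇ dom φ`, is bounded below by its infimum over
`dom φ`, and `S` contains the gradient steps of length at most `1 / L` from `dom φ`
(which is automatic when `S` is the whole space). -/
structure IsSmoothFamily {n p : ℕ} (f : Fin n → EuclideanSpace ℝ (Fin p) → ℝ)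
    (φ : EuclideanSpace ℝ (Fin p) → EReal) (L : ℝ) (S : Set (EuclideanSpace ℝ (Fin p))) :
    Prop where
  isOpen : IsOpen S
  dom_subset : dom φ ⊆ S
  differentiableOn : ∀ i, DifferentiableOn ℝ (f i) S
  lipschitz : ∀ i, ∀ x ∈ S, ∀ y ∈ S, ‖gradient (f i) x - gradient (f i) y‖ ≤ L * ‖x - y‖
  bddBelow : ∀ i, BddBelow (f i '' dom φ)
  inf_le : ∀ i x, infOnDom φ (f i) ≤ f i x
  step_mem : ∀ i, ∀ x ∈ dom φ, ∀ t ∈ Set.Icc (0 : ℝ) (1 / L), x - t • gradient (f i) x ∈ S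

/-- `φ : ℝᵖ → (-∞, ∞]` is proper, lower semicontinuous, `ρ`-weakly convex, and
`φ* = inf φ > -∞`. -/
structure IsWeaklyConvex {p : ℕ} (φ : EuclideanSpace ℝ (Fin p) → EReal) (ρ : ℝ) : Prop where
  ne_bot : ∀ x, φ x ≠ ⊥
  proper : (dom φ).Nonempty
  lsc : LowerSemicontinuous φ
  convex : ConvexOn ℝ (dom φ) fun x => (φ x).toReal + ρ / 2 * ‖x‖ ^ 2
  bddBelow : BddBelow ((fun x => (φ x).toReal) '' dom φ)

/-- Stochastic gradients `gᵢ(x; ξ_{i,k})` with independent samples `ξ_{i,k}`, unbiased and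
satisfying the ABC variance condition with constants `C₀`, `σ`. -/
structure IsStochasticOracle {n p : ℕ} {Ω Ξ : Type*} [MeasurableSpace Ω] [MeasurableSpace Ξ]
    (f : Fin n → EuclideanSpace ℝ (Fin p) → ℝ) (φ : EuclideanSpace ℝ (Fin p) → EReal)
    (C₀ σ : ℝ) (P : Measure Ω)
    (g : Fin n → EuclideanSpace ℝ (Fin p) → Ξ → EuclideanSpace ℝ (Fin p))
    (ξ : Fin n → ℕ → Ω → Ξ) : Prop where
  measurable_g : ∀ i, Measurable fun q : EuclideanSpace ℝ (Fin p) × Ξ => g i q.1 q.2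
  measurable_sample : ∀ i k, Measurable (ξ i k)
  indep : iIndepFun (fun (q : Fin n × ℕ) => ξ q.1 q.2) P
  integrable : ∀ i k, ∀ x ∈ dom φ, Integrable (fun ω => g i x (ξ i k ω)) P
  unbiased : ∀ i k, ∀ x ∈ dom φ, ∫ ω, g i x (ξ i k ω) ∂P = gradient (f i) x
  integrable_sq : ∀ i k, ∀ x ∈ dom φ,
    Integrable (fun ω => ‖g i x (ξ i k ω) - gradient (f i) x‖ ^ 2) P
  variance_le : ∀ i k, ∀ x ∈ dom φ,
    ∫ ω, ‖g i x (ξ i k ω) - gradient (f i) x‖ ^ 2 ∂P ≤ C₀ * (f i x - infOnDom φ (f i)) + σ ^ 2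

/-! ### The algorithm -/

/-- The product of an `n × n` matrix with the `n × p` matrix whose rows are the `z i`. -/
def mulRows {n p : ℕ} (M : Matrix (Fin n) (Fin n) ℝ) (z : Fin n → EuclideanSpace ℝ (Fin p)) :
    Fin n → EuclideanSpace ℝ (Fin p) :=
  fun i => ∑ j, M i j • z j

/-- The iterates `(𝐳ₖ, 𝐝ₖ)` of the unified normal map-based framework with matrices `A`, `B`, `C`:
`𝐳ₖ₊₁ = A {C 𝐳ₖ - α [𝐠ₖ + γ⁻¹ (𝐳ₖ - 𝐱ₖ)]} - B 𝐝ₖ`, `𝐝ₖ₊₁ = 𝐝ₖ + B 𝐳ₖ₊₁`, `𝐱ₖ = prox(𝐳ₖ)`,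
where `grad k 𝐱` is the stacked stochastic gradient of iteration `k` at `𝐱`. -/
def normABC {n p : ℕ} (A B C : Matrix (Fin n) (Fin n) ℝ) (α γ : ℝ)
    (φ : EuclideanSpace ℝ (Fin p) → EReal)
    (grad : ℕ → (Fin n → EuclideanSpace ℝ (Fin p)) → Fin n → EuclideanSpace ℝ (Fin p))
    (z₀ d₀ : Fin n → EuclideanSpace ℝ (Fin p)) :
    ℕ → (Fin n → EuclideanSpace ℝ (Fin p)) × (Fin n → EuclideanSpace ℝ (Fin p))
  | 0 => (z₀, d₀)
  | k + 1 =>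
    let z := (normABC A B C α γ φ grad z₀ d₀ k).1
    let d := (normABC A B C α γ φ grad z₀ d₀ k).2
    let x := fun i => prox φ γ (z i)
    let z' := mulRows A (mulRows C z - α • (grad k x + γ⁻¹ • (z - x))) - mulRows B d
    (z', d + mulRows B z')

/-- The iterates `x_{i,k} = prox(z_{i,k})` of norM-ED: `A = W`, `C = I`, `𝐝₀ = 0`, where `B`
is the positive semidefinite square root of `I - W`. -/
def edX {n p : ℕ} {Ω Ξ : Type*} (W B : Matrix (Fin n) (Fin n) ℝ) (α γ : ℝ)
    (φ : EuclideanSpace ℝ (Fin p) → EReal)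
    (g : Fin n → EuclideanSpace ℝ (Fin p) → Ξ → EuclideanSpace ℝ (Fin p))
    (ξ : Fin n → ℕ → Ω → Ξ) (z₀ : Fin n → EuclideanSpace ℝ (Fin p)) (i : Fin n) (k : ℕ) (ω : Ω) :
    EuclideanSpace ℝ (Fin p) :=
  prox φ γ ((normABC W B 1 α γ φ (fun l x j => g j (x j) (ξ j l ω)) z₀ 0 k).1 i)

/-- The averaged stationarity measure
`(1/(nK)) ∑_{k<K} ∑ᵢ 𝔼 ‖γ⁻¹ F_nat(x_{i,k})‖²` of random iterates `x`. -/
def statMeasure {n p : ℕ} {Ω : Type*} [MeasurableSpace Ω] (P : Measure Ω)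
    (h : EuclideanSpace ℝ (Fin p) → ℝ) (φ : EuclideanSpace ℝ (Fin p) → EReal) (γ : ℝ)
    (x : Fin n → ℕ → Ω → EuclideanSpace ℝ (Fin p)) (K : ℕ) : ℝ :=
  1 / ((n : ℝ) * K) *
    ∑ k ∈ Finset.range K, ∑ i, ∫ ω, ‖γ⁻¹ • Fnat h φ γ (x i k ω)‖ ^ 2 ∂P

/-- The expression inside `𝒪(·)` in the convergence rate of norM-ED; `l` stands for `λ`. -/
def edRate (n K : ℕ) (l : ℝ) : ℝ :=
  1 / √((n : ℝ) * K)
    + 1 / (√(1 - l) * ((n : ℝ) * K ^ 3) ^ (1 / 4 : ℝ))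
    + (1 / ((1 - l) * (K : ℝ) ^ 2)) ^ (1 / 3 : ℝ)
    + (1 / ((n : ℝ) ^ 2 * (1 - l) * (K : ℝ) ^ 3)) ^ (1 / 5 : ℝ)
    + n / ((1 - l) * K)

/-- The transient time for the constant `c`: the infimum of all `K` such that the accuracy `S k`
reached with horizon `k` is at most `c / √(n k)` for all `k ≥ K`; it is `⊤` if there is no
such `K`. -/
def transientTime (n : ℕ) (S : ℕ → ℝ) (c : ℝ) : EReal :=
  ⨅ (K : ℕ) (_ : 1 ≤ K ∧ ∀ k, K ≤ k → S k ≤ c / √((n : ℝ) * k)), ((K : ℝ) : EReal)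

end NormED

end

open NormED MeasureTheory

/-! Part 1. In the eigenbasis of `W` the consensus dynamics split into one 2×2 block per eigenvalue
μ on the complement of the constants. Such a block has trace 2μ and determinant μ, so its
eigenvalues have modulus √μ, and √λ is the best norm one can hope for. `exists_isEDTransform` gives
an explicit conjugation. Its scaling uses the common factor √λ instead of √μ, so `V` stays
invertible when `W` is singular. Each conjugated block has norm at most √λ (`sq_gamma_block_le`),
with equality at μ = λ. That λ < 1 follows from connectedness (`IsMixing.lam_lt_one`).

Part 2. Progress is measured by `merit`, which decreases along inexact normal map steps
(`merit_step_le`). It is not differentiable, so gradient noise cannot be removed by taking the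
expectation of a first-order term. The averaged iterate is therefore corrected by a filtered noise:
ν' = (1 - αM)ν + α·(mean noise) with M = L_F, and y = (mean of z) + ν. The fresh noise cancels in y,
whose next value is already known before the samples of the iteration are drawn (`Valid.y_succ`,
`Valid.isL2_y_succ`). Hence `merit` descends pathwise along y, with an error governed by the
consensus error and ν. Independence across agents makes the forcing of E‖ν‖² equal to α² times the
noise variance over n, and this is the source of the 1/√(nK) term.

The dual variable is recentred at the value that would balance the normal maps at y. In the
coordinates `u` the recursion is then Γ plus differences of normal maps plus noise (`Valid.u_succ`).
Since β² = λ, Young's inequality gives the contraction factor (1 + λ)/2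
(`Valid.sum_norm_uDet_sq_le`), and the noise is orthogonal to the rest because `uDet` depends only
on the past.

The expected merit, the consensus error and E‖ν‖² are combined into one Lyapunov function
(`lyapunov_step`). The variance may grow with the objective gap, so the recursion has the form Φ' ≤
(1 + c)Φ - s + b. The step size keeps cK bounded (`exponent_le`), so the exponential factor is a
constant. What remains are the three quantities 1/(αK), α/n and α²/(1 - λ) (`averaged_bound_le`).
Every summand of η divided by K is dominated by terms of the rate (`eta_terms_le`), and the summand
114(C₀ + L)√(K/n) of 1/α controls the other two quantities (`alphaPar_rates`). For K ≥ n³/(1 - λ)²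
each of the five rate terms is at most 1/√(nK) (`IsRateTerms.le_of_transient`), which bounds the
transient time. -/

namespace NormED

open Filter Topology
open scoped InnerProductSpace

/-! ### The proximal operator of a weakly convex function -/

section Prox

variable {p : ℕ} {φ : EuclideanSpace ℝ (Fin p) → EReal} {ρ γ : ℝ}

theorem IsWeaklyConvex.coe_toReal (hφ : IsWeaklyConvex φ ρ) {x : EuclideanSpace ℝ (Fin p)}
    (hx : x ∈ dom φ) : ((φ x).toReal : EReal) = φ x :=
  EReal.coe_toReal (ne_of_lt hx) (hφ.ne_bot x)

theorem IsWeaklyConvex.infOnDom_le (hφ : IsWeaklyConvex φ ρ) {x : EuclideanSpace ℝ (Fin p)}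
    (hx : x ∈ dom φ) : infOnDom φ (fun y => (φ y).toReal) ≤ (φ x).toReal := by
  exact csInf_le hφ.bddBelow ⟨x, hx, rfl⟩

theorem IsWeaklyConvex.exists_prox (hφ : IsWeaklyConvex φ ρ) (hγ : 0 < γ)
    (x : EuclideanSpace ℝ (Fin p)) :
    ∃ y, ∀ w, φ y + ((‖y - x‖ ^ 2 / (2 * γ) : ℝ) : EReal)
      ≤ φ w + ((‖w - x‖ ^ 2 / (2 * γ) : ℝ) : EReal) := by
  obtain ⟨x₀, hx₀⟩ := hφ.proper
  set c := infOnDom φ (fun y => (φ y).toReal) with hc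
  set T := (φ x₀).toReal + ‖x₀ - x‖ ^ 2 / (2 * γ) with hT
  have hcT : 0 ≤ T - c := by
    have := hφ.infOnDom_le hx₀
    have h2 : 0 ≤ ‖x₀ - x‖ ^ 2 / (2 * γ) := by positivity
    linarith
  -- Outside the ball of this radius the quadratic term alone exceeds `T - inf φ`, so no point there
  -- beats `x₀` and a minimizer over the compact ball is global.
  set R := √(2 * γ * (T - c)) with hR
  have hK : IsCompact (Metric.closedBall x R) := isCompact_closedBall x R
  have key : ∀ w, w ∉ Metric.closedBall x R →
      (T : EReal) ≤ φ w + ((‖w - x‖ ^ 2 / (2 * γ) : ℝ) : EReal) := by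
    intro w hw
    rw [Metric.mem_closedBall, dist_eq_norm, not_le] at hw
    by_cases hwd : w ∈ dom φ
    · rw [← hφ.coe_toReal hwd, ← EReal.coe_add, EReal.coe_le_coe_iff]
      have h1 : 2 * γ * (T - c) ≤ ‖w - x‖ ^ 2 := by
        have := pow_le_pow_left₀ (Real.sqrt_nonneg _) hw.le 2
        rwa [Real.sq_sqrt (by positivity)] at this
      have h2 : T - c ≤ ‖w - x‖ ^ 2 / (2 * γ) := by
        rw [le_div_iff₀ (by positivity)]; linarith
      have := hφ.infOnDom_le hwd
      linarith
    · have : φ w = ⊤ := by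
        simpa [dom] using hwd
      rw [this, EReal.top_add_coe]
      exact le_top
  have hx₀mem : x₀ ∈ Metric.closedBall x R := by
    rw [Metric.mem_closedBall, dist_eq_norm]
    refine Real.le_sqrt_of_sq_le ?_
    have h1 := hφ.infOnDom_le hx₀
    have h2 : ‖x₀ - x‖ ^ 2 / (2 * γ) ≤ T - c := by rw [hT]; linarith
    rw [div_le_iff₀ (by positivity)] at h2
    linarith
  have hlsc : LowerSemicontinuousOn
      (fun y => φ y + ((‖y - x‖ ^ 2 / (2 * γ) : ℝ) : EReal)) (Metric.closedBall x R) := by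
    refine LowerSemicontinuous.lowerSemicontinuousOn ?_ _
    refine LowerSemicontinuous.add' hφ.lsc ?_ ?_
    · refine Continuous.lowerSemicontinuous ?_
      exact continuous_coe_real_ereal.comp (by fun_prop)
    · intro y
      exact EReal.continuousAt_add (Or.inr (EReal.coe_ne_bot _)) (Or.inr (EReal.coe_ne_top _))
  obtain ⟨a, ha, hmin⟩ := LowerSemicontinuousOn.exists_isMinOn ⟨x₀, hx₀mem⟩ hK hlsc
  refine ⟨a, fun w => ?_⟩
  by_cases hw : w ∈ Metric.closedBall x R
  · exact hmin hw
  · refine le_trans (hmin hx₀mem) (le_trans ?_ (key w hw))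
    simp only
    rw [← hφ.coe_toReal hx₀, ← EReal.coe_add]

theorem IsWeaklyConvex.prox_spec (hφ : IsWeaklyConvex φ ρ) (hγ : 0 < γ)
    (x w : EuclideanSpace ℝ (Fin p)) :
    φ (prox φ γ x) + ((‖prox φ γ x - x‖ ^ 2 / (2 * γ) : ℝ) : EReal)
      ≤ φ w + ((‖w - x‖ ^ 2 / (2 * γ) : ℝ) : EReal) :=
  Classical.epsilon_spec (hφ.exists_prox hγ x) w

theorem IsWeaklyConvex.prox_mem (hφ : IsWeaklyConvex φ ρ) (hγ : 0 < γ)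
    (x : EuclideanSpace ℝ (Fin p)) : prox φ γ x ∈ dom φ := by
  obtain ⟨x₀, hx₀⟩ := hφ.proper
  have h := hφ.prox_spec hγ x x₀
  rw [← hφ.coe_toReal hx₀, ← EReal.coe_add] at h
  by_contra hcon
  have : φ (prox φ γ x) = ⊤ := by simpa [dom] using hcon
  rw [this, EReal.top_add_coe, top_le_iff] at h
  exact EReal.coe_ne_top _ h

theorem IsWeaklyConvex.prox_min (hφ : IsWeaklyConvex φ ρ) (hγ : 0 < γ)
    (x : EuclideanSpace ℝ (Fin p)) {w : EuclideanSpace ℝ (Fin p)} (hw : w ∈ dom φ) :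
    (φ (prox φ γ x)).toReal + ‖prox φ γ x - x‖ ^ 2 / (2 * γ)
      ≤ (φ w).toReal + ‖w - x‖ ^ 2 / (2 * γ) := by
  have h := hφ.prox_spec hγ x w
  rw [← hφ.coe_toReal hw, ← hφ.coe_toReal (hφ.prox_mem hγ x), ← EReal.coe_add, ← EReal.coe_add,
    EReal.coe_le_coe_iff] at h
  exact h

/-- Divide by `t` and let `t → 0`. This extracts a first-order optimality condition from comparisons
along a segment. -/
theorem nonneg_of_forall_mul_add_mul_sq {a b : ℝ}
    (h : ∀ t, 0 < t → t < 1 → 0 ≤ t * a + t ^ 2 * b) : 0 ≤ a := by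
  by_contra ha
  push Not at ha
  set t := min (1 / 2) (-a / (2 * (|b| + 1))) with ht
  have hb : 0 < |b| + 1 := by positivity
  have ht0 : 0 < t := lt_min (by norm_num) (div_pos (by linarith) (by positivity))
  have ht1 : t < 1 := lt_of_le_of_lt (min_le_left _ _) (by norm_num)
  have h1 := h t ht0 ht1
  have h2 : 0 ≤ a + t * b := by
    have : 0 ≤ t * (a + t * b) := by linarith [h1]
    exact nonneg_of_mul_nonneg_right this ht0
  have h3 : t * (|b| + 1) ≤ -a / 2 := by
    have := min_le_right (1 / 2) (-a / (2 * (|b| + 1)))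
    rw [← ht, le_div_iff₀ (by positivity)] at this
    linarith
  nlinarith [le_abs_self b]

/-- `γ⁻¹ (z - prox z)` is a `ρ`-weak subgradient of `φ` at `prox z`. -/
theorem IsWeaklyConvex.subgradient (hφ : IsWeaklyConvex φ ρ) (hγ : 0 < γ)
    (z : EuclideanSpace ℝ (Fin p)) {w : EuclideanSpace ℝ (Fin p)} (hw : w ∈ dom φ) :
    (φ (prox φ γ z)).toReal + γ⁻¹ * ⟪z - prox φ γ z, w - prox φ γ z⟫_ℝ
      - ρ / 2 * ‖w - prox φ γ z‖ ^ 2 ≤ (φ w).toReal := by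
  set x := prox φ γ z with hx
  have hxd : x ∈ dom φ := hφ.prox_mem hγ z
  suffices 0 ≤ (φ w).toReal - (φ x).toReal - γ⁻¹ * ⟪z - x, w - x⟫_ℝ + ρ / 2 * ‖w - x‖ ^ 2 by
    linarith
  -- Minimality of `x` is tested against `x + t (w - x)`, where weak convexity bounds `φ`; `b`
  -- collects the terms of order `t²`.
  refine nonneg_of_forall_mul_add_mul_sq
    (b := ‖w - x‖ ^ 2 / (2 * γ) - ρ / 2 * ‖w - x‖ ^ 2) fun t ht0 ht1 => ?_
  have hconv := hφ.convex.2 hxd hw (by linarith : (0 : ℝ) ≤ 1 - t) ht0.le (by ring)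
  have hmem := hφ.convex.1 hxd hw (by linarith : (0 : ℝ) ≤ 1 - t) ht0.le (by ring)
  have hmin := hφ.prox_min hγ z hmem
  rw [← hx] at hmin
  have e1 : (1 - t) • x + t • w = x + t • (w - x) := by module
  rw [e1] at hmin hconv
  have e2 : x + t • (w - x) - z = (x - z) + t • (w - x) := by module
  have e3 : ‖x + t • (w - x) - z‖ ^ 2
      = ‖x - z‖ ^ 2 - 2 * t * ⟪z - x, w - x⟫_ℝ + t ^ 2 * ‖w - x‖ ^ 2 := by
    rw [e2, norm_add_sq_real, inner_smul_right, norm_smul, mul_pow, Real.norm_eq_abs, sq_abs,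
      ← neg_sub z x, inner_neg_left, norm_neg]
    ring
  have e4 : ‖x + t • (w - x)‖ ^ 2
      = (1 - t) * ‖x‖ ^ 2 + t * ‖w‖ ^ 2 - t * (1 - t) * ‖w - x‖ ^ 2 := by
    rw [norm_add_sq_real, inner_smul_right, norm_smul, mul_pow, Real.norm_eq_abs, sq_abs,
      norm_sub_sq_real, inner_sub_right, real_inner_self_eq_norm_sq, real_inner_comm]
    ring
  rw [e3] at hmin
  simp only [smul_eq_mul] at hconv
  rw [e4] at hconv
  have e5 : (‖x - z‖ ^ 2 - 2 * t * ⟪z - x, w - x⟫_ℝ + t ^ 2 * ‖w - x‖ ^ 2) / (2 * γ)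
      = ‖x - z‖ ^ 2 / (2 * γ) - t * (γ⁻¹ * ⟪z - x, w - x⟫_ℝ)
        + t ^ 2 * (‖w - x‖ ^ 2 / (2 * γ)) := by
    field_simp
  rw [e5] at hmin
  nlinarith

/-- Adding the weak subgradient inequalities at the two prox points cancels `φ`. With Cauchy–Schwarz
this yields the Lipschitz bound, and for `γρ < 1` it gives the sign of the inner product used in
`merit_step_le`. -/
theorem IsWeaklyConvex.inner_prox_sub (hφ : IsWeaklyConvex φ ρ) (hγ : 0 < γ)
    (z z' : EuclideanSpace ℝ (Fin p)) :
    (1 - γ * ρ) * ‖prox φ γ z' - prox φ γ z‖ ^ 2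
      ≤ ⟪z' - z, prox φ γ z' - prox φ γ z⟫_ℝ := by
  have h1 := hφ.subgradient hγ z (hφ.prox_mem hγ z')
  have h2 := hφ.subgradient hγ z' (hφ.prox_mem hγ z)
  set x := prox φ γ z
  set x' := prox φ γ z'
  have e1 : ‖x - x'‖ = ‖x' - x‖ := norm_sub_rev _ _
  have e2 : ⟪z' - x', x - x'⟫_ℝ = - ⟪z' - x', x' - x⟫_ℝ := by
    rw [← neg_sub x' x, inner_neg_right]
  have e3 : ⟪z' - x', x' - x⟫_ℝ - ⟪z - x, x' - x⟫_ℝ = ⟪z' - z, x' - x⟫_ℝ - ‖x' - x‖ ^ 2 := by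
    rw [← inner_sub_left, ← real_inner_self_eq_norm_sq, ← inner_sub_left]
    congr 1; abel
  rw [e1, e2] at h2
  have h3 : γ⁻¹ * (⟪z - x, x' - x⟫_ℝ - ⟪z' - x', x' - x⟫_ℝ) ≤ ρ * ‖x' - x‖ ^ 2 := by linarith
  rw [inv_mul_le_iff₀ hγ] at h3
  nlinarith

theorem IsWeaklyConvex.norm_prox_sub_le (hφ : IsWeaklyConvex φ ρ) (hγ : 0 < γ)
    (z z' : EuclideanSpace ℝ (Fin p)) :
    (1 - γ * ρ) * ‖prox φ γ z' - prox φ γ z‖ ≤ ‖z' - z‖ := by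
  have h := hφ.inner_prox_sub hγ z z'
  have h2 := real_inner_le_norm (z' - z) (prox φ γ z' - prox φ γ z)
  rcases (norm_nonneg (prox φ γ z' - prox φ γ z)).eq_or_lt with h0 | h0
  · rw [← h0]; simp
  · refine le_of_mul_le_mul_right ?_ h0
    nlinarith

/-- When `γρ ≤ 1/4`, the proximal operator is `4/3`-Lipschitz. -/
theorem IsWeaklyConvex.norm_prox_sub_le' (hφ : IsWeaklyConvex φ ρ) (hγ : 0 < γ)
    (hγρ : γ * ρ ≤ 1 / 4) (z z' : EuclideanSpace ℝ (Fin p)) :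
    ‖prox φ γ z' - prox φ γ z‖ ≤ 4 / 3 * ‖z' - z‖ := by
  have h := hφ.norm_prox_sub_le hγ z z'
  nlinarith [norm_nonneg (prox φ γ z' - prox φ γ z)]

theorem IsWeaklyConvex.continuous_prox (hφ : IsWeaklyConvex φ ρ) (hγ : 0 < γ)
    (hγρ : γ * ρ ≤ 1 / 4) : Continuous (prox φ γ) := by
  have : LipschitzWith (4 / 3) (prox φ γ) := by
    refine LipschitzWith.of_dist_le_mul fun x y => ?_
    rw [dist_eq_norm, dist_eq_norm]
    simpa using hφ.norm_prox_sub_le' hγ hγρ y x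
  exact this.continuous

end Prox

/-! ### Functions with Lipschitz gradient near the effective domain -/

section Smooth

variable {p : ℕ}

/-- The quadratic upper and lower bounds for a function with Lipschitz gradient along a segment. -/
theorem abs_sub_sub_inner_le {h : EuclideanSpace ℝ (Fin p) → ℝ} {S : Set (EuclideanSpace ℝ (Fin p))}
    {L : ℝ} (hS : IsOpen S) (hd : DifferentiableOn ℝ h S)
    (hlip : ∀ x ∈ S, ∀ y ∈ S, ‖gradient h x - gradient h y‖ ≤ L * ‖x - y‖)
    {x v : EuclideanSpace ℝ (Fin p)} (hseg : ∀ t ∈ Set.Icc (0 : ℝ) 1, x + t • v ∈ S) :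
    |h (x + v) - h x - ⟪gradient h x, v⟫_ℝ| ≤ L / 2 * ‖v‖ ^ 2 := by
  have hx : x ∈ S := by simpa using hseg 0 (by simp)
  have hder : ∀ t ∈ Set.Icc (0 : ℝ) 1,
      HasDerivAt (fun t : ℝ => h (x + t • v)) ⟪gradient h (x + t • v), v⟫_ℝ t := by
    intro t ht
    have hmem := hseg t ht
    have h1 : HasFDerivAt h (fderiv ℝ h (x + t • v)) (x + t • v) :=
      ((hd _ hmem).differentiableAt (hS.mem_nhds hmem)).hasFDerivAt
    have h2 : HasDerivAt (fun t : ℝ => x + t • v) v t := by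
      simpa using ((hasDerivAt_id t).smul_const v).const_add x
    have h3 := h1.comp_hasDerivAt t h2
    have h4 : ⟪gradient h (x + t • v), v⟫_ℝ = fderiv ℝ h (x + t • v) v := by
      rw [gradient, InnerProductSpace.toDual_symm_apply]
    rw [h4]
    exact h3
  have hbound : ∀ t ∈ Set.Icc (0 : ℝ) 1,
      |⟪gradient h (x + t • v), v⟫_ℝ - ⟪gradient h x, v⟫_ℝ| ≤ L * t * ‖v‖ ^ 2 := by
    intro t ht
    rw [← inner_sub_left]
    refine (abs_real_inner_le_norm _ _).trans ?_
    have h1 := hlip _ (hseg t ht) _ hx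
    rw [add_sub_cancel_left, norm_smul, Real.norm_eq_abs, abs_of_nonneg ht.1] at h1
    nlinarith [norm_nonneg v]
  -- The signs `s = 1` and `s = -1` give the two halves of the absolute value. The quadratic in `k`
  -- offsets the derivative error `L t ‖v‖²`, so `k` decreases and `k 1 ≤ k 0` is the claim.
  have aux : ∀ s : ℝ, |s| = 1 →
      s * (h (x + v) - h x - ⟪gradient h x, v⟫_ℝ) ≤ L / 2 * ‖v‖ ^ 2 := by
    intro s hs
    let k : ℝ → ℝ := fun t => s * (h (x + t • v) - t * ⟪gradient h x, v⟫_ℝ) - L / 2 * t ^ 2 * ‖v‖ ^ 2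
    have hk : ∀ t ∈ Set.Icc (0 : ℝ) 1, HasDerivAt k
        (s * (⟪gradient h (x + t • v), v⟫_ℝ - ⟪gradient h x, v⟫_ℝ) - L * t * ‖v‖ ^ 2) t := by
      intro t ht
      have h1 := (((hder t ht).sub ((hasDerivAt_id t).mul_const ⟪gradient h x, v⟫_ℝ)).const_mul s).sub
        ((((hasDerivAt_id t).pow 2).const_mul (L / 2)).mul_const (‖v‖ ^ 2))
      exact HasDerivAt.congr_deriv (f := k) h1 (by
        simp only [id_eq, Nat.cast_ofNat, Nat.add_one_sub_one, pow_one]; ring)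
    have hanti : AntitoneOn k (Set.Icc 0 1) := by
      refine antitoneOn_of_deriv_nonpos (convex_Icc 0 1)
        (fun t ht => (hk t ht).continuousAt.continuousWithinAt)
        (fun t ht => (hk t (interior_subset ht)).differentiableAt.differentiableWithinAt) ?_
      intro t ht
      have ht' := interior_subset ht
      rw [(hk t ht').deriv]
      have h1 := hbound t ht'
      have h2 := le_abs_self (s * (⟪gradient h (x + t • v), v⟫_ℝ - ⟪gradient h x, v⟫_ℝ))
      rw [abs_mul, hs, one_mul] at h2
      linarith
    have := hanti (by simp : (0 : ℝ) ∈ Set.Icc 0 1) (by simp : (1 : ℝ) ∈ Set.Icc 0 1) zero_le_one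
    simp only [k, one_smul, zero_smul, add_zero, one_mul, zero_mul, one_pow] at this
    nlinarith
  have h1 := aux 1 (by simp)
  have h2 := aux (-1) (by simp)
  rw [abs_le]
  constructor <;> linarith

variable {n : ℕ} {φ : EuclideanSpace ℝ (Fin p) → EReal} {ρ γ L : ℝ}
  {f : Fin n → EuclideanSpace ℝ (Fin p) → ℝ} {S : Set (EuclideanSpace ℝ (Fin p))}

theorem IsSmoothFamily.abs_sub_sub_inner_le (hf : IsSmoothFamily f φ L S)
    (hφ : IsWeaklyConvex φ ρ) (i : Fin n) {x y : EuclideanSpace ℝ (Fin p)}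
    (hx : x ∈ dom φ) (hy : y ∈ dom φ) :
    |f i y - f i x - ⟪gradient (f i) x, y - x⟫_ℝ| ≤ L / 2 * ‖y - x‖ ^ 2 := by
  have := NormED.abs_sub_sub_inner_le hf.isOpen (hf.differentiableOn i) (hf.lipschitz i)
    (x := x) (v := y - x) (fun t ht => hf.dom_subset ?_)
  · simpa using this
  · have := hφ.convex.1 hx hy (by linarith [ht.2] : (0 : ℝ) ≤ 1 - t) ht.1 (by ring)
    convert this using 1
    module

/-- The gradient is dominated by the gap to the infimum. -/
theorem IsSmoothFamily.norm_gradient_sq_le (hL : 0 < L) (hf : IsSmoothFamily f φ L S) (i : Fin n)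
    {x : EuclideanSpace ℝ (Fin p)} (hx : x ∈ dom φ) :
    ‖gradient (f i) x‖ ^ 2 ≤ 2 * L * (f i x - infOnDom φ (f i)) := by
  -- The gradient step of length `1 / L` stays in `S` but may leave `dom φ`. The lower bound on `f
  -- i` is available there too, because it holds on the whole space.
  have := NormED.abs_sub_sub_inner_le hf.isOpen (hf.differentiableOn i) (hf.lipschitz i)
    (x := x) (v := -(1 / L) • gradient (f i) x) (fun t ht => ?_)
  · have h1 := (abs_le.1 this).2
    have h2 := hf.inf_le i (x + -(1 / L) • gradient (f i) x)
    rw [inner_smul_right, real_inner_self_eq_norm_sq, norm_smul, mul_pow, Real.norm_eq_abs,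
      sq_abs] at h1
    have e : L / 2 * ((-(1 / L)) ^ 2 * ‖gradient (f i) x‖ ^ 2)
        = 1 / (2 * L) * ‖gradient (f i) x‖ ^ 2 := by field_simp
    have e2 : -(1 / L) * ‖gradient (f i) x‖ ^ 2 = - 2 * (1 / (2 * L) * ‖gradient (f i) x‖ ^ 2) := by
      field_simp
    rw [e, e2] at h1
    have h3 : 1 / (2 * L) * ‖gradient (f i) x‖ ^ 2 ≤ f i x - infOnDom φ (f i) := by linarith
    rw [one_div, inv_mul_le_iff₀ (by positivity)] at h3
    exact h3
  · have := hf.step_mem i x hx (t * (1 / L))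
      ⟨mul_nonneg ht.1 (by positivity), mul_le_of_le_one_left (by positivity) ht.2⟩
    convert this using 1
    module

/-- Comparison of the gaps at two points. -/
theorem IsSmoothFamily.gap_le (hL : 0 < L) (hf : IsSmoothFamily f φ L S)
    (hφ : IsWeaklyConvex φ ρ) (i : Fin n) {x y : EuclideanSpace ℝ (Fin p)}
    (hx : x ∈ dom φ) (hy : y ∈ dom φ) :
    f i y - infOnDom φ (f i) ≤ 2 * (f i x - infOnDom φ (f i)) + L * ‖y - x‖ ^ 2 := by
  have h1 := (abs_le.1 (hf.abs_sub_sub_inner_le hφ i hx hy)).2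
  have h2 := hf.norm_gradient_sq_le hL i hx
  have h3 := real_inner_le_norm (gradient (f i) x) (y - x)
  -- The Young weights make the gradient part `‖∇f‖² / (2L)`, which is at most the gap at `x`; hence
  -- the factor 2 in the claim.
  have h4 : ‖gradient (f i) x‖ * ‖y - x‖
      ≤ 1 / (2 * L) * ‖gradient (f i) x‖ ^ 2 + L / 2 * ‖y - x‖ ^ 2 := by
    have : 0 ≤ 1 / (2 * L) * (‖gradient (f i) x‖ - L * ‖y - x‖) ^ 2 := by positivity
    have e : 1 / (2 * L) * (‖gradient (f i) x‖ - L * ‖y - x‖) ^ 2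
        = 1 / (2 * L) * ‖gradient (f i) x‖ ^ 2 + L / 2 * ‖y - x‖ ^ 2
          - ‖gradient (f i) x‖ * ‖y - x‖ := by field_simp; ring
    linarith
  have h5 : 1 / (2 * L) * ‖gradient (f i) x‖ ^ 2 ≤ f i x - infOnDom φ (f i) := by
    rw [one_div, inv_mul_le_iff₀ (by positivity)]
    exact h2
  linarith

theorem IsSmoothFamily.gradient_avgFun (hf : IsSmoothFamily f φ L S)
    {x : EuclideanSpace ℝ (Fin p)} (hx : x ∈ S) :
    gradient (avgFun f) x = (n : ℝ)⁻¹ • ∑ i, gradient (f i) x := by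
  have hd : ∀ i, HasGradientAt (f i) (gradient (f i) x) x := fun i =>
    ((hf.differentiableOn i x hx).differentiableAt (hf.isOpen.mem_nhds hx)).hasGradientAt
  refine HasGradientAt.gradient ?_
  rw [hasGradientAt_iff_hasFDerivAt]
  have h1 : HasFDerivAt (fun x => ∑ i, f i x)
      (∑ i, (InnerProductSpace.toDual ℝ _) (gradient (f i) x)) x :=
    HasFDerivAt.fun_sum fun i _ => (hd i).hasFDerivAt
  have h2 := h1.const_mul (n : ℝ)⁻¹
  exact h2.congr_fderiv (by simp [map_sum])

theorem IsSmoothFamily.infOnDom_avgFun_le (hf : IsSmoothFamily f φ L S)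
    {x : EuclideanSpace ℝ (Fin p)} (hx : x ∈ dom φ) : infOnDom φ (avgFun f) ≤ avgFun f x := by
  refine csInf_le ⟨(n : ℝ)⁻¹ * ∑ i, infOnDom φ (f i), ?_⟩ ⟨x, hx, rfl⟩
  rintro _ ⟨y, -, rfl⟩
  exact mul_le_mul_of_nonneg_left (Finset.sum_le_sum fun i _ => hf.inf_le i y) (by positivity)

end Smooth

end NormED

namespace NormED

open Filter Topology
open scoped InnerProductSpace

/-! ### The normal map and descent of the merit function -/

section NormalMap

variable {n p : ℕ} {φ : EuclideanSpace ℝ (Fin p) → EReal} {ρ γ L : ℝ}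
  {f : Fin n → EuclideanSpace ℝ (Fin p) → ℝ} {S : Set (EuclideanSpace ℝ (Fin p))}

/-- With `prox` being `1/(1 - γρ)`-Lipschitz, the triangle inequality gives `(L + γ⁻¹)/(1 - γρ) +
γ⁻¹`, which is `LF`. -/
theorem norm_Fnor_sub_le (hL : 0 < L) (hφ : IsWeaklyConvex φ ρ) (hf : IsSmoothFamily f φ L S)
    (hγ : 0 < γ) (hγρ : γ * ρ ≤ 1 / 4) (i : Fin n) (z z' : EuclideanSpace ℝ (Fin p)) :
    ‖Fnor (f i) φ γ z' - Fnor (f i) φ γ z‖ ≤ LF L ρ γ * ‖z' - z‖ := by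
  have h1 := hφ.norm_prox_sub_le hγ z z'
  have h2 := hf.lipschitz i _ (hf.dom_subset (hφ.prox_mem hγ z')) _
    (hf.dom_subset (hφ.prox_mem hγ z))
  have e : Fnor (f i) φ γ z' - Fnor (f i) φ γ z
      = (gradient (f i) (prox φ γ z') - gradient (f i) (prox φ γ z))
        + γ⁻¹ • ((z' - z) - (prox φ γ z' - prox φ γ z)) := by
    simp only [Fnor, smul_sub]; abel
  have h3 : ‖Fnor (f i) φ γ z' - Fnor (f i) φ γ z‖
      ≤ L * ‖prox φ γ z' - prox φ γ z‖ + γ⁻¹ * (‖z' - z‖ + ‖prox φ γ z' - prox φ γ z‖) := by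
    rw [e]
    refine (norm_add_le _ _).trans (add_le_add h2 ?_)
    rw [norm_smul, Real.norm_of_nonneg (by positivity)]
    gcongr
    exact norm_sub_le _ _
  refine h3.trans ?_
  rw [LF, div_mul_eq_mul_div, le_div_iff₀ (by linarith)]
  have hi : 0 < γ⁻¹ := by positivity
  have hg : γ * γ⁻¹ = 1 := mul_inv_cancel₀ hγ.ne'
  have h4 := mul_le_mul_of_nonneg_left h1 (by positivity : 0 ≤ L + γ⁻¹)
  rw [div_eq_mul_inv]
  calc (L * ‖prox φ γ z' - prox φ γ z‖ + γ⁻¹ * (‖z' - z‖ + ‖prox φ γ z' - prox φ γ z‖))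
        * (1 - γ * ρ)
      = (L + γ⁻¹) * ((1 - γ * ρ) * ‖prox φ γ z' - prox φ γ z‖)
        + (γ⁻¹ - (γ * γ⁻¹) * ρ) * ‖z' - z‖ := by ring
    _ ≤ (L + γ⁻¹) * ‖z' - z‖ + (γ⁻¹ - (γ * γ⁻¹) * ρ) * ‖z' - z‖ := by linarith
    _ = (L - ρ + 2 * γ⁻¹) * ‖z' - z‖ := by rw [hg]; ring

/-- At a common point `z` the prox part is the same for all components and the gradient is linear in
the function. The step of the average can thus be compared with component maps evaluated at
different points. -/
theorem Fnor_avgFun (hn : 0 < n) (hφ : IsWeaklyConvex φ ρ) (hf : IsSmoothFamily f φ L S)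
    (hγ : 0 < γ) (z : EuclideanSpace ℝ (Fin p)) :
    Fnor (avgFun f) φ γ z = mean fun i => Fnor (f i) φ γ z := by
  have hn' : (n : ℝ) ≠ 0 := by positivity
  simp only [Fnor, mean]
  rw [hf.gradient_avgFun (hf.dom_subset (hφ.prox_mem hγ z)), Finset.sum_add_distrib, smul_add]
  simp [← Nat.cast_smul_eq_nsmul ℝ, smul_smul, hn']

theorem norm_mean_le {z : Fin n → EuclideanSpace ℝ (Fin p)} {c : ℝ} (hc : 0 ≤ c)
    (h : ∀ i, ‖z i‖ ≤ c) : ‖mean z‖ ≤ c := by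
  rw [mean, norm_smul, norm_inv, Real.norm_natCast]
  rcases Nat.eq_zero_or_pos n with hn | hn
  · subst hn; simpa using hc
  · rw [inv_mul_le_iff₀ (by positivity)]
    refine (norm_sum_le _ _).trans ((Finset.sum_le_sum fun i _ => h i).trans ?_)
    simp

theorem mean_sub (z w : Fin n → EuclideanSpace ℝ (Fin p)) :
    mean (fun i => z i - w i) = mean z - mean w := by
  simp [mean, Finset.sum_sub_distrib, smul_sub]

theorem norm_Fnor_avgFun_sub_le (hn : 0 < n) (hL : 0 < L) (hφ : IsWeaklyConvex φ ρ)
    (hf : IsSmoothFamily f φ L S) (hγ : 0 < γ) (hγρ : γ * ρ ≤ 1 / 4)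
    (z z' : EuclideanSpace ℝ (Fin p)) :
    ‖Fnor (avgFun f) φ γ z' - Fnor (avgFun f) φ γ z‖ ≤ LF L ρ γ * ‖z' - z‖ := by
  rw [Fnor_avgFun hn hφ hf hγ, Fnor_avgFun hn hφ hf hγ, ← mean_sub]
  have h := fun i => norm_Fnor_sub_le hL hφ hf hγ hγρ i z z'
  exact norm_mean_le ((norm_nonneg _).trans (h ⟨0, hn⟩)) h

/-- The natural residual at `prox z` is dominated by the normal map at `z`. -/
theorem norm_Fnat_prox_le (h : EuclideanSpace ℝ (Fin p) → ℝ) (hφ : IsWeaklyConvex φ ρ)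
    (hγ : 0 < γ) (hγρ : γ * ρ ≤ 1 / 4) (z : EuclideanSpace ℝ (Fin p)) :
    ‖γ⁻¹ • Fnat h φ γ (prox φ γ z)‖ ≤ 4 / 3 * ‖Fnor h φ γ z‖ := by
  have h1 := hφ.norm_prox_sub_le' hγ hγρ (prox φ γ z - γ • gradient h (prox φ γ z)) z
  -- The natural residual is a difference of two prox values whose arguments differ by `γ` times the
  -- normal map.
  have e : z - (prox φ γ z - γ • gradient h (prox φ γ z)) = γ • Fnor h φ γ z := by
    rw [Fnor, smul_add, smul_smul, mul_inv_cancel₀ hγ.ne', one_smul]; abel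
  rw [e, norm_smul, Real.norm_of_nonneg hγ.le] at h1
  rw [norm_smul, Real.norm_of_nonneg (by positivity), inv_mul_le_iff₀ hγ, Fnat]
  linarith

theorem psiGap_nonneg (hφ : IsWeaklyConvex φ ρ) (hf : IsSmoothFamily f φ L S)
    {x : EuclideanSpace ℝ (Fin p)} (hx : x ∈ dom φ) : 0 ≤ psiGap f φ x := by
  have h1 := hf.infOnDom_avgFun_le hx
  have h2 := hφ.infOnDom_le hx
  rw [psiGap]; linarith

/-- The merit function `ψ(prox z) - ψ̄ + (γ/2) ‖F_nor(z)‖²`. -/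
noncomputable def merit (f : Fin n → EuclideanSpace ℝ (Fin p) → ℝ)
    (φ : EuclideanSpace ℝ (Fin p) → EReal) (γ : ℝ) (z : EuclideanSpace ℝ (Fin p)) : ℝ :=
  psiGap f φ (prox φ γ z) + γ / 2 * ‖Fnor (avgFun f) φ γ z‖ ^ 2

theorem merit_nonneg (hφ : IsWeaklyConvex φ ρ) (hf : IsSmoothFamily f φ L S) (hγ : 0 < γ)
    (z : EuclideanSpace ℝ (Fin p)) : 0 ≤ merit f φ γ z :=
  add_nonneg (psiGap_nonneg hφ hf (hφ.prox_mem hγ z)) (by positivity)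

theorem avgFun_sub_le (hn : 0 < n) (hφ : IsWeaklyConvex φ ρ) (hf : IsSmoothFamily f φ L S)
    {x y : EuclideanSpace ℝ (Fin p)} (hx : x ∈ dom φ) (hy : y ∈ dom φ) :
    avgFun f y - avgFun f x ≤ ⟪gradient (avgFun f) x, y - x⟫_ℝ + L / 2 * ‖y - x‖ ^ 2 := by
  have hn' : (0 : ℝ) < n := by positivity
  have h := Finset.sum_le_sum fun i (_ : i ∈ Finset.univ) =>
    (abs_le.1 (hf.abs_sub_sub_inner_le hφ i hx hy)).2
  simp only [Finset.sum_sub_distrib, Finset.sum_const, Finset.card_univ, Fintype.card_fin,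
    nsmul_eq_mul] at h
  rw [hf.gradient_avgFun (hf.dom_subset hx), inner_smul_left, sum_inner]
  simp only [avgFun, conj_trivial]
  have h2 := mul_le_mul_of_nonneg_left h (inv_nonneg.2 hn'.le)
  rw [inv_mul_cancel_left₀ hn'.ne'] at h2
  linarith

theorem norm_gradient_avgFun_sub_le (hL : 0 < L) (hf : IsSmoothFamily f φ L S)
    {x y : EuclideanSpace ℝ (Fin p)} (hx : x ∈ dom φ) (hy : y ∈ dom φ) :
    ‖gradient (avgFun f) y - gradient (avgFun f) x‖ ≤ L * ‖y - x‖ := by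
  rw [hf.gradient_avgFun (hf.dom_subset hx), hf.gradient_avgFun (hf.dom_subset hy), ← smul_sub,
    ← Finset.sum_sub_distrib]
  exact norm_mean_le (n := n) (z := fun i => gradient (f i) y - gradient (f i) x) (by positivity)
    fun i => hf.lipschitz i _ (hf.dom_subset hy) _ (hf.dom_subset hx)

/-- Descent of the merit function along an inexact normal map step. -/
theorem merit_step_le (hn : 0 < n) (hL : 0 < L) (hρ : 0 < ρ) (hφ : IsWeaklyConvex φ ρ)
    (hf : IsSmoothFamily f φ L S) (hγ : 0 < γ) (hγs : γ * (ρ + L) ≤ 1 / 4) {α : ℝ} (hα : 0 < α)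
    (hαγ : α ≤ γ / 100) (y r : EuclideanSpace ℝ (Fin p)) :
    merit f φ γ (y - α • (Fnor (avgFun f) φ γ y + r))
      ≤ merit f φ γ y - α / 4 * ‖Fnor (avgFun f) φ γ y‖ ^ 2 + 2 * α * ‖r‖ ^ 2 := by
  have hγρ : γ * ρ ≤ 1 / 4 := by nlinarith
  have hγL : γ * L ≤ 1 / 4 := by nlinarith
  set F := Fnor (avgFun f) φ γ y with hF
  set y' := y - α • (F + r) with hy'
  set d := y' - y with hd
  set x := prox φ γ y with hx
  set x' := prox φ γ y' with hx'
  set e := x' - x with he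
  set D := gradient (avgFun f) x' - gradient (avgFun f) x with hD
  have hxd : x ∈ dom φ := hφ.prox_mem hγ y
  have hxd' : x' ∈ dom φ := hφ.prox_mem hγ y'
  have hDle : ‖D‖ ≤ L * ‖e‖ := norm_gradient_avgFun_sub_le hL hf hxd hxd'
  have hele : ‖e‖ ≤ 4 / 3 * ‖d‖ := hφ.norm_prox_sub_le' hγ hγρ y y'
  -- Monotonicity of the prox: after `hE1` and `hE2` are added, this inner product survives with the
  -- favourable sign.
  have hI3 : 0 ≤ ⟪d, e⟫_ℝ :=
    le_trans (mul_nonneg (by linarith) (by positivity)) (hφ.inner_prox_sub hγ y y')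
  have hFdef : F = gradient (avgFun f) x + γ⁻¹ • (y - x) := rfl
  set i := γ⁻¹ with hi
  have hi0 : 0 < i := by positivity
  have hgi : γ * i = 1 := mul_inv_cancel₀ hγ.ne'
  -- decrease of the objective
  have hE1 : psiGap f φ x' - psiGap f φ x
      ≤ ⟪F, e⟫_ℝ + i * ⟪d, e⟫_ℝ - i * ‖e‖ ^ 2 + (L + ρ) / 2 * ‖e‖ ^ 2 := by
    have h1 := avgFun_sub_le hn hφ hf hxd hxd'
    have h2 := hφ.subgradient hγ y' hxd
    rw [← hx', ← hi, ← neg_sub x' x, ← he, inner_neg_right, norm_neg] at h2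
    have h3 : y' - x' = (y - x) + d - e := by rw [hd, he]; abel
    rw [h3, inner_sub_left, inner_add_left, real_inner_self_eq_norm_sq] at h2
    rw [hFdef, inner_add_left, inner_smul_left, conj_trivial]
    rw [← he] at h1
    simp only [psiGap]
    linarith
  -- The weight `γ / 2` of the merit function is chosen for this cancellation: in the sum with `hE1`
  -- the terms `⟪F, e⟫` and `i ‖e‖²` disappear and `i ⟪d, e⟫` keeps coefficient `-1`. The leading
  -- term left is `⟪F, d⟫`, about `-α ‖F‖²`.
  have hE2 : γ / 2 * ‖Fnor (avgFun f) φ γ y'‖ ^ 2 - γ / 2 * ‖F‖ ^ 2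
      ≤ γ * ⟪F, D⟫_ℝ + ⟪F, d⟫_ℝ - ⟪F, e⟫_ℝ + γ * ‖D‖ ^ 2
        + i * (‖d‖ ^ 2 - 2 * ⟪d, e⟫_ℝ + ‖e‖ ^ 2) := by
    have h1 : Fnor (avgFun f) φ γ y' = F + (D + i • (d - e)) := by
      rw [hFdef]
      simp only [Fnor, ← hx', hD, hd, he, smul_sub]
      abel
    have h2 : ‖D + i • (d - e)‖ ^ 2 ≤ 2 * ‖D‖ ^ 2 + 2 * ‖i • (d - e)‖ ^ 2 := by
      have := parallelogram_law_with_norm ℝ D (i • (d - e))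
      nlinarith [norm_nonneg (D - i • (d - e))]
    rw [norm_smul, mul_pow, Real.norm_of_nonneg hi0.le, norm_sub_sq_real d e] at h2
    rw [h1, norm_add_sq_real, inner_add_right, inner_smul_right, inner_sub_right F d e]
    have h3 := mul_le_mul_of_nonneg_left h2 (by positivity : 0 ≤ γ / 2)
    have h4 : γ / 2 * (2 * ‖D‖ ^ 2 + 2 * (i ^ 2 * (‖d‖ ^ 2 - 2 * ⟪d, e⟫_ℝ + ‖e‖ ^ 2)))
        = γ * ‖D‖ ^ 2 + (γ * i) * i * (‖d‖ ^ 2 - 2 * ⟪d, e⟫_ℝ + ‖e‖ ^ 2) := by ring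
    rw [h4, hgi, one_mul] at h3
    have h5 : γ / 2 * (2 * (⟪F, D⟫_ℝ + i * (⟪F, d⟫_ℝ - ⟪F, e⟫_ℝ)))
        = γ * ⟪F, D⟫_ℝ + (γ * i) * (⟪F, d⟫_ℝ - ⟪F, e⟫_ℝ) := by ring
    rw [hgi, one_mul] at h5
    linarith
  have hdα : d = -(α • (F + r)) := by rw [hd, hy']; abel
  have hFd : ⟪F, d⟫_ℝ ≤ -(α * ‖F‖ ^ 2) + α * (‖F‖ * ‖r‖) := by
    rw [hdα, inner_neg_right, inner_smul_right, inner_add_right, real_inner_self_eq_norm_sq]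
    have h1 := mul_le_mul_of_nonneg_left (neg_le_of_abs_le (abs_real_inner_le_norm F r)) hα.le
    linarith
  have hdn : ‖d‖ ≤ α * (‖F‖ + ‖r‖) := by
    rw [hdα, norm_neg, norm_smul, Real.norm_of_nonneg hα.le]
    exact mul_le_mul_of_nonneg_left (norm_add_le _ _) hα.le
  have hFD : γ * ⟪F, D⟫_ℝ ≤ 1 / 3 * (‖F‖ * ‖d‖) := by
    have h1 := real_inner_le_norm F D
    have h2 : γ * ‖D‖ ≤ 1 / 3 * ‖d‖ := by
      calc γ * ‖D‖ ≤ γ * (L * (4 / 3 * ‖d‖)) := by gcongr; exact hDle.trans (by gcongr)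
        _ = (γ * L) * (4 / 3 * ‖d‖) := by ring
        _ ≤ 1 / 4 * (4 / 3 * ‖d‖) := by gcongr
        _ = _ := by ring
    calc γ * ⟪F, D⟫_ℝ ≤ γ * (‖F‖ * ‖D‖) := by gcongr
      _ = ‖F‖ * (γ * ‖D‖) := by ring
      _ ≤ ‖F‖ * (1 / 3 * ‖d‖) := by gcongr
      _ = _ := by ring
  have hquad : (L + ρ) / 2 * ‖e‖ ^ 2 + γ * ‖D‖ ^ 2 ≤ i / 3 * ‖d‖ ^ 2 := by
    have h1 : γ * ‖D‖ ^ 2 ≤ i / 16 * ‖e‖ ^ 2 := by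
      have h2 : ‖D‖ ^ 2 ≤ (L * ‖e‖) ^ 2 := by gcongr
      calc γ * ‖D‖ ^ 2 ≤ γ * (L * ‖e‖) ^ 2 := by gcongr
        _ = (γ * i) * γ * (L * ‖e‖) ^ 2 := by rw [hgi]; ring
        _ = i * (γ * L) ^ 2 * ‖e‖ ^ 2 := by ring
        _ ≤ i * (1 / 4) ^ 2 * ‖e‖ ^ 2 := by gcongr
        _ = _ := by ring
    have h3 : (L + ρ) / 2 ≤ i / 8 := by
      have : (L + ρ) = i * (γ * (ρ + L)) := by linear_combination (-(ρ + L)) * hgi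
      have h2 := mul_le_mul_of_nonneg_left hγs hi0.le
      rw [this]; linarith
    have h4 : ‖e‖ ^ 2 ≤ 16 / 9 * ‖d‖ ^ 2 := by
      calc ‖e‖ ^ 2 ≤ (4 / 3 * ‖d‖) ^ 2 := by gcongr
        _ = _ := by ring
    have h5 := mul_le_mul_of_nonneg_right h3 (sq_nonneg ‖e‖)
    have h6 := mul_le_mul_of_nonneg_left h4 hi0.le
    linarith
  -- The condition `α ≤ γ / 100` makes everything quadratic in the step negligible against `α ‖F‖²`.
  have hid : i * ‖d‖ ^ 2 ≤ α / 50 * (‖F‖ ^ 2 + ‖r‖ ^ 2) := by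
    have h1 : i * α ≤ 1 / 100 := by
      have := mul_le_mul_of_nonneg_left hαγ hi0.le
      linarith
    calc i * ‖d‖ ^ 2 ≤ i * (α * (‖F‖ + ‖r‖)) ^ 2 := by gcongr
      _ = (i * α) * α * (‖F‖ + ‖r‖) ^ 2 := by ring
      _ ≤ 1 / 100 * α * (2 * (‖F‖ ^ 2 + ‖r‖ ^ 2)) := by
        gcongr
        linarith [sq_nonneg (‖F‖ - ‖r‖)]
      _ = _ := by ring
  have hFdn : ‖F‖ * ‖d‖ ≤ α * ‖F‖ ^ 2 + α * (‖F‖ * ‖r‖) := by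
    calc ‖F‖ * ‖d‖ ≤ ‖F‖ * (α * (‖F‖ + ‖r‖)) := by gcongr
      _ = _ := by ring
  have hcross : α * (‖F‖ * ‖r‖) ≤ α * (1 / 4 * ‖F‖ ^ 2 + ‖r‖ ^ 2) := by
    refine mul_le_mul_of_nonneg_left ?_ hα.le
    linarith [sq_nonneg (‖F‖ / 2 - ‖r‖)]
  have hI3' : 0 ≤ i * ⟪d, e⟫_ℝ := mul_nonneg hi0.le hI3
  have e1 : merit f φ γ y' = psiGap f φ x' + γ / 2 * ‖Fnor (avgFun f) φ γ y'‖ ^ 2 := rfl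
  have e2 : merit f φ γ y = psiGap f φ x + γ / 2 * ‖F‖ ^ 2 := rfl
  rw [e1, e2]
  have hp1 : 0 ≤ α * ‖F‖ ^ 2 := by positivity
  have hp2 : 0 ≤ α * ‖r‖ ^ 2 := by positivity
  linarith

end NormalMap

/-! ### Continuity and integrability of objective values along prox points -/

section QuadLip

variable {p : ℕ}

/-- Locally Lipschitz functions with a Lipschitz constant of linear growth. -/
def QuadLip (h : EuclideanSpace ℝ (Fin p) → ℝ) : Prop :=
  ∃ C, 0 ≤ C ∧ ∀ z z', |h z' - h z| ≤ C * (1 + ‖z‖ + ‖z'‖) * ‖z' - z‖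

theorem QuadLip.continuous {h : EuclideanSpace ℝ (Fin p) → ℝ} (hh : QuadLip h) :
    Continuous h := by
  obtain ⟨C, hC, hle⟩ := hh
  rw [continuous_iff_continuousAt]
  intro z
  rw [ContinuousAt, tendsto_iff_dist_tendsto_zero]
  have hg : Tendsto (fun z' => C * (1 + ‖z‖ + ‖z'‖) * ‖z' - z‖) (𝓝 z) (𝓝 0) := by
    have : Continuous (fun z' => C * (1 + ‖z‖ + ‖z'‖) * ‖z' - z‖) := by fun_prop
    simpa using this.tendsto z
  refine squeeze_zero (fun _ => dist_nonneg) (fun z' => ?_) hg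
  rw [Real.dist_eq]
  exact hle z z'

/-- Such functions grow at most quadratically, so square integrability of `Y` suffices. This is what
makes the expected merit and the expected gaps finite. -/
theorem QuadLip.integrable_comp {Ω : Type*} [MeasurableSpace Ω] {P : Measure Ω}
    [IsProbabilityMeasure P] {h : EuclideanSpace ℝ (Fin p) → ℝ} (hh : QuadLip h)
    {Y : Ω → EuclideanSpace ℝ (Fin p)} (hY : MemLp Y 2 P) : Integrable (fun ω => h (Y ω)) P := by
  have hc := hh.continuous
  obtain ⟨C, hC, hle⟩ := hh
  have hint : Integrable (fun ω => |h 0| + C * (1 + 2 * ‖Y ω‖ ^ 2)) P := by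
    have := hY.integrable_norm_pow (by norm_num)
    exact (integrable_const _).add (((integrable_const _).add (this.const_mul 2)).const_mul C)
  refine hint.mono' (hc.comp_aestronglyMeasurable hY.1) (.of_forall fun ω => ?_)
  have h1 := hle 0 (Y ω)
  simp only [norm_zero, add_zero, sub_zero] at h1
  rw [Real.norm_eq_abs]
  have h2 : |h (Y ω)| ≤ |h (Y ω) - h 0| + |h 0| := by
    simpa using abs_add_le (h (Y ω) - h 0) (h 0)
  have h3 : C * (1 + ‖Y ω‖) * ‖Y ω‖ ≤ C * (1 + 2 * ‖Y ω‖ ^ 2) := by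
    rw [mul_assoc]
    refine mul_le_mul_of_nonneg_left ?_ hC
    nlinarith [sq_nonneg (‖Y ω‖ - 1)]
  linarith

variable {n : ℕ} {φ : EuclideanSpace ℝ (Fin p) → EReal} {ρ γ L : ℝ}
  {f : Fin n → EuclideanSpace ℝ (Fin p) → ℝ} {S : Set (EuclideanSpace ℝ (Fin p))}

theorem QuadLip.of_le {h : EuclideanSpace ℝ (Fin p) → ℝ} {C : ℝ} (hC : 0 ≤ C)
    (hle : ∀ z z', h z' - h z ≤ C * (1 + ‖z‖ + ‖z'‖) * ‖z' - z‖) : QuadLip h := by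
  refine ⟨C, hC, fun z z' => abs_le.2 ⟨?_, hle z z'⟩⟩
  have := hle z' z
  rw [norm_sub_rev] at this
  linarith

theorem IsWeaklyConvex.norm_prox_le (hφ : IsWeaklyConvex φ ρ) (hγ : 0 < γ)
    (hγρ : γ * ρ ≤ 1 / 4) (z : EuclideanSpace ℝ (Fin p)) :
    ‖prox φ γ z‖ ≤ ‖prox φ γ 0‖ + 4 / 3 * ‖z‖ := by
  have h1 := hφ.norm_prox_sub_le' hγ hγρ 0 z
  have h2 := norm_le_norm_add_norm_sub' (prox φ γ z) (prox φ γ 0)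
  rw [sub_zero] at h1
  linarith

/-- Although `φ` is only lower semicontinuous, at prox points it has the weak subgradients `γ⁻¹ (z -
prox z)`, whose norm grows linearly in `z`. The subgradient inequality at `z'` gives one side, and
exchanging the points gives the other. -/
theorem quadLip_toReal_prox (hρ : 0 < ρ) (hφ : IsWeaklyConvex φ ρ) (hγ : 0 < γ)
    (hγρ : γ * ρ ≤ 1 / 4) : QuadLip fun z => (φ (prox φ γ z)).toReal := by
  set c := ‖prox φ γ 0‖
  have hg := hφ.norm_prox_le hγ hγρ
  have hc : 0 ≤ c := norm_nonneg _
  have hi : 0 < γ⁻¹ := by positivity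
  refine QuadLip.of_le (C := 4 / 3 * (γ⁻¹ + ρ) * (c + 3)) (by positivity) fun z z' => ?_
  have h1 := hφ.subgradient hγ z' (hφ.prox_mem hγ z)
  have h2 := hφ.norm_prox_sub_le' hγ hγρ z z'
  have h3 := neg_le_of_abs_le
    (abs_real_inner_le_norm (z' - prox φ γ z') (prox φ γ z - prox φ γ z'))
  rw [norm_sub_rev (prox φ γ z) (prox φ γ z')] at h1 h3
  set e := ‖prox φ γ z' - prox φ γ z‖
  have he : 0 ≤ e := norm_nonneg _
  have hz := norm_nonneg z
  have hz' := norm_nonneg z'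
  have h4 : ‖z' - prox φ γ z'‖ ≤ (c + 3) * (1 + ‖z‖ + ‖z'‖) := by
    have := norm_sub_le z' (prox φ γ z')
    have := hg z'
    nlinarith [mul_nonneg hc hz, mul_nonneg hc hz']
  have h5 : e ≤ 2 * ((c + 3) * (1 + ‖z‖ + ‖z'‖)) := by
    have := norm_sub_le (prox φ γ z') (prox φ γ z)
    have := hg z'
    have := hg z
    nlinarith [mul_nonneg hc hz, mul_nonneg hc hz']
  set R := (c + 3) * (1 + ‖z‖ + ‖z'‖) with hR
  have hR0 : 0 ≤ R := by positivity
  have h6 : (φ (prox φ γ z')).toReal - (φ (prox φ γ z)).toReal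
      ≤ γ⁻¹ * (R * e) + ρ / 2 * (2 * R * e) := by
    have h7 : γ⁻¹ * -(R * e) ≤ γ⁻¹ * ⟪z' - prox φ γ z', prox φ γ z - prox φ γ z'⟫_ℝ := by
      refine mul_le_mul_of_nonneg_left (le_trans ?_ h3) hi.le
      exact neg_le_neg (mul_le_mul_of_nonneg_right h4 he)
    have h8 : ρ / 2 * e ^ 2 ≤ ρ / 2 * (2 * R * e) := by
      refine mul_le_mul_of_nonneg_left ?_ (by positivity)
      rw [sq, mul_assoc, ← mul_assoc]
      exact mul_le_mul_of_nonneg_right (by linarith) he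
    linarith
  calc _ ≤ γ⁻¹ * (R * e) + ρ / 2 * (2 * R * e) := h6
    _ = (γ⁻¹ + ρ) * R * e := by ring
    _ ≤ (γ⁻¹ + ρ) * R * (4 / 3 * ‖z' - z‖) := by gcongr
    _ = 4 / 3 * (γ⁻¹ + ρ) * (c + 3) * (1 + ‖z‖ + ‖z'‖) * ‖z' - z‖ := by rw [hR]; ring

theorem continuous_gradient_prox (hL : 0 < L) (hφ : IsWeaklyConvex φ ρ)
    (hf : IsSmoothFamily f φ L S) (hγ : 0 < γ) (hγρ : γ * ρ ≤ 1 / 4) (i : Fin n) :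
    Continuous fun z => gradient (f i) (prox φ γ z) := by
  have : LipschitzWith (L * (4 / 3)).toNNReal fun z => gradient (f i) (prox φ γ z) := by
    refine LipschitzWith.of_dist_le_mul fun x y => ?_
    rw [dist_eq_norm, dist_eq_norm, Real.coe_toNNReal _ (by positivity), mul_assoc]
    exact (hf.lipschitz i _ (hf.dom_subset (hφ.prox_mem hγ x)) _
      (hf.dom_subset (hφ.prox_mem hγ y))).trans
        (mul_le_mul_of_nonneg_left (hφ.norm_prox_sub_le' hγ hγρ y x) hL.le)
  exact this.continuous

/-- The quadratic upper bound applies between prox points, and the gradient there has linear growth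
because it is Lipschitz. -/
theorem quadLip_comp_prox (hL : 0 < L) (hφ : IsWeaklyConvex φ ρ)
    (hf : IsSmoothFamily f φ L S) (hγ : 0 < γ) (hγρ : γ * ρ ≤ 1 / 4) (i : Fin n) :
    QuadLip fun z => f i (prox φ γ z) := by
  set c := ‖prox φ γ 0‖
  set G := ‖gradient (f i) (prox φ γ 0)‖
  have hG : 0 ≤ G := norm_nonneg _
  have hg := hφ.norm_prox_le hγ hγρ
  have hc : 0 ≤ c := norm_nonneg _
  refine QuadLip.of_le (C := 4 / 3 * (G + L * (2 * c + 3))) (by positivity) fun z z' => ?_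
  have h1 := (abs_le.1 (hf.abs_sub_sub_inner_le hφ i (hφ.prox_mem hγ z) (hφ.prox_mem hγ z'))).2
  have h2 := hφ.norm_prox_sub_le' hγ hγρ z z'
  have h3 := real_inner_le_norm (gradient (f i) (prox φ γ z)) (prox φ γ z' - prox φ γ z)
  have h4 : ‖gradient (f i) (prox φ γ z)‖ ≤ G + L * (4 / 3 * ‖z‖) := by
    have h5 := hf.lipschitz i _ (hf.dom_subset (hφ.prox_mem hγ z)) _
      (hf.dom_subset (hφ.prox_mem hγ 0))
    have h6 := norm_le_norm_add_norm_sub' (gradient (f i) (prox φ γ z))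
      (gradient (f i) (prox φ γ 0))
    have h7 := hφ.norm_prox_sub_le' hγ hγρ 0 z
    rw [sub_zero] at h7
    nlinarith
  have h8 : ‖prox φ γ z' - prox φ γ z‖ ≤ 2 * c + 4 / 3 * ‖z‖ + 4 / 3 * ‖z'‖ := by
    have := norm_sub_le (prox φ γ z') (prox φ γ z)
    have := hg z'
    have := hg z
    linarith
  set e := ‖prox φ γ z' - prox φ γ z‖
  have he : 0 ≤ e := norm_nonneg _
  have hz := norm_nonneg z
  have hz' := norm_nonneg z'
  calc f i (prox φ γ z') - f i (prox φ γ z)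
      ≤ ‖gradient (f i) (prox φ γ z)‖ * e + L / 2 * e ^ 2 := by linarith
    _ = (‖gradient (f i) (prox φ γ z)‖ + L / 2 * e) * e := by ring
    _ ≤ ((G + L * (4 / 3 * ‖z‖)) + L / 2 * (2 * c + 4 / 3 * ‖z‖ + 4 / 3 * ‖z'‖)) * e := by
        gcongr
    _ ≤ ((G + L * (2 * c + 3)) * (1 + ‖z‖ + ‖z'‖)) * e := by
        gcongr
        have : 0 ≤ L * (c * 1 + 3 + ‖z‖ + (7 / 3) * ‖z'‖ + 2 * c * (‖z‖ + ‖z'‖))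
            + G * (‖z‖ + ‖z'‖) := by positivity
        linarith
    _ ≤ ((G + L * (2 * c + 3)) * (1 + ‖z‖ + ‖z'‖)) * (4 / 3 * ‖z' - z‖) := by gcongr
    _ = _ := by ring

end QuadLip

end NormED

namespace NormED

open Matrix

/-! ### Spectral norms and matrices acting on tuples of vectors -/

section SpecNorm

variable {ι κ ν : Type} [Fintype ι] [Fintype κ] [Fintype ν] [DecidableEq ι] [DecidableEq κ]
  [DecidableEq ν]

open scoped Matrix.Norms.L2Operator in
theorem specNorm_nonneg (M : Matrix ι κ ℝ) : 0 ≤ specNorm M := norm_nonneg M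

open scoped Matrix.Norms.L2Operator in
theorem sum_sq_mulVec_le (M : Matrix ι κ ℝ) (x : κ → ℝ) :
    ∑ i, (M *ᵥ x) i ^ 2 ≤ specNorm M ^ 2 * ∑ j, x j ^ 2 := by
  have h := Matrix.l2_opNorm_mulVec M (WithLp.toLp 2 x)
  have h2 := pow_le_pow_left₀ (norm_nonneg _) h 2
  rw [mul_pow, EuclideanSpace.norm_sq_eq, EuclideanSpace.norm_sq_eq] at h2
  simpa [specNorm] using h2

open scoped Matrix.Norms.L2Operator in
theorem specNorm_le_of_forall (M : Matrix ι κ ℝ) {c : ℝ} (hc : 0 ≤ c)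
    (h : ∀ x : κ → ℝ, ∑ i, (M *ᵥ x) i ^ 2 ≤ c ^ 2 * ∑ j, x j ^ 2) : specNorm M ≤ c := by
  rw [specNorm, Matrix.l2_opNorm_def]
  refine ContinuousLinearMap.opNorm_le_bound _ hc fun x => ?_
  refine le_of_sq_le_sq ?_ (by positivity)
  rw [mul_pow, EuclideanSpace.norm_sq_eq, EuclideanSpace.norm_sq_eq]
  simpa using h x

open scoped Matrix.Norms.L2Operator in
theorem specNorm_mul_le (M : Matrix ι κ ℝ) (N : Matrix κ ν ℝ) :
    specNorm (M * N) ≤ specNorm M * specNorm N := Matrix.l2_opNorm_mul M N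

open scoped Matrix.Norms.L2Operator in
theorem specNorm_diagonal (v : ι → ℝ) : specNorm (Matrix.diagonal v) = ‖v‖ :=
  Matrix.l2_opNorm_diagonal v

/-- The product of a matrix with the matrix whose rows are the vectors `z j`. -/
noncomputable def rmul {E : Type*} [AddCommMonoid E] [Module ℝ E] (M : Matrix ι κ ℝ) (z : κ → E) : ι → E :=
  fun i => ∑ j, M i j • z j

theorem rmul_mul {E : Type*} [AddCommGroup E] [Module ℝ E] (M : Matrix ι κ ℝ) (N : Matrix κ ν ℝ)
    (z : ν → E) : rmul M (rmul N z) = rmul (M * N) z := by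
  ext i
  simp only [rmul, Finset.smul_sum, Matrix.mul_apply, Finset.sum_smul, smul_smul]
  exact Finset.sum_comm

theorem rmul_add {E : Type*} [AddCommGroup E] [Module ℝ E] (M : Matrix ι κ ℝ) (z w : κ → E) :
    rmul M (z + w) = rmul M z + rmul M w := by
  ext i; simp [rmul, smul_add, Finset.sum_add_distrib]

theorem rmul_sub {E : Type*} [AddCommGroup E] [Module ℝ E] (M : Matrix ι κ ℝ) (z w : κ → E) :
    rmul M (z - w) = rmul M z - rmul M w := by
  ext i; simp [rmul, smul_sub, Finset.sum_sub_distrib]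

theorem rmul_smul {E : Type*} [AddCommGroup E] [Module ℝ E] (M : Matrix ι κ ℝ) (c : ℝ)
    (z : κ → E) : rmul M (c • z) = c • rmul M z := by
  ext i; simp [rmul, Finset.smul_sum, smul_smul, mul_comm]

theorem sub_rmul {E : Type*} [AddCommGroup E] [Module ℝ E] (M N : Matrix ι κ ℝ) (z : κ → E) :
    rmul (M - N) z = rmul M z - rmul N z := by
  ext i; simp [rmul, sub_smul, Finset.sum_sub_distrib]

theorem one_rmul {E : Type*} [AddCommGroup E] [Module ℝ E] (z : ι → E) :
    rmul (1 : Matrix ι ι ℝ) z = z := by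
  ext i; simp [rmul, Matrix.one_apply, ite_smul]

/-- The coordinates of the vectors `z j` decouple, so the scalar bound is applied to each of them
and summed. No dimension factor appears. -/
theorem sum_norm_sq_rmul_le {p : ℕ} (M : Matrix ι κ ℝ) (z : κ → EuclideanSpace ℝ (Fin p)) :
    ∑ i, ‖rmul M z i‖ ^ 2 ≤ specNorm M ^ 2 * ∑ j, ‖z j‖ ^ 2 := by
  simp only [EuclideanSpace.norm_sq_eq]
  rw [Finset.sum_comm, Finset.sum_comm (s := (Finset.univ : Finset κ)), Finset.mul_sum]
  refine Finset.sum_le_sum fun c _ => ?_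
  have e : ∀ i, (rmul M z i) c = (M *ᵥ fun j => z j c) i := fun i => by
    simp [rmul, Matrix.mulVec, dotProduct]
  simp only [e, Real.norm_eq_abs, sq_abs]
  exact sum_sq_mulVec_le M fun j => z j c

end SpecNorm

/-! ### Spectrum of the mixing matrix -/

section Spectral

variable {n : ℕ} {G : SimpleGraph (Fin n)} {W : Matrix (Fin n) (Fin n) ℝ}
  {U : Matrix (Fin n) (Fin (n - 1)) ℝ} {μ : Fin (n - 1) → ℝ}

theorem IsSpectralDecomp.avg_mul (h : IsSpectralDecomp W U μ) : avgMat n * U = 0 := by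
  have : avgMat n = 1 - U * Uᵀ := by rw [h.mul_transpose]; abel
  rw [this, Matrix.sub_mul, Matrix.mul_assoc, h.transpose_mul]; simp

theorem IsSpectralDecomp.transpose_mul_avg (h : IsSpectralDecomp W U μ) : Uᵀ * avgMat n = 0 := by
  have : avgMat n = 1 - U * Uᵀ := by rw [h.mul_transpose]; abel
  rw [this, Matrix.mul_sub, ← Matrix.mul_assoc, h.transpose_mul]; simp

theorem IsSpectralDecomp.mul_eq (h : IsSpectralDecomp W U μ) : W * U = U * diagonal μ := by
  conv_lhs => rw [h.decomp]
  rw [Matrix.add_mul, h.avg_mul, zero_add, Matrix.mul_assoc, h.transpose_mul, Matrix.mul_one]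

theorem IsSpectralDecomp.transpose_mul_eq (h : IsSpectralDecomp W U μ) :
    Uᵀ * W = diagonal μ * Uᵀ := by
  conv_lhs => rw [h.decomp]
  rw [Matrix.mul_add, h.transpose_mul_avg, zero_add, Matrix.mul_assoc, ← Matrix.mul_assoc,
    h.transpose_mul, Matrix.one_mul]

theorem IsSpectralDecomp.sum_sq_mulVec (h : IsSpectralDecomp W U μ) (x : Fin (n - 1) → ℝ) :
    ∑ i, (U *ᵥ x) i ^ 2 = ∑ j, x j ^ 2 := by
  have h1 : (U *ᵥ x) ⬝ᵥ (U *ᵥ x) = x ⬝ᵥ x := by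
    rw [Matrix.dotProduct_mulVec, Matrix.vecMul_mulVec, h.transpose_mul, ← Matrix.dotProduct_mulVec]
    simp
  simpa [dotProduct, sq] using h1

theorem IsSpectralDecomp.specNorm_le_one (h : IsSpectralDecomp W U μ) : specNorm U ≤ 1 :=
  specNorm_le_of_forall _ zero_le_one fun x => by rw [h.sum_sq_mulVec]; simp

theorem IsSpectralDecomp.specNorm_transpose_le_one (h : IsSpectralDecomp W U μ) :
    specNorm Uᵀ ≤ 1 := by
  refine le_of_eq_of_le ?_ h.specNorm_le_one
  have := Matrix.l2_opNorm_conjTranspose U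
  rwa [Matrix.conjTranspose_eq_transpose_of_trivial] at this

theorem IsSpectralDecomp.mulVec_single (h : IsSpectralDecomp W U μ) (i : Fin (n - 1)) :
    W *ᵥ (U *ᵥ Pi.single i 1) = μ i • (U *ᵥ Pi.single i 1) := by
  rw [Matrix.mulVec_mulVec, h.mul_eq, ← Matrix.mulVec_mulVec, ← Matrix.mulVec_smul]
  congr 1
  ext j
  by_cases hij : j = i
  · subst hij; simp [Matrix.mulVec_diagonal]
  · simp [Matrix.mulVec_diagonal, hij]

theorem sum_sq_single {ι : Type*} [Fintype ι] [DecidableEq ι] (i : ι) :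
    ∑ j, (Pi.single i 1 : ι → ℝ) j ^ 2 = 1 := by
  simp [Pi.single_apply]

theorem IsSpectralDecomp.lam_eq (h : IsSpectralDecomp W U μ) :
    lam W = specNorm (U * diagonal μ * Uᵀ) := by
  rw [lam]; congr 1
  conv_lhs => rw [h.decomp]
  abel

/-- The `i`th column of `U` is a unit eigenvector of `W - avgMat n` for `μ i`, because the averaging
matrix annihilates `U`. -/
theorem IsSpectralDecomp.abs_le_lam (h : IsSpectralDecomp W U μ) (i : Fin (n - 1)) :
    |μ i| ≤ lam W := by
  have h1 := sum_sq_mulVec_le (W - avgMat n) (U *ᵥ Pi.single i 1)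
  rw [h.sum_sq_mulVec, sum_sq_single, mul_one, Matrix.sub_mulVec, h.mulVec_single,
    Matrix.mulVec_mulVec, h.avg_mul, Matrix.zero_mulVec, sub_zero] at h1
  simp only [Pi.smul_apply, smul_eq_mul, mul_pow] at h1
  rw [← Finset.mul_sum, h.sum_sq_mulVec, sum_sq_single, mul_one] at h1
  exact abs_le_of_sq_le_sq h1 (specNorm_nonneg _)

theorem IsSpectralDecomp.le_lam (h : IsSpectralDecomp W U μ) (i : Fin (n - 1)) :
    μ i ≤ lam W := (le_abs_self _).trans (h.abs_le_lam i)

theorem IsSpectralDecomp.nonneg (h : IsSpectralDecomp W U μ) (hW : W.PosSemidef)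
    (i : Fin (n - 1)) : 0 ≤ μ i := by
  have h1 := hW.dotProduct_mulVec_nonneg (U *ᵥ Pi.single i 1)
  rw [h.mulVec_single, dotProduct_smul] at h1
  have h2 := h.sum_sq_mulVec (Pi.single i 1)
  rw [sum_sq_single] at h2
  have h3 : ∀ v : Fin n → ℝ, star v ⬝ᵥ v = ∑ j, v j ^ 2 := fun v => by simp [dotProduct, sq]
  rwa [h3, h2, smul_eq_mul, mul_one] at h1

/-- The norm is at most the largest `|μ i|`, and positive semidefiniteness turns this into the
largest `μ i`. Positivity of `lam W` excludes the empty index set. -/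
theorem IsSpectralDecomp.exists_eq_lam (h : IsSpectralDecomp W U μ) (hW : W.PosSemidef)
    (hlam : 0 < lam W) : ∃ i, μ i = lam W := by
  have hle : lam W ≤ ‖μ‖ := by
    rw [h.lam_eq]
    refine (specNorm_mul_le _ _).trans ?_
    have h1 := specNorm_mul_le U (diagonal μ)
    rw [specNorm_diagonal] at h1
    have h2 := h.specNorm_le_one
    have h3 := h.specNorm_transpose_le_one
    have h4 := specNorm_nonneg Uᵀ
    have h5 := specNorm_nonneg (U * diagonal μ)
    have h6 := norm_nonneg μ
    nlinarith
  have hne : Nonempty (Fin (n - 1)) := by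
    by_contra hcon
    rw [not_nonempty_iff] at hcon
    have : ‖μ‖ = 0 := by rw [Subsingleton.elim μ 0, norm_zero]
    linarith
  obtain ⟨i, hi⟩ := Finite.exists_max μ
  refine ⟨i, le_antisymm (h.le_lam i) (hle.trans ?_)⟩
  refine (pi_norm_le_iff_of_nonneg (h.nonneg hW i)).2 fun j => ?_
  rw [Real.norm_of_nonneg (h.nonneg hW j)]
  exact hi j

/-- For a unit eigenvector `u` of `λ` the Dirichlet form `∑ W j k (u j - u k)²` equals `2 - 2λ`. If
`λ ≥ 1`, it vanishes, so `u` is constant along edges and hence constant by connectedness. It also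
has mean zero, so it would be zero. -/
theorem IsMixing.lam_lt_one (hG : IsMixing G W) (h : IsSpectralDecomp W U μ) (hW : W.PosSemidef)
    (hlam : 0 < lam W) : lam W < 1 := by
  obtain ⟨i, hi⟩ := h.exists_eq_lam hW hlam
  set u := U *ᵥ Pi.single i 1 with hu
  have hWu : W *ᵥ u = lam W • u := by rw [← hi]; exact h.mulVec_single i
  have hu2 : ∑ j, u j ^ 2 = 1 := by rw [hu, h.sum_sq_mulVec, sum_sq_single]
  by_contra hcon
  push Not at hcon
  have hcol : ∀ j, ∑ k, W k j = 1 := fun j => by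
    rw [← hG.row_sum j]
    exact Finset.sum_congr rfl fun k _ => by
      conv_lhs => rw [← hG.symm]
      rfl
  have hexp : ∑ j, ∑ k, W j k * (u j - u k) ^ 2 = 2 - 2 * lam W := by
    have e1 : ∀ j, ∑ k, W j k * (u j - u k) ^ 2
        = u j ^ 2 + ∑ k, W j k * u k ^ 2 - 2 * (lam W * u j ^ 2) := fun j => by
      have h2 : ∑ k, W j k * u k = lam W * u j := congrFun hWu j
      calc ∑ k, W j k * (u j - u k) ^ 2
          = ∑ k, (W j k * u j ^ 2 + W j k * u k ^ 2 - 2 * u j * (W j k * u k)) :=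
            Finset.sum_congr rfl fun k _ => by ring
        _ = _ := by
            rw [Finset.sum_sub_distrib, Finset.sum_add_distrib, ← Finset.sum_mul, hG.row_sum,
              ← Finset.mul_sum, h2]
            ring
    rw [Finset.sum_congr rfl fun j _ => e1 j, Finset.sum_sub_distrib, Finset.sum_add_distrib,
      Finset.sum_comm, ← Finset.mul_sum, ← Finset.mul_sum, hu2]
    simp only [← Finset.sum_mul, hcol, one_mul, hu2]
    ring
  have hzero : ∀ j k, W j k * (u j - u k) ^ 2 = 0 := by
    have hnn : ∀ j k, 0 ≤ W j k * (u j - u k) ^ 2 := fun j k =>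
      mul_nonneg (hG.nonneg j k) (sq_nonneg _)
    have htot : ∑ j, ∑ k, W j k * (u j - u k) ^ 2 = 0 :=
      le_antisymm (by linarith) (Finset.sum_nonneg fun j _ => Finset.sum_nonneg fun k _ => hnn j k)
    intro j k
    have h1 := (Finset.sum_eq_zero_iff_of_nonneg fun j _ =>
      Finset.sum_nonneg fun k _ => hnn j k).1 htot j (Finset.mem_univ _)
    exact (Finset.sum_eq_zero_iff_of_nonneg fun k _ => hnn j k).1 h1 k (Finset.mem_univ _)
  have hadj : ∀ j k, G.Adj j k → u j = u k := fun j k hjk => by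
    have h1 := (hG.adj_iff j k hjk.ne).1 hjk
    have h2 := hzero j k
    have h3 := (mul_eq_zero.1 h2).resolve_left h1.ne'
    exact sub_eq_zero.1 (pow_eq_zero_iff (by norm_num) |>.1 h3)
  have hconst : ∀ j k, u j = u k := fun j k => by
    obtain ⟨w⟩ := hG.connected.preconnected j k
    induction w with
    | nil => rfl
    | cons hjk _ ih => exact (hadj _ _ hjk).trans ih
  have havg : avgMat n *ᵥ u = 0 := by
    rw [hu, Matrix.mulVec_mulVec, h.avg_mul, Matrix.zero_mulVec]
  have huz : ∀ j, u j = 0 := fun j => by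
    have h1 := congrFun havg j
    have hn : 0 < n := j.pos
    have hn' : (n : ℝ) ≠ 0 := by positivity
    simp only [avgMat, Matrix.mulVec, dotProduct, Matrix.of_apply, Pi.zero_apply,
      ← Finset.mul_sum, hconst _ j, Finset.sum_const, Finset.card_univ, Fintype.card_fin,
      nsmul_eq_mul] at h1
    rwa [inv_mul_cancel_left₀ hn'] at h1
  simp [huz] at hu2

/-- The spectrum is finite and nonnegative, so the infimum is attained at a positive eigenvalue; `λ`
is itself a nonzero eigenvalue. This converts the bound `1 / λ` on `‖V⁻¹‖²` into one with the
smallest nonzero eigenvalue. -/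
theorem IsSpectralDecomp.lamMinPos_spec (h : IsSpectralDecomp W U μ) (hW : W.PosSemidef)
    (hlam : 0 < lam W) : 0 < lamMinPos W ∧ lamMinPos W ≤ lam W := by
  obtain ⟨i, hi⟩ := h.exists_eq_lam hW hlam
  have hnn : ∀ t ∈ spectrum ℝ W, 0 ≤ t := fun t ht => by
    rw [hW.1.spectrum_real_eq_range_eigenvalues] at ht
    obtain ⟨j, rfl⟩ := ht
    exact hW.eigenvalues_nonneg j
  have hfin : (spectrum ℝ W).Finite := by
    rw [hW.1.spectrum_real_eq_range_eigenvalues]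
    exact Set.finite_range _
  have hmem : lam W ∈ spectrum ℝ W := by
    rw [spectrum.mem_iff]
    intro hu
    have h0 : (algebraMap ℝ (Matrix (Fin n) (Fin n) ℝ) (lam W) - W) *ᵥ (U *ᵥ Pi.single i 1) = 0 := by
      rw [Matrix.sub_mulVec, h.mulVec_single, hi, Matrix.algebraMap_eq_diagonal]
      ext j
      simp [Matrix.mulVec_diagonal]
    obtain ⟨Q, hQ⟩ := hu
    have h1 : U *ᵥ Pi.single i 1 = 0 := by
      have : (↑Q⁻¹ : Matrix (Fin n) (Fin n) ℝ) *ᵥ ((Q : Matrix (Fin n) (Fin n) ℝ) *ᵥ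
          (U *ᵥ Pi.single i 1)) = U *ᵥ Pi.single i 1 := by
        rw [Matrix.mulVec_mulVec, Units.inv_mul, Matrix.one_mulVec]
      rw [← this, hQ, h0, Matrix.mulVec_zero]
    have h2 := h.sum_sq_mulVec (Pi.single i 1)
    rw [h1, sum_sq_single] at h2
    simp at h2
  have hset : (lam W) ∈ {t : ℝ | t ∈ spectrum ℝ W ∧ t ≠ 0} := ⟨hmem, hlam.ne'⟩
  have hfin' : {t : ℝ | t ∈ spectrum ℝ W ∧ t ≠ 0}.Finite := hfin.subset fun t ht => ht.1
  constructor
  · have h1 := Set.Nonempty.csInf_mem ⟨_, hset⟩ hfin'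
    exact lt_of_le_of_ne (hnn _ h1.1) h1.2.symm
  · exact csInf_le hfin'.bddBelow hset

/-- The positive semidefinite square root of `I - W` in the eigenbasis. -/
theorem IsSpectralDecomp.transpose_mul_sqrt (h : IsSpectralDecomp W U μ)
    {B : Matrix (Fin n) (Fin n) ℝ} (hB : B.PosSemidef) (hBW : B * B = 1 - W) (hμ : ∀ i, μ i ≤ 1) :
    Uᵀ * B = diagonal (edB μ) * Uᵀ := by
  have hb : diagonal (edB μ) * diagonal (edB μ) = 1 - diagonal μ := by
    rw [Matrix.diagonal_mul_diagonal, ← Matrix.diagonal_one, Matrix.diagonal_sub]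
    congr 1; ext i
    exact Real.mul_self_sqrt (by have := hμ i; linarith)
  -- An explicit positive semidefinite square root of `1 - W`; by uniqueness of such roots it must
  -- be `B`.
  have hC : (U * diagonal (edB μ) * Uᵀ) * (U * diagonal (edB μ) * Uᵀ) = 1 - W := by
    calc (U * diagonal (edB μ) * Uᵀ) * (U * diagonal (edB μ) * Uᵀ)
        = U * diagonal (edB μ) * (Uᵀ * U) * diagonal (edB μ) * Uᵀ := by
          simp only [Matrix.mul_assoc]
      _ = U * (diagonal (edB μ) * diagonal (edB μ)) * Uᵀ := by
          rw [h.transpose_mul]; simp only [Matrix.mul_assoc, Matrix.one_mul]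
      _ = U * Uᵀ - U * diagonal μ * Uᵀ := by
          rw [hb, Matrix.mul_sub, Matrix.sub_mul, Matrix.mul_one]
      _ = 1 - W := by
          rw [h.mul_transpose]; conv_rhs => rw [h.decomp]
          abel
  have hCpsd : (U * diagonal (edB μ) * Uᵀ).PosSemidef := by
    have hd : (diagonal (edB μ)).PosSemidef := Matrix.PosSemidef.diagonal fun i => Real.sqrt_nonneg _
    have := hd.mul_mul_conjTranspose_same U
    rwa [Matrix.conjTranspose_eq_transpose_of_trivial] at this
  have heq : B = U * diagonal (edB μ) * Uᵀ := by
    open scoped MatrixOrder Matrix.Norms.L2Operator in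
    have h1 := CFC.sqrt_unique hBW hB.nonneg
    have h2 := CFC.sqrt_unique hC hCpsd.nonneg
    rw [← h1, ← h2]
  rw [heq, ← Matrix.mul_assoc, ← Matrix.mul_assoc, h.transpose_mul, Matrix.one_mul]

end Spectral

end NormED

namespace NormED

open Matrix

/-! ### The transformation `V` of the consensus dynamics -/

section Transform

theorem fromBlocks_diagonal_mulVec {ι : Type} [Fintype ι] [DecidableEq ι] (a b c d : ι → ℝ)
    (x : ι ⊕ ι → ℝ) :
    fromBlocks (diagonal a) (diagonal b) (diagonal c) (diagonal d) *ᵥ x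
      = Sum.elim (fun i => a i * x (Sum.inl i) + b i * x (Sum.inr i))
        (fun i => c i * x (Sum.inl i) + d i * x (Sum.inr i)) := by
  ext j
  rw [Matrix.fromBlocks_mulVec]
  rcases j with i | i <;> simp [Matrix.mulVec_diagonal]

/-- Up to a permutation of coordinates the matrix is a direct sum of 2×2 blocks, so its norm is
controlled block by block. -/
theorem specNorm_fromBlocks_diagonal_le {ι : Type} [Fintype ι] [DecidableEq ι] (a b c d : ι → ℝ)
    {K : ℝ} (hK : 0 ≤ K)
    (h : ∀ i x y, (a i * x + b i * y) ^ 2 + (c i * x + d i * y) ^ 2 ≤ K ^ 2 * (x ^ 2 + y ^ 2)) :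
    specNorm (fromBlocks (diagonal a) (diagonal b) (diagonal c) (diagonal d)) ≤ K := by
  refine specNorm_le_of_forall _ hK fun x => ?_
  rw [fromBlocks_diagonal_mulVec, Fintype.sum_sum_type, Fintype.sum_sum_type,
    ← Finset.sum_add_distrib, ← Finset.sum_add_distrib, Finset.mul_sum]
  exact Finset.sum_le_sum fun i _ => h i _ _

theorem fromBlocks_diagonal_mul {ι : Type} [Fintype ι] [DecidableEq ι]
    (a b c d a' b' c' d' : ι → ℝ) :
    fromBlocks (diagonal a) (diagonal b) (diagonal c) (diagonal d)
        * fromBlocks (diagonal a') (diagonal b') (diagonal c') (diagonal d')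
      = fromBlocks (diagonal fun i => a i * a' i + b i * c' i)
        (diagonal fun i => a i * b' i + b i * d' i)
        (diagonal fun i => c i * a' i + d i * c' i)
        (diagonal fun i => c i * b' i + d i * d' i) := by
  rw [Matrix.fromBlocks_multiply]
  simp only [Matrix.diagonal_mul_diagonal, Matrix.diagonal_add]

/-- The defect factors as `l - m` times the form `l w² + m (b w - y)²`, where `x = s w`; both
factors are nonnegative. -/
theorem sq_gamma_block_le {m s b l x y : ℝ} (hm : 0 ≤ m) (hml : m ≤ l) (hs : 0 < s)
    (hsl : s ^ 2 = l) (hb : b ^ 2 = 1 - m) :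
    (m * x + b * s * y) ^ 2 + (-(b * m / s) * x + m * y) ^ 2 ≤ l * (x ^ 2 + y ^ 2) := by
  have hl0 : 0 < l := hsl ▸ by positivity
  have hx : x = s * (x / s) := by field_simp
  set w := x / s with hw
  rw [hx]
  have e : -(b * m / s) * (s * w) = -(b * m * w) := by field_simp
  rw [e]
  -- the difference of both sides is a quadratic form in `w`, `y`
  have key : l * ((s * w) ^ 2 + y ^ 2)
      - ((m * (s * w) + b * s * y) ^ 2 + (-(b * m * w) + m * y) ^ 2)
      = (l - m) * ((l + m - m ^ 2) * w ^ 2 - 2 * m * b * w * y + m * y ^ 2) := by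
    have h1 : l * ((s * w) ^ 2 + y ^ 2)
      - ((m * (s * w) + b * s * y) ^ 2 + (-(b * m * w) + m * y) ^ 2)
      = l * (s ^ 2 * w ^ 2 + y ^ 2) - (m ^ 2 * s ^ 2 * w ^ 2 + 2 * m * b * s ^ 2 * w * y
          + b ^ 2 * s ^ 2 * y ^ 2 + b ^ 2 * m ^ 2 * w ^ 2 - 2 * b * m ^ 2 * w * y
          + m ^ 2 * y ^ 2) := by ring
    rw [h1, hsl, hb]; ring
  have hq : 0 ≤ (l + m - m ^ 2) * w ^ 2 - 2 * m * b * w * y + m * y ^ 2 := by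
    have : (l + m - m ^ 2) * w ^ 2 - 2 * m * b * w * y + m * y ^ 2
        = l * w ^ 2 + m * (b * w - y) ^ 2 := by
      have : m * (b * w - y) ^ 2 = m * (b ^ 2 * w ^ 2 - 2 * b * w * y + y ^ 2) := by ring
      rw [this, hb]; ring
    rw [this]; positivity
  have := mul_nonneg (sub_nonneg.2 hml) hq
  linarith

/-- Existence of a transformation with the required bounds. -/
theorem exists_isEDTransform {n : ℕ} {G : SimpleGraph (Fin n)} {W : Matrix (Fin n) (Fin n) ℝ}
    {U : Matrix (Fin n) (Fin (n - 1)) ℝ} {μ : Fin (n - 1) → ℝ} (hG : IsMixing G W)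
    (hW : W.PosSemidef) (hlam : 0 < lam W) (h : IsSpectralDecomp W U μ) :
    ∃ V, IsEDTransform W U μ V := by
  have hl1 := hG.lam_lt_one h hW hlam
  obtain ⟨hmin0, hminle⟩ := h.lamMinPos_spec hW hlam
  obtain ⟨i₀, hi₀⟩ := h.exists_eq_lam hW hlam
  set l := lam W with hl
  set s := √l with hs
  have hs0 : 0 < s := Real.sqrt_pos.2 hlam
  have hs2 : s ^ 2 = l := Real.sq_sqrt hlam.le
  have hs1 : s ≤ 1 := by nlinarith
  set b := edB μ with hb
  have hb0 : ∀ i, 0 ≤ b i := fun i => Real.sqrt_nonneg _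
  have hb2 : ∀ i, b i ^ 2 = 1 - μ i := fun i =>
    Real.sq_sqrt (by have := h.le_lam i; linarith)
  have hμ0 := h.nonneg hW
  have hb1 : ∀ i, b i ≤ 1 := fun i => by have := hb2 i; have := hμ0 i; nlinarith [hb0 i]
  set c := √(2 : ℝ) with hc
  have hc0 : 0 < c := by positivity
  have hc2 : c ^ 2 = 2 := Real.sq_sqrt (by norm_num)
  -- The denominator comes from `μ = (1 - b)(1 + b)`, which makes the conjugated block have equal
  -- diagonal entries. As `0 ≤ b ≤ 1`, `t²` lies between `λ / 2` and `2`, which bounds `V` and its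
  -- inverse.
  set t : Fin (n - 1) → ℝ := fun i => c * s / (1 + b i) with ht
  have hbp : ∀ i, 0 < 1 + b i := fun i => by linarith [hb0 i]
  have ht0 : ∀ i, 0 < t i := fun i => div_pos (by positivity) (hbp i)
  have htb : ∀ i, t i * (1 + b i) = c * s := fun i => div_mul_cancel₀ _ (hbp i).ne'
  clear_value t
  have ht2 : ∀ i, t i ^ 2 * (1 + b i) ^ 2 = 2 * l := fun i => by
    rw [← mul_pow, htb, mul_pow, hc2, hs2]
  have htle : ∀ i, t i ^ 2 ≤ 2 := fun i => by
    have h1 := ht2 i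
    nlinarith [hb0 i, sq_nonneg (t i), mul_nonneg (sq_nonneg (t i)) (hb0 i),
      mul_nonneg (sq_nonneg (t i)) (sq_nonneg (b i))]
  have htge : ∀ i, l ≤ 2 * t i ^ 2 := fun i => by
    have h1 := ht2 i
    have h2 : (1 + b i) ^ 2 ≤ 4 := by nlinarith [hb0 i, hb1 i]
    nlinarith [sq_nonneg (t i)]
  set V : Matrix (Fin (n - 1) ⊕ Fin (n - 1)) (Fin (n - 1) ⊕ Fin (n - 1)) ℝ :=
    fromBlocks (diagonal fun _ => -c) (diagonal t) (diagonal fun _ => c) (diagonal t) with hV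
  set V' : Matrix (Fin (n - 1) ⊕ Fin (n - 1)) (Fin (n - 1) ⊕ Fin (n - 1)) ℝ :=
    fromBlocks (diagonal fun _ => -(1 / (2 * c))) (diagonal fun _ => 1 / (2 * c))
      (diagonal fun i => 1 / (2 * t i)) (diagonal fun i => 1 / (2 * t i)) with hV'
  have hone : (1 : Matrix (Fin (n - 1) ⊕ Fin (n - 1)) (Fin (n - 1) ⊕ Fin (n - 1)) ℝ)
      = fromBlocks (diagonal fun _ => 1) (diagonal fun _ => 0) (diagonal fun _ => 0)
        (diagonal fun _ => 1) := by
    rw [Matrix.diagonal_one, Matrix.diagonal_zero, Matrix.fromBlocks_one]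
  have hVV' : V * V' = 1 := by
    rw [hV, hV', fromBlocks_diagonal_mul, hone]
    congr 2 <;> ext i <;> have := (ht0 i).ne' <;> field_simp <;> ring
  have hV'V : V' * V = 1 := by
    rw [hV, hV', fromBlocks_diagonal_mul, hone]
    congr 2 <;> ext i <;> have := (ht0 i).ne' <;> field_simp <;> ring
  have hinv : V⁻¹ = V' := Matrix.inv_eq_right_inv hVV'
  have hVle : specNorm V ≤ 2 := by
    refine specNorm_fromBlocks_diagonal_le _ _ _ _ (by norm_num) fun i x y => ?_
    have h1 : (-c * x + t i * y) ^ 2 + (c * x + t i * y) ^ 2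
        = 2 * c ^ 2 * x ^ 2 + 2 * t i ^ 2 * y ^ 2 := by ring
    rw [h1, hc2]
    nlinarith [htle i, sq_nonneg y]
  have hV'le : specNorm V' ≤ 1 / s := by
    refine specNorm_fromBlocks_diagonal_le _ _ _ _ (by positivity) fun i x y => ?_
    have h1 : (-(1 / (2 * c)) * x + 1 / (2 * c) * y) ^ 2
        + (1 / (2 * t i) * x + 1 / (2 * t i) * y) ^ 2
        = (x - y) ^ 2 / (4 * c ^ 2) + (x + y) ^ 2 / (2 * (2 * t i ^ 2)) := by
      have := (ht0 i).ne'
      field_simp; ring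
    have h2 : (x - y) ^ 2 / (4 * c ^ 2) ≤ (x - y) ^ 2 / (2 * l) := by
      rw [hc2]
      exact div_le_div_of_nonneg_left (sq_nonneg _) (by positivity) (by linarith)
    have h3 : (x + y) ^ 2 / (2 * (2 * t i ^ 2)) ≤ (x + y) ^ 2 / (2 * l) :=
      div_le_div_of_nonneg_left (sq_nonneg _) (by positivity) (by linarith [htge i])
    rw [h1, div_pow, hs2]
    have h4 : (x - y) ^ 2 / (2 * l) + (x + y) ^ 2 / (2 * l) = 1 ^ 2 / l * (x ^ 2 + y ^ 2) := by
      field_simp; ring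
    linarith
  have hV'sq : specNorm V' ^ 2 ≤ 1 / l := by
    have := pow_le_pow_left₀ (specNorm_nonneg _) hV'le 2
    rwa [div_pow, hs2, one_pow] at this
  -- Only `s = √λ` is divided by, never `μ`, so zero eigenvalues do no harm. The identity is proved
  -- as an intertwining relation with `V`, which avoids expanding the inverse.
  have hΓ : gammaMat μ b (fun _ => 1) V
      = fromBlocks (diagonal μ) (diagonal fun i => b i * s) (diagonal fun i => -(b i * μ i / s))
        (diagonal μ) := by
    have h0 : fromBlocks (diagonal μ * diagonal (fun _ => (1 : ℝ)) - diagonal b ^ 2) (-diagonal b)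
        (diagonal b) 1
        = fromBlocks (diagonal fun i => 2 * μ i - 1) (diagonal fun i => -b i) (diagonal b)
          (diagonal fun _ => 1) := by
      rw [Matrix.diagonal_pow, Matrix.diagonal_mul_diagonal, Matrix.diagonal_sub,
        Matrix.diagonal_neg, Matrix.diagonal_one]
      congr 2; ext i
      simp only [Pi.pow_apply, hb2]; ring
    have h1 : fromBlocks (diagonal fun i => 2 * μ i - 1) (diagonal fun i => -b i) (diagonal b)
          (diagonal fun _ => 1) * V
        = V * fromBlocks (diagonal μ) (diagonal fun i => b i * s)
          (diagonal fun i => -(b i * μ i / s)) (diagonal μ) := by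
      have htμ : ∀ i, t i * (b i * μ i / s) = c * (1 - b i) * b i := fun i => by
        rw [mul_div_assoc', div_eq_iff hs0.ne']
        have : μ i = (1 - b i) * (1 + b i) := by linear_combination hb2 i
        rw [this]; linear_combination (b i) * (1 - b i) * htb i
      have hbs : ∀ i, c * (b i * s) = t i * (b i + b i ^ 2) := fun i => by
        linear_combination -(b i) * htb i
      rw [hV, fromBlocks_diagonal_mul, fromBlocks_diagonal_mul]
      congr 2 <;> ext i
      · linear_combination htμ i + (-c) * hb2 i
      · linear_combination hbs i + t i * hb2 i
      · linear_combination htμ i + (-c) * hb2 i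
      · linear_combination (-1) * hbs i - t i * hb2 i
    rw [gammaMat, hinv, h0, Matrix.mul_assoc, h1, ← Matrix.mul_assoc, hV'V, Matrix.one_mul]
  have hβ : edBeta μ V = s := by
    rw [edBeta, hΓ]
    refine le_antisymm (specNorm_fromBlocks_diagonal_le _ _ _ _ hs0.le fun i x y => ?_) ?_
    · rw [hs2]
      exact sq_gamma_block_le (hμ0 i) (h.le_lam i) hs0 hs2 (hb2 i)
    -- In the block with `μ = λ` the second column has squared length `(1 - λ) λ + λ² = λ`, so the
    -- bound is attained.
    · refine le_of_sq_le_sq ?_ (specNorm_nonneg _)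
      have h1 := sum_sq_mulVec_le (fromBlocks (diagonal μ) (diagonal fun i => b i * s)
        (diagonal fun i => -(b i * μ i / s)) (diagonal μ)) (Pi.single (Sum.inr i₀) 1)
      rw [sum_sq_single, mul_one, fromBlocks_diagonal_mulVec] at h1
      rw [Fintype.sum_sum_type] at h1
      simp only [Sum.elim_inl, Sum.elim_inr, Pi.single_apply, reduceCtorEq, if_false, mul_zero,
        zero_add, Sum.inr.injEq, mul_ite, mul_one, ite_pow, ne_eq, OfNat.ofNat_ne_zero,
        not_false_eq_true, zero_pow, Finset.sum_ite_eq', Finset.mem_univ, if_true] at h1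
      refine le_trans ?_ h1
      rw [mul_pow, hb2, hs2, hi₀]
      nlinarith
  have hΛU : specNorm (diagonal μ * Uᵀ) ≤ l := by
    refine (specNorm_mul_le _ _).trans ?_
    rw [specNorm_diagonal]
    have h1 : ‖μ‖ ≤ l := (pi_norm_le_iff_of_nonneg hlam.le).2 h.abs_le_lam
    have := h.specNorm_transpose_le_one
    have := specNorm_nonneg Uᵀ
    have := norm_nonneg μ
    nlinarith
  have hΛU' : specNorm ((diagonal b)⁻¹ * diagonal μ * Uᵀ) ≤ l / √(1 - l) := by
    have hbpos : ∀ i, √(1 - l) ≤ b i := fun i => Real.sqrt_le_sqrt (by linarith [h.le_lam i])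
    have hq : 0 < √(1 - l) := Real.sqrt_pos.2 (by linarith)
    have hbi : (diagonal b)⁻¹ = diagonal fun i => (b i)⁻¹ := by
      refine Matrix.inv_eq_right_inv ?_
      rw [Matrix.diagonal_mul_diagonal, ← Matrix.diagonal_one]
      congr 1; ext i
      exact mul_inv_cancel₀ (hq.trans_le (hbpos i)).ne'
    rw [hbi, Matrix.diagonal_mul_diagonal]
    refine (specNorm_mul_le _ _).trans ?_
    rw [specNorm_diagonal]
    have h1 : ‖fun i => (b i)⁻¹ * μ i‖ ≤ l / √(1 - l) := by
      refine (pi_norm_le_iff_of_nonneg (by positivity)).2 fun i => ?_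
      rw [Real.norm_of_nonneg (mul_nonneg (inv_nonneg.2 (hb0 i)) (hμ0 i)), inv_mul_eq_div]
      exact div_le_div₀ hlam.le (h.le_lam i) hq (hbpos i)
    have h2 := h.specNorm_transpose_le_one
    calc _ ≤ l / √(1 - l) * 1 := mul_le_mul h1 h2 (specNorm_nonneg _) (by positivity)
      _ = _ := mul_one _
  refine ⟨V, ⟨⟨⟨V, V', hVV', hV'V⟩, rfl⟩, ?_, ?_, ?_, ?_, ?_⟩⟩
  · have := pow_le_pow_left₀ (specNorm_nonneg _) hVle 2
    linarith
  · rw [hinv]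
    refine hV'sq.trans ?_
    rw [div_le_div_iff₀ hlam hmin0]; linarith
  · rw [D1, hinv, mul_pow]
    have h1 := pow_le_pow_left₀ (specNorm_nonneg _) hΛU 2
    calc _ ≤ 1 / l * l ^ 2 := mul_le_mul hV'sq h1 (sq_nonneg _) (by positivity)
      _ = l := by field_simp
      _ ≤ 1 := hl1.le
  · rw [D2, hinv, mul_pow]
    have h1 := pow_le_pow_left₀ (specNorm_nonneg _) hΛU' 2
    rw [div_pow, Real.sq_sqrt (by linarith)] at h1
    have h3 : 0 < 1 - l := by linarith
    calc _ ≤ 1 / l * (l ^ 2 / (1 - l)) := mul_le_mul hV'sq h1 (sq_nonneg _) (by positivity)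
      _ = l / (1 - l) := by field_simp
      _ ≤ 1 / (1 - l) := by gcongr
  · exact hβ

end Transform

end NormED

namespace NormED

open scoped InnerProductSpace

/-! ### Independent samples and orthogonality of the gradient noise -/

section Noise

variable {Ω Ξ : Type*} [MeasurableSpace Ω] [MeasurableSpace Ξ] {P : Measure Ω}
  [IsProbabilityMeasure P] {p : ℕ}

theorem memLp_two_of_integrable_sq {Y : Ω → EuclideanSpace ℝ (Fin p)}
    (hm : AEStronglyMeasurable Y P) (h : Integrable (fun ω => ‖Y ω‖ ^ 2) P) : MemLp Y 2 P :=
  (memLp_two_iff_integrable_sq_norm hm).2 h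

theorem integrable_norm_sq_of_memLp {Y : Ω → EuclideanSpace ℝ (Fin p)} (h : MemLp Y 2 P) :
    Integrable (fun ω => ‖Y ω‖ ^ 2) P :=
  (memLp_two_iff_integrable_sq_norm h.1).1 h

theorem integrable_inner_of_memLp {Y Z : Ω → EuclideanSpace ℝ (Fin p)} (hY : MemLp Y 2 P)
    (hZ : MemLp Z 2 P) : Integrable (fun ω => ⟪Y ω, Z ω⟫_ℝ) P := by
  refine ((integrable_norm_sq_of_memLp hY).add (integrable_norm_sq_of_memLp hZ)).mono'
    (hY.1.inner hZ.1) (.of_forall fun ω => ?_)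
  have h1 := abs_real_inner_le_norm (Y ω) (Z ω)
  rw [Real.norm_eq_abs, Pi.add_apply]
  nlinarith [sq_nonneg (‖Y ω‖ - ‖Z ω‖), sq_nonneg ‖Y ω‖, sq_nonneg ‖Z ω‖]

/-- Second moments of a random field evaluated at an independent random point. -/
theorem noise_sq_le {X : Ω → EuclideanSpace ℝ (Fin p)} {s : Ω → Ξ}
    {N : EuclideanSpace ℝ (Fin p) → Ξ → EuclideanSpace ℝ (Fin p)}
    {Vf : EuclideanSpace ℝ (Fin p) → ℝ} (hX : Measurable X) (hs : Measurable s)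
    (hind : IndepFun X s P)
    (hN : Measurable fun q : EuclideanSpace ℝ (Fin p) × Ξ => N q.1 q.2)
    (hint : ∀ z, Integrable (fun ω => ‖N z (s ω)‖ ^ 2) P)
    (hle : ∀ z, ∫ ω, ‖N z (s ω)‖ ^ 2 ∂P ≤ Vf z) (hVm : Measurable Vf)
    (hV : Integrable (fun ω => Vf (X ω)) P) :
    MemLp (fun ω => N (X ω) (s ω)) 2 P ∧
      ∫ ω, ‖N (X ω) (s ω)‖ ^ 2 ∂P ≤ ∫ ω, Vf (X ω) ∂P := by
  have hXs : AEMeasurable (fun ω => (X ω, s ω)) P := (hX.prodMk hs).aemeasurable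
  -- The joint law is a product, so Fubini reduces the claim to the bounds at a fixed point `z`.
  -- This replaces conditional expectations.
  have hlaw := (indepFun_iff_map_prod_eq_prod_map_map hX.aemeasurable hs.aemeasurable).1 hind
  have : IsProbabilityMeasure (P.map X) := Measure.isProbabilityMeasure_map hX.aemeasurable
  have : IsProbabilityMeasure (P.map s) := Measure.isProbabilityMeasure_map hs.aemeasurable
  set F : EuclideanSpace ℝ (Fin p) × Ξ → ℝ := fun q => ‖N q.1 q.2‖ ^ 2 with hF
  have hFm : Measurable F := (hN.norm).pow_const 2
  have hsec : ∀ z, Integrable (fun t => F (z, t)) (P.map s) := fun z => by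
    exact (integrable_map_measure (g := fun t => F (z, t))
      (hFm.comp measurable_prodMk_left).aestronglyMeasurable hs.aemeasurable).2 (hint z)
  have hsecint : ∀ z, ∫ t, F (z, t) ∂(P.map s) = ∫ ω, ‖N z (s ω)‖ ^ 2 ∂P := fun z => by
    exact integral_map (f := fun t => F (z, t)) hs.aemeasurable
      (hFm.comp measurable_prodMk_left).aestronglyMeasurable
  have hFnn : ∀ q, 0 ≤ F q := fun q => sq_nonneg _
  have hVmap : Integrable Vf (P.map X) :=
    (integrable_map_measure hVm.aestronglyMeasurable hX.aemeasurable).2 hV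
  have hmeas : StronglyMeasurable fun z => ∫ t, F (z, t) ∂(P.map s) :=
    hFm.stronglyMeasurable.integral_prod_right'
  have hsecI : Integrable (fun z => ∫ t, F (z, t) ∂(P.map s)) (P.map X) := by
    refine hVmap.mono' hmeas.aestronglyMeasurable (.of_forall fun z => ?_)
    rw [Real.norm_of_nonneg (integral_nonneg fun t => hFnn _), hsecint]
    exact hle z
  have hFint : Integrable F ((P.map X).prod (P.map s)) := by
    rw [integrable_prod_iff hFm.aestronglyMeasurable]
    refine ⟨.of_forall hsec, ?_⟩
    simpa only [Real.norm_of_nonneg (hFnn _)] using hsecI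
  have hFint' : Integrable (fun ω => F (X ω, s ω)) P := by
    rw [← hlaw] at hFint
    exact (integrable_map_measure hFm.aestronglyMeasurable hXs).1 hFint
  refine ⟨memLp_two_of_integrable_sq (hN.comp (hX.prodMk hs)).aestronglyMeasurable hFint', ?_⟩
  calc ∫ ω, F (X ω, s ω) ∂P = ∫ q, F q ∂((P.map X).prod (P.map s)) := by
        rw [← hlaw, integral_map hXs hFm.aestronglyMeasurable]
    _ = ∫ z, ∫ t, F (z, t) ∂(P.map s) ∂(P.map X) := integral_prod _ hFint
    _ ≤ ∫ z, Vf z ∂(P.map X) := integral_mono hsecI hVmap fun z => by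
        simp only [hsecint]; exact hle z
    _ = ∫ ω, Vf (X ω) ∂P := integral_map hX.aemeasurable hVm.aestronglyMeasurable

/-- A centered random field evaluated at an independent random point is orthogonal to
every square integrable variable that is jointly independent. -/
theorem integral_inner_noise_eq_zero {A X : Ω → EuclideanSpace ℝ (Fin p)} {s : Ω → Ξ}
    {N : EuclideanSpace ℝ (Fin p) → Ξ → EuclideanSpace ℝ (Fin p)}
    (hA : Measurable A) (hX : Measurable X) (hs : Measurable s)
    (hind : IndepFun (fun ω => (A ω, X ω)) s P)
    (hN : Measurable fun q : EuclideanSpace ℝ (Fin p) × Ξ => N q.1 q.2)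
    (hint : ∀ z, Integrable (fun ω => N z (s ω)) P)
    (hzero : ∀ z, ∫ ω, N z (s ω) ∂P = 0)
    (hA2 : MemLp A 2 P) (hN2 : MemLp (fun ω => N (X ω) (s ω)) 2 P) :
    ∫ ω, ⟪A ω, N (X ω) (s ω)⟫_ℝ ∂P = 0 := by
  have hAX : Measurable fun ω => (A ω, X ω) := hA.prodMk hX
  have hAXs : AEMeasurable (fun ω => ((A ω, X ω), s ω)) P := (hAX.prodMk hs).aemeasurable
  have hlaw := (indepFun_iff_map_prod_eq_prod_map_map hAX.aemeasurable hs.aemeasurable).1 hind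
  have : IsProbabilityMeasure (P.map fun ω => (A ω, X ω)) :=
    Measure.isProbabilityMeasure_map hAX.aemeasurable
  have : IsProbabilityMeasure (P.map s) := Measure.isProbabilityMeasure_map hs.aemeasurable
  set F : (EuclideanSpace ℝ (Fin p) × EuclideanSpace ℝ (Fin p)) × Ξ → ℝ :=
    fun q => ⟪q.1.1, N q.1.2 q.2⟫_ℝ with hF
  have hFm : Measurable F := by
    have : Measurable fun q : (EuclideanSpace ℝ (Fin p) × EuclideanSpace ℝ (Fin p)) × Ξ =>
        N q.1.2 q.2 := hN.comp (measurable_fst.snd.prodMk measurable_snd)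
    exact measurable_fst.fst.inner this
  have hint1 : Integrable (fun ω => F ((A ω, X ω), s ω)) P := by
    exact integrable_inner_of_memLp hA2 hN2
  have hFint : Integrable F ((P.map fun ω => (A ω, X ω)).prod (P.map s)) := by
    rw [← hlaw]
    exact (integrable_map_measure hFm.aestronglyMeasurable hAXs).2 hint1
  calc ∫ ω, F ((A ω, X ω), s ω) ∂P = ∫ q, F q ∂((P.map fun ω => (A ω, X ω)).prod (P.map s)) := by
        rw [← hlaw, integral_map hAXs hFm.aestronglyMeasurable]
    _ = ∫ z, ∫ t, F (z, t) ∂(P.map s) ∂(P.map fun ω => (A ω, X ω)) := integral_prod _ hFint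
    _ = ∫ z, (0 : ℝ) ∂(P.map fun ω => (A ω, X ω)) := by
        congr 1; ext z
        have hNz : Measurable fun t => N z.2 t := hN.comp measurable_prodMk_left
        have h1 : Integrable (fun t => N z.2 t) (P.map s) :=
          (integrable_map_measure hNz.aestronglyMeasurable hs.aemeasurable).2 (hint z.2)
        simp only [hF]
        rw [integral_inner h1, integral_map hs.aemeasurable hNz.aestronglyMeasurable, hzero,
          inner_zero_right]
    _ = 0 := by simp

/-- The σ-algebra generated by the samples with indices in `T`. -/
def hist {n : ℕ} (ξ : Fin n → ℕ → Ω → Ξ) (T : Set (Fin n × ℕ)) : MeasurableSpace Ω :=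
  ⨆ q ∈ T, MeasurableSpace.comap (ξ q.1 q.2) inferInstance

variable {n : ℕ} {ξ : Fin n → ℕ → Ω → Ξ}

theorem hist_mono {T T' : Set (Fin n × ℕ)} (h : T ⊆ T') : hist ξ T ≤ hist ξ T' :=
  biSup_mono h

theorem hist_le (hξ : ∀ i k, Measurable (ξ i k)) (T : Set (Fin n × ℕ)) :
    hist ξ T ≤ (inferInstance : MeasurableSpace Ω) :=
  iSup₂_le fun q _ => (hξ q.1 q.2).comap_le

theorem measurable_hist {T : Set (Fin n × ℕ)} {i : Fin n} {k : ℕ} (h : (i, k) ∈ T) :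
    Measurable[hist ξ T] (ξ i k) :=
  Measurable.mono (comap_measurable (ξ i k))
    (le_iSup₂ (f := fun q (_ : q ∈ T) => MeasurableSpace.comap (ξ q.1 q.2) inferInstance) (i, k) h)
    le_rfl

/-- Joint independence passes to the σ-algebras generated by disjoint groups of samples. Allowing
any index set `T` covers both the past and the past together with another agent's current sample. -/
theorem indepFun_of_measurable_hist {α : Type*} [MeasurableSpace α]
    (hξ : ∀ i k, Measurable (ξ i k))
    (hind : iIndepFun (fun q : Fin n × ℕ => ξ q.1 q.2) P) {T : Set (Fin n × ℕ)} {i : Fin n} {k : ℕ}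
    (h : (i, k) ∉ T) {Z : Ω → α} (hZ : Measurable[hist ξ T] Z) : IndepFun Z (ξ i k) P := by
  have h1 := indep_iSup_of_disjoint (m := fun q : Fin n × ℕ =>
    MeasurableSpace.comap (ξ q.1 q.2) inferInstance) (fun q => (hξ q.1 q.2).comap_le)
    hind.iIndep (S := T) (T := {(i, k)}) (by simpa using h)
  rw [IndepFun_iff_Indep]
  refine indep_of_indep_of_le_left (indep_of_indep_of_le_right h1 ?_) hZ.comap_le
  simp

end Noise

end NormED

namespace NormED

open Matrix
open scoped InnerProductSpace

/-! ### Averages, consensus and matrix action -/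

section MatrixVectors

variable {ι κ : Type} [Fintype ι] [Fintype κ] [DecidableEq ι] [DecidableEq κ] {n p : ℕ}

/-- Young's inequality, weighted so that a first summand already contracted by `β² = l` keeps the
factor `(1 + l) / 2 < 1`. -/
theorem sum_norm_sq_add_le {E : Type*} [NormedAddCommGroup E] [InnerProductSpace ℝ E]
    (x y : ι → E) {l : ℝ} (hl0 : 0 < l) (hl1 : l < 1) :
    ∑ j, ‖x j + y j‖ ^ 2
      ≤ (1 + l) / (2 * l) * ∑ j, ‖x j‖ ^ 2 + 2 / (1 - l) * ∑ j, ‖y j‖ ^ 2 := by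
  rw [Finset.mul_sum, Finset.mul_sum, ← Finset.sum_add_distrib]
  refine Finset.sum_le_sum fun j _ => ?_
  have h1 : 0 < 1 - l := by linarith
  have h2 : ‖x j + y j‖ ^ 2 ≤ (‖x j‖ + ‖y j‖) ^ 2 := by
    gcongr; exact norm_add_le _ _
  have h3 : (1 + l) / (2 * l) * ‖x j‖ ^ 2 + 2 / (1 - l) * ‖y j‖ ^ 2 - (‖x j‖ + ‖y j‖) ^ 2
      = ((1 - l) * ‖x j‖ - 2 * l * ‖y j‖) ^ 2 / (2 * l * (1 - l)) + ‖y j‖ ^ 2 := by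
    field_simp; ring
  have h4 : 0 ≤ ((1 - l) * ‖x j‖ - 2 * l * ‖y j‖) ^ 2 / (2 * l * (1 - l)) + ‖y j‖ ^ 2 := by
    positivity
  linarith

theorem mean_add (z w : Fin n → EuclideanSpace ℝ (Fin p)) : mean (z + w) = mean z + mean w := by
  simp [mean, Finset.sum_add_distrib, smul_add]

theorem mean_sub' (z w : Fin n → EuclideanSpace ℝ (Fin p)) : mean (z - w) = mean z - mean w := by
  simp [mean, Finset.sum_sub_distrib, smul_sub]

theorem mean_smul (c : ℝ) (z : Fin n → EuclideanSpace ℝ (Fin p)) :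
    mean (c • z) = c • mean z := by
  simp only [mean, Pi.smul_apply, ← Finset.smul_sum]
  rw [smul_comm]

theorem mean_const (hn : 0 < n) (c : EuclideanSpace ℝ (Fin p)) :
    mean (fun _ : Fin n => c) = c := by
  have hn' : (n : ℝ) ≠ 0 := by positivity
  simp [mean, ← Nat.cast_smul_eq_nsmul ℝ, smul_smul, hn']

/-- Jensen's inequality for the mean. -/
theorem norm_mean_sq_le (z : Fin n → EuclideanSpace ℝ (Fin p)) :
    ‖mean z‖ ^ 2 ≤ (n : ℝ)⁻¹ * ∑ i, ‖z i‖ ^ 2 := by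
  rcases Nat.eq_zero_or_pos n with hn | hn
  · subst hn; simp [mean]
  have hn' : (0 : ℝ) < n := by positivity
  rw [mean, norm_smul, mul_pow, norm_inv, Real.norm_natCast]
  have h1 : ‖∑ i, z i‖ ^ 2 ≤ (∑ i, ‖z i‖) ^ 2 := by
    gcongr; exact norm_sum_le _ _
  have h2 : (∑ i, ‖z i‖) ^ 2 ≤ n * ∑ i, ‖z i‖ ^ 2 := by
    simpa using sq_sum_le_card_mul_sum_sq (s := Finset.univ) (f := fun i => ‖z i‖)
  calc ((n : ℝ)⁻¹) ^ 2 * ‖∑ i, z i‖ ^ 2 ≤ ((n : ℝ)⁻¹) ^ 2 * (n * ∑ i, ‖z i‖ ^ 2) := by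
        gcongr; exact h1.trans h2
    _ = _ := by field_simp

/-- The variance decomposition around an arbitrary point. -/
theorem sum_norm_sub_sq (hn : 0 < n) (z : Fin n → EuclideanSpace ℝ (Fin p))
    (y : EuclideanSpace ℝ (Fin p)) :
    ∑ i, ‖z i - y‖ ^ 2 = ∑ i, ‖z i - mean z‖ ^ 2 + n * ‖y - mean z‖ ^ 2 := by
  have hn' : (n : ℝ) ≠ 0 := by positivity
  have h1 : ∀ i, ‖z i - y‖ ^ 2
      = ‖z i - mean z‖ ^ 2 - 2 * ⟪z i - mean z, y - mean z⟫_ℝ + ‖y - mean z‖ ^ 2 := fun i => by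
    rw [← norm_sub_sq_real]; congr 2; abel
  have h2 : ∑ i, (z i - mean z) = 0 := by
    rw [Finset.sum_sub_distrib]
    simp [mean, ← Nat.cast_smul_eq_nsmul ℝ, smul_smul, hn']
  have h3 : ∑ i, ⟪z i - mean z, y - mean z⟫_ℝ = 0 := by
    rw [← sum_inner, h2, inner_zero_left]
  rw [Finset.sum_congr rfl fun i _ => h1 i, Finset.sum_add_distrib, Finset.sum_sub_distrib,
    ← Finset.mul_sum, h3]
  simp

theorem rmul_avgMat (z : Fin n → EuclideanSpace ℝ (Fin p)) :
    rmul (avgMat n) z = fun _ => mean z := by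
  ext i
  simp [rmul, avgMat, mean, Finset.smul_sum]

theorem mean_rmul {A : Matrix (Fin n) (Fin n) ℝ} {c : ℝ} (hA : ∀ j, ∑ i, A i j = c)
    (z : Fin n → EuclideanSpace ℝ (Fin p)) : mean (rmul A z) = c • mean z := by
  simp only [mean, rmul]
  rw [Finset.sum_comm, smul_comm c]
  simp only [← Finset.sum_smul, hA, Finset.smul_sum]

theorem IsMixing.col_sum {G : SimpleGraph (Fin n)} {W : Matrix (Fin n) (Fin n) ℝ}
    (h : IsMixing G W) (j : Fin n) : ∑ i, W i j = 1 := by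
  rw [← h.row_sum j]
  exact Finset.sum_congr rfl fun k _ => by
    conv_lhs => rw [← h.symm]
    rfl

/-- `‖B 1‖² = 1ᵀ (I - W) 1 = 0`. Hence the dual variable does not influence the average of the
iterates. -/
theorem sqrt_col_sum {W B : Matrix (Fin n) (Fin n) ℝ} (hW : ∀ i, ∑ j, W i j = 1)
    (hB : B.PosSemidef) (hBW : B * B = 1 - W) (j : Fin n) : ∑ i, B i j = 0 := by
  have hsymm : Bᵀ = B := by
    have := hB.1
    rwa [Matrix.IsHermitian, Matrix.conjTranspose_eq_transpose_of_trivial] at this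
  have h1 : (B *ᵥ 1) ⬝ᵥ (B *ᵥ 1) = 0 := by
    rw [Matrix.dotProduct_mulVec, Matrix.vecMul_mulVec, hsymm, hBW, ← Matrix.dotProduct_mulVec,
      Matrix.sub_mulVec, Matrix.one_mulVec]
    have : W *ᵥ 1 = 1 := by
      ext i; simp [Matrix.mulVec, dotProduct, hW]
    rw [this, sub_self, dotProduct_zero]
  have h2 : B *ᵥ 1 = 0 := dotProduct_self_eq_zero.1 h1
  have h3 := congrFun h2 j
  simp only [Matrix.mulVec, dotProduct, Pi.one_apply, mul_one, Pi.zero_apply] at h3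
  rw [← h3]
  exact Finset.sum_congr rfl fun i _ => by
    conv_lhs => rw [← hsymm]
    rfl

/-- Moving the matrix to the adjoint side pairs a known vector with each agent's noise separately,
so orthogonality can be applied agent by agent. -/
theorem sum_inner_rmul {E : Type*} [NormedAddCommGroup E] [InnerProductSpace ℝ E]
    (Q : Matrix ι κ ℝ) (a : ι → E) (e : κ → E) :
    ∑ j, ⟪a j, rmul Q e j⟫_ℝ = ∑ i, ⟪rmul Qᵀ a i, e i⟫_ℝ := by
  simp only [rmul, inner_sum, sum_inner, inner_smul_left, inner_smul_right, conj_trivial,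
    Matrix.transpose_apply]
  exact Finset.sum_comm

end MatrixVectors

/-! ### A run of the method and its recursions -/

/-- The data of a run of the method: matrices, problem, oracle, starting point and parameters. -/
structure Run (n p : ℕ) (Ω Ξ : Type*) where
  W : Matrix (Fin n) (Fin n) ℝ
  B : Matrix (Fin n) (Fin n) ℝ
  U : Matrix (Fin n) (Fin (n - 1)) ℝ
  μ : Fin (n - 1) → ℝ
  V : Matrix (Fin (n - 1) ⊕ Fin (n - 1)) (Fin (n - 1) ⊕ Fin (n - 1)) ℝ
  f : Fin n → EuclideanSpace ℝ (Fin p) → ℝ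
  φ : EuclideanSpace ℝ (Fin p) → EReal
  g : Fin n → EuclideanSpace ℝ (Fin p) → Ξ → EuclideanSpace ℝ (Fin p)
  ξ : Fin n → ℕ → Ω → Ξ
  z₀ : Fin n → EuclideanSpace ℝ (Fin p)
  α : ℝ
  γ : ℝ
  M : ℝ

namespace Run

variable {n p : ℕ} {Ω Ξ : Type*} (R : Run n p Ω Ξ)

/-- The pair of iterates `(𝐳ₖ, 𝐝ₖ)`. -/
noncomputable def zd (k : ℕ) (ω : Ω) :
    (Fin n → EuclideanSpace ℝ (Fin p)) × (Fin n → EuclideanSpace ℝ (Fin p)) :=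
  normABC R.W R.B 1 R.α R.γ R.φ (fun l x j => R.g j (x j) (R.ξ j l ω)) R.z₀ 0 k

noncomputable def z (k : ℕ) (ω : Ω) : Fin n → EuclideanSpace ℝ (Fin p) := (R.zd k ω).1

noncomputable def d (k : ℕ) (ω : Ω) : Fin n → EuclideanSpace ℝ (Fin p) := (R.zd k ω).2

/-- The normal map of the `i`th component. -/
noncomputable def Fi (i : Fin n) (z : EuclideanSpace ℝ (Fin p)) : EuclideanSpace ℝ (Fin p) :=
  Fnor (R.f i) R.φ R.γ z

/-- The normal map of the average. -/
noncomputable def F (z : EuclideanSpace ℝ (Fin p)) : EuclideanSpace ℝ (Fin p) :=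
  Fnor (avgFun R.f) R.φ R.γ z

/-- The error of the stochastic gradient at `prox z`. -/
noncomputable def err (i : Fin n) (z : EuclideanSpace ℝ (Fin p)) (s : Ξ) :
    EuclideanSpace ℝ (Fin p) :=
  R.g i (prox R.φ R.γ z) s - gradient (R.f i) (prox R.φ R.γ z)

/-- The gradient noise of agent `i` in iteration `k`. -/
noncomputable def e (k : ℕ) (ω : Ω) (i : Fin n) : EuclideanSpace ℝ (Fin p) :=
  R.err i (R.z k ω i) (R.ξ i k ω)

/-- Exponentially filtered average noise. -/
noncomputable def ν : ℕ → Ω → EuclideanSpace ℝ (Fin p)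
  | 0, _ => 0
  | k + 1, ω => (1 - R.α * R.M) • ν k ω + R.α • mean (R.e k ω)

/-- The averaged iterate, corrected by the filtered noise. -/
noncomputable def y (k : ℕ) (ω : Ω) : EuclideanSpace ℝ (Fin p) := mean (R.z k ω) + R.ν k ω

/-- `Λ̂_a Ûᵀ`. -/
noncomputable def LU : Matrix (Fin (n - 1)) (Fin n) ℝ := diagonal R.μ * R.Uᵀ

/-- `Λ̂_b⁻¹ Λ̂_a Ûᵀ`. -/
noncomputable def BLU : Matrix (Fin (n - 1)) (Fin n) ℝ :=
  (diagonal (edB R.μ))⁻¹ * diagonal R.μ * R.Uᵀ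

/-- The consensus error before the transformation by `V⁻¹`. -/
noncomputable def w (k : ℕ) (ω : Ω) : Fin (n - 1) ⊕ Fin (n - 1) → EuclideanSpace ℝ (Fin p) :=
  Sum.elim (rmul R.Uᵀ (R.z k ω))
    (rmul R.Uᵀ (R.d k ω - rmul R.B (R.z k ω)) + R.α • rmul R.BLU fun i => R.Fi i (R.y k ω))

/-- The transformed consensus error. -/
noncomputable def u (k : ℕ) (ω : Ω) : Fin (n - 1) ⊕ Fin (n - 1) → EuclideanSpace ℝ (Fin p) :=
  rmul R.V⁻¹ (R.w k ω)

/-- The deviation of the averaged step from the normal map step at `y`. -/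
noncomputable def r (k : ℕ) (ω : Ω) : EuclideanSpace ℝ (Fin p) :=
  mean (fun i => R.Fi i (R.z k ω i)) - R.F (R.y k ω) + R.M • R.ν k ω

/-- Squared consensus error. -/
noncomputable def cons (k : ℕ) (ω : Ω) : ℝ := ∑ i, ‖R.z k ω i - mean (R.z k ω)‖ ^ 2

/-- The stochastic gradient plus `γ⁻¹ (z - x)` is the component normal map plus the gradient error.
-/
theorem z_succ (k : ℕ) (ω : Ω) :
    R.z (k + 1) ω = rmul R.W (R.z k ω - R.α • ((fun i => R.Fi i (R.z k ω i)) + R.e k ω))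
      - rmul R.B (R.d k ω) := by
  have h1 : mulRows (1 : Matrix (Fin n) (Fin n) ℝ) (R.z k ω) = R.z k ω := one_rmul _
  have h2 : ((fun i => R.Fi i (R.z k ω i)) + R.e k ω)
      = (fun j => R.g j (prox R.φ R.γ (R.z k ω j)) (R.ξ j k ω))
        + R.γ⁻¹ • (R.z k ω - fun i => prox R.φ R.γ (R.z k ω i)) := by
    ext1 i
    simp only [Pi.add_apply, Fi, e, err, Fnor, Pi.smul_apply, Pi.sub_apply]
    abel
  rw [h2]
  have h3 : R.z (k + 1) ω = mulRows R.W (mulRows (1 : Matrix (Fin n) (Fin n) ℝ) (R.z k ω)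
      - R.α • ((fun j => R.g j (prox R.φ R.γ (R.z k ω j)) (R.ξ j k ω))
        + R.γ⁻¹ • (R.z k ω - fun i => prox R.φ R.γ (R.z k ω i)))) - mulRows R.B (R.d k ω) := rfl
  rw [h3, h1]
  rfl

theorem d_succ (k : ℕ) (ω : Ω) : R.d (k + 1) ω = R.d k ω + rmul R.B (R.z (k + 1) ω) := rfl

theorem rmul_transpose_const {R : Run n p Ω Ξ} (hU : IsSpectralDecomp R.W R.U R.μ) (c : EuclideanSpace ℝ (Fin p)) :
    rmul R.Uᵀ (fun _ => c) = 0 := by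
  rcases Nat.eq_zero_or_pos n with hn | hn
  · subst hn; ext1 i; simp [rmul]
  have h1 : (fun _ : Fin n => c) = rmul (avgMat n) fun _ => c := by
    rw [rmul_avgMat, mean_const hn]
  rw [h1, rmul_mul, hU.transpose_mul_avg]
  ext1 i; simp [rmul]

/-- The noise-free part of the recursion of the consensus error. -/
noncomputable def uDet (k : ℕ) (ω : Ω) :
    Fin (n - 1) ⊕ Fin (n - 1) → EuclideanSpace ℝ (Fin p) :=
  rmul (gammaMat R.μ (edB R.μ) (fun _ => 1) R.V) (R.u k ω)
    + R.α • rmul R.V⁻¹ (Sum.elim (rmul R.LU fun i => R.Fi i (R.y k ω) - R.Fi i (R.z k ω i))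
      (rmul R.BLU fun i => R.Fi i (R.y (k + 1) ω) - R.Fi i (R.y k ω)))

theorem sum_norm_sq_transform_le (R : Run n p Ω Ξ) (a b : Fin n → EuclideanSpace ℝ (Fin p)) :
    ∑ j, ‖rmul R.V⁻¹ (Sum.elim (rmul R.LU a) (rmul R.BLU b)) j‖ ^ 2
      ≤ D1 R.U R.μ R.V ^ 2 * ∑ i, ‖a i‖ ^ 2
        + D2 R.U R.μ (edB R.μ) R.V ^ 2 * ∑ i, ‖b i‖ ^ 2 := by
  refine (sum_norm_sq_rmul_le _ _).trans ?_
  rw [Fintype.sum_sum_type]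
  have h1 := sum_norm_sq_rmul_le R.LU a
  have h2 := sum_norm_sq_rmul_le R.BLU b
  have h3 := mul_le_mul_of_nonneg_left (add_le_add h1 h2) (sq_nonneg (specNorm R.V⁻¹))
  have e1 : D1 R.U R.μ R.V = specNorm R.V⁻¹ * specNorm R.LU := rfl
  have e2 : D2 R.U R.μ (edB R.μ) R.V = specNorm R.V⁻¹ * specNorm R.BLU := rfl
  simp only [Sum.elim_inl, Sum.elim_inr]
  rw [e1, e2]
  linarith

/-- The assumptions on a run. -/
structure Valid [MeasurableSpace Ω] [MeasurableSpace Ξ] (P : Measure Ω) (L ρ C₀ σ : ℝ)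
    (G : SimpleGraph (Fin n)) (S : Set (EuclideanSpace ℝ (Fin p))) : Prop where
  n_pos : 0 < n
  L_pos : 0 < L
  ρ_pos : 0 < ρ
  C₀_nonneg : 0 ≤ C₀
  γ_pos : 0 < R.γ
  γ_le : R.γ * (ρ + L) ≤ 1 / 4
  α_pos : 0 < R.α
  α_le : R.α ≤ R.γ / 100
  M_eq : R.M = LF L ρ R.γ
  M_pos : 0 < R.M
  αM_le : R.α * R.M ≤ 1
  mixing : IsMixing G R.W
  posSemidef : R.W.PosSemidef
  lam_pos : 0 < lam R.W
  sqrt_posSemidef : R.B.PosSemidef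
  sqrt_mul_self : R.B * R.B = 1 - R.W
  spectral : IsSpectralDecomp R.W R.U R.μ
  transform : IsEDTransform R.W R.U R.μ R.V
  smooth : IsSmoothFamily R.f R.φ L S
  weaklyConvex : IsWeaklyConvex R.φ ρ
  oracle : IsStochasticOracle R.f R.φ C₀ σ P R.g R.ξ

variable {R} [MeasurableSpace Ω] [MeasurableSpace Ξ] {P : Measure Ω} {L ρ C₀ σ : ℝ}
    {G : SimpleGraph (Fin n)} {S : Set (EuclideanSpace ℝ (Fin p))}

theorem Valid.lam_lt_one (h : R.Valid P L ρ C₀ σ G S) : lam R.W < 1 :=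
  h.mixing.lam_lt_one h.spectral h.posSemidef h.lam_pos

theorem Valid.γρ_le (h : R.Valid P L ρ C₀ σ G S) : R.γ * ρ ≤ 1 / 4 := by
  have := h.γ_le
  have := mul_pos h.γ_pos h.L_pos
  linarith

theorem Valid.norm_Fi_sub_le (h : R.Valid P L ρ C₀ σ G S) (i : Fin n)
    (z z' : EuclideanSpace ℝ (Fin p)) : ‖R.Fi i z' - R.Fi i z‖ ≤ R.M * ‖z' - z‖ := by
  rw [h.M_eq]
  exact norm_Fnor_sub_le h.L_pos h.weaklyConvex h.smooth h.γ_pos h.γρ_le i z z'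

theorem Valid.norm_F_sub_le (h : R.Valid P L ρ C₀ σ G S)
    (z z' : EuclideanSpace ℝ (Fin p)) : ‖R.F z' - R.F z‖ ≤ R.M * ‖z' - z‖ := by
  rw [h.M_eq]
  exact norm_Fnor_avgFun_sub_le h.n_pos h.L_pos h.weaklyConvex h.smooth h.γ_pos h.γρ_le z z'

theorem Valid.F_eq (h : R.Valid P L ρ C₀ σ G S) (z : EuclideanSpace ℝ (Fin p)) :
    R.F z = mean fun i => R.Fi i z :=
  Fnor_avgFun h.n_pos h.weaklyConvex h.smooth h.γ_pos z

theorem Valid.mean_z_succ (h : R.Valid P L ρ C₀ σ G S) (k : ℕ) (ω : Ω) :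
    mean (R.z (k + 1) ω) = mean (R.z k ω)
      - R.α • (mean (fun i => R.Fi i (R.z k ω i)) + mean (R.e k ω)) := by
  rw [z_succ, mean_sub', mean_rmul h.mixing.col_sum, one_smul,
    mean_rmul (sqrt_col_sum h.mixing.row_sum h.sqrt_posSemidef h.sqrt_mul_self), zero_smul,
    sub_zero, mean_sub', mean_smul, mean_add]

/-- The corrected average is not affected by the noise of the current iteration. -/
theorem Valid.y_succ (h : R.Valid P L ρ C₀ σ G S) (k : ℕ) (ω : Ω) :
    R.y (k + 1) ω = R.y k ω - R.α • (R.F (R.y k ω) + R.r k ω) := by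
  rw [y, h.mean_z_succ, ν, r, y]
  module

theorem Valid.rmul_V_u (h : R.Valid P L ρ C₀ σ G S) (k : ℕ) (ω : Ω) :
    rmul R.V (R.u k ω) = R.w k ω := by
  have hdet : IsUnit R.V.det := (Matrix.isUnit_iff_isUnit_det _).1 h.transform.isUnit
  rw [u, rmul_mul, Matrix.mul_nonsing_inv _ hdet, one_rmul]

theorem Valid.μ_lt_one (h : R.Valid P L ρ C₀ σ G S) (i : Fin (n - 1)) : R.μ i < 1 :=
  (h.spectral.le_lam i).trans_lt h.lam_lt_one

theorem Valid.edB_sq (h : R.Valid P L ρ C₀ σ G S) :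
    diagonal (edB R.μ) * diagonal (edB R.μ) = 1 - diagonal R.μ := by
  rw [Matrix.diagonal_mul_diagonal, ← Matrix.diagonal_one, Matrix.diagonal_sub]
  congr 1; ext i
  exact Real.mul_self_sqrt (by have := h.μ_lt_one i; linarith)

theorem Valid.edB_mul_inv (h : R.Valid P L ρ C₀ σ G S) :
    diagonal (edB R.μ) * (diagonal (edB R.μ))⁻¹ = 1 := by
  refine Matrix.mul_nonsing_inv _ ?_
  rw [Matrix.det_diagonal, isUnit_iff_ne_zero]
  exact Finset.prod_ne_zero_iff.2 fun i _ =>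
    (Real.sqrt_pos.2 (by have := h.μ_lt_one i; linarith)).ne'

/-- The recursion of the transformed consensus error. -/
theorem Valid.u_succ (h : R.Valid P L ρ C₀ σ G S) (k : ℕ) (ω : Ω) :
    R.u (k + 1) ω = R.uDet k ω
      - R.α • rmul R.V⁻¹ (Sum.elim (rmul R.LU (R.e k ω)) (rmul R.BLU 0)) := by
  have hUB := h.spectral.transpose_mul_sqrt h.sqrt_posSemidef h.sqrt_mul_self
    fun i => (h.μ_lt_one i).le
  have hUW := h.spectral.transpose_mul_eq
  -- At time `k + 1` the difference `d - B z` is just `d` at time `k`. Its shift by `α Λ_b⁻¹ Λ_a Uᵀ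
  -- F(y)` satisfies `Λ_b · BLU = LU`. This leaves only `F(y) - F(z)` in the first component and the
  -- increment of `F(y)` in the second.
  have hw : R.w (k + 1) ω
      = rmul (fromBlocks (diagonal R.μ * diagonal (fun _ => (1 : ℝ)) - diagonal (edB R.μ) ^ 2)
          (-diagonal (edB R.μ)) (diagonal (edB R.μ)) 1) (R.w k ω)
        + R.α • Sum.elim (rmul R.LU fun i => R.Fi i (R.y k ω) - R.Fi i (R.z k ω i))
          (rmul R.BLU fun i => R.Fi i (R.y (k + 1) ω) - R.Fi i (R.y k ω))
        - R.α • Sum.elim (rmul R.LU (R.e k ω)) (rmul R.BLU 0) := by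
    set b := diagonal (edB R.μ) with hb
    set a := diagonal R.μ with ha
    set Z := rmul R.Uᵀ (R.z k ω) with hZ
    set D := rmul R.Uᵀ (R.d k ω) with hD
    set Gy : Fin n → EuclideanSpace ℝ (Fin p) := fun i => R.Fi i (R.y k ω) with hGy
    set Gz : Fin n → EuclideanSpace ℝ (Fin p) := fun i => R.Fi i (R.z k ω i) with hGz
    set Gy' : Fin n → EuclideanSpace ℝ (Fin p) := fun i => R.Fi i (R.y (k + 1) ω) with hGy'
    have hUBz : ∀ x : Fin n → EuclideanSpace ℝ (Fin p),
        rmul R.Uᵀ (rmul R.B x) = rmul b (rmul R.Uᵀ x) := fun x => by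
      rw [rmul_mul, hUB, ← rmul_mul]
    have hUWz : ∀ x : Fin n → EuclideanSpace ℝ (Fin p),
        rmul R.Uᵀ (rmul R.W x) = rmul a (rmul R.Uᵀ x) := fun x => by
      rw [rmul_mul, hUW, ← rmul_mul]
    have hLU : ∀ x : Fin n → EuclideanSpace ℝ (Fin p), rmul R.LU x = rmul a (rmul R.Uᵀ x) :=
      fun x => by rw [rmul_mul]; rfl
    have hbBLU : ∀ x : Fin n → EuclideanSpace ℝ (Fin p), rmul b (rmul R.BLU x) = rmul R.LU x :=
      fun x => by
        rw [rmul_mul, BLU, ← Matrix.mul_assoc, ← Matrix.mul_assoc, h.edB_mul_inv,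
          Matrix.one_mul]
        rfl
    have hz1 : rmul R.Uᵀ (R.z (k + 1) ω) = rmul a Z - R.α • (rmul R.LU Gz + rmul R.LU (R.e k ω))
        - rmul b D := by
      rw [z_succ, rmul_sub, hUBz, hUWz, rmul_sub, rmul_smul, rmul_add, rmul_sub, rmul_smul,
        rmul_add, hLU, hLU]
    have hs1 : rmul R.Uᵀ (R.d (k + 1) ω - rmul R.B (R.z (k + 1) ω)) = D := by
      rw [d_succ, add_sub_cancel_right]
    have hwk : R.w k ω = Sum.elim Z (D - rmul b Z + R.α • rmul R.BLU Gy) := by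
      rw [w, rmul_sub, hUBz]
    have hblock : ∀ (A B' C' D' : Matrix (Fin (n - 1)) (Fin (n - 1)) ℝ)
        (x x' : Fin (n - 1) → EuclideanSpace ℝ (Fin p)),
        rmul (fromBlocks A B' C' D') (Sum.elim x x')
          = Sum.elim (rmul A x + rmul B' x') (rmul C' x + rmul D' x') := by
      intro A B' C' D' x x'
      ext1 j
      rcases j with i | i <;> simp [rmul, Fintype.sum_sum_type]
    have hneg : ∀ (A : Matrix (Fin (n - 1)) (Fin (n - 1)) ℝ)
        (x : Fin (n - 1) → EuclideanSpace ℝ (Fin p)), rmul (-A) x = -rmul A x := by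
      intro A x; ext1 j; simp [rmul, Finset.sum_neg_distrib]
    have hb2 : ∀ x : Fin (n - 1) → EuclideanSpace ℝ (Fin p),
        rmul b (rmul b x) = x - rmul a x := fun x => by
      rw [rmul_mul, h.edB_sq, sub_rmul, one_rmul]
    have hsub : ∀ (A : Matrix (Fin (n - 1)) (Fin n) ℝ) (x x' : Fin n → EuclideanSpace ℝ (Fin p)),
        (rmul A fun i => x i - x' i) = rmul A x - rmul A x' := fun A x x' => rmul_sub A x x'
    have hzero : rmul R.BLU (0 : Fin n → EuclideanSpace ℝ (Fin p)) = 0 := by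
      ext1 j; simp [rmul]
    rw [hwk, hblock, w, hs1, hz1, hzero, hneg, sub_rmul, sq, ← rmul_mul b b, hb2, one_rmul,
      rmul_add b, rmul_sub b, hb2, rmul_smul b, hbBLU, Matrix.diagonal_one, Matrix.mul_one]
    have e1 := hsub R.LU Gy Gz
    have e2 := hsub R.BLU Gy' Gy
    rw [e1, e2]
    ext1 j
    rcases j with i | i
    · simp only [Sum.elim_inl, Pi.add_apply, Pi.sub_apply, Pi.smul_apply, Pi.neg_apply]
      module
    · simp only [Sum.elim_inr, Pi.add_apply, Pi.sub_apply, Pi.smul_apply, Pi.zero_apply]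
      module
  rw [u, hw, uDet, rmul_sub, rmul_add, rmul_smul, rmul_smul, gammaMat, ← rmul_mul, ← rmul_mul,
    h.rmul_V_u]

end Run

end NormED

/-! ### Pathwise estimates and adaptedness of the iterates -/

namespace NormED

open Matrix
open scoped InnerProductSpace

/-- Square integrable and measurable with respect to the σ-algebra `m`. -/
structure IsL2 {Ω : Type*} {p : ℕ} (m : MeasurableSpace Ω) [MeasurableSpace Ω] (P : Measure Ω)
    (X : Ω → EuclideanSpace ℝ (Fin p)) : Prop where
  meas : Measurable[m] X
  memLp : MemLp X 2 P

namespace IsL2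

variable {Ω : Type*} {p : ℕ} {m m' : MeasurableSpace Ω} [mΩ : MeasurableSpace Ω] {P : Measure Ω}
  {X Y : Ω → EuclideanSpace ℝ (Fin p)}

theorem mono (h : IsL2 m P X) (hm : m ≤ m') : IsL2 m' P X := ⟨h.meas.mono hm le_rfl, h.memLp⟩

theorem add (hX : IsL2 m P X) (hY : IsL2 m P Y) : IsL2 m P fun ω => X ω + Y ω :=
  ⟨hX.meas.add hY.meas, hX.memLp.add hY.memLp⟩

theorem sub (hX : IsL2 m P X) (hY : IsL2 m P Y) : IsL2 m P fun ω => X ω - Y ω :=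
  ⟨hX.meas.sub hY.meas, hX.memLp.sub hY.memLp⟩

theorem smul (c : ℝ) (hX : IsL2 m P X) : IsL2 m P fun ω => c • X ω :=
  ⟨hX.meas.const_smul c, hX.memLp.const_smul c⟩

theorem const [IsFiniteMeasure P] (c : EuclideanSpace ℝ (Fin p)) : IsL2 m P fun _ => c :=
  ⟨measurable_const, memLp_const c⟩

theorem sum {ι : Type*} [Fintype ι] {X : ι → Ω → EuclideanSpace ℝ (Fin p)}
    (hX : ∀ i, IsL2 m P (X i)) : IsL2 m P fun ω => ∑ i, X i ω :=
  ⟨Finset.measurable_fun_sum _ fun i _ => (hX i).meas,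
    memLp_finsetSum _ fun i _ => (hX i).memLp⟩

theorem rmul {ι κ : Type} [Fintype ι] [Fintype κ] [DecidableEq ι] [DecidableEq κ]
    (A : Matrix ι κ ℝ) {X : Ω → κ → EuclideanSpace ℝ (Fin p)}
    (hX : ∀ j, IsL2 m P fun ω => X ω j) (i : ι) : IsL2 m P fun ω => rmul A (X ω) i :=
  IsL2.sum fun j => (hX j).smul (A i j)

theorem mean {n : ℕ} {X : Ω → Fin n → EuclideanSpace ℝ (Fin p)}
    (hX : ∀ j, IsL2 m P fun ω => X ω j) : IsL2 m P fun ω => mean (X ω) :=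
  (IsL2.sum hX).smul _

theorem comp_lipschitz [IsFiniteMeasure P] (hm : m ≤ mΩ)
    {F : EuclideanSpace ℝ (Fin p) → EuclideanSpace ℝ (Fin p)} {M : ℝ}
    (hF : ∀ z z', ‖F z' - F z‖ ≤ M * ‖z' - z‖) (hX : IsL2 m P X) : IsL2 m P fun ω => F (X ω) := by
  have hc : Continuous F := by
    have : LipschitzWith M.toNNReal F := by
      refine LipschitzWith.of_dist_le_mul fun x y => ?_
      rw [dist_eq_norm, dist_eq_norm]
      exact (hF y x).trans (mul_le_mul_of_nonneg_right (Real.le_coe_toNNReal M) (norm_nonneg _))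
    exact this.continuous
  have hmeas : Measurable[m] fun ω => F (X ω) := hc.measurable.comp hX.meas
  refine ⟨hmeas, ?_⟩
  refine ((memLp_const ‖F 0‖).add (hX.memLp.norm.const_mul M)).mono'
    (hmeas.mono hm le_rfl).aestronglyMeasurable (.of_forall fun ω => ?_)
  have h1 := hF 0 (X ω)
  have h2 := norm_le_norm_add_norm_sub' (F (X ω)) (F 0)
  rw [sub_zero] at h1
  simp only [Pi.add_apply]
  linarith

end IsL2

namespace Run

variable {n p : ℕ} {Ω Ξ : Type*} {R : Run n p Ω Ξ} [MeasurableSpace Ω] [MeasurableSpace Ξ]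
  {P : Measure Ω} {L ρ C₀ σ : ℝ} {G : SimpleGraph (Fin n)} {S : Set (EuclideanSpace ℝ (Fin p))}

/-! ### Pathwise bounds -/

/-- The deviation from the mean is `U Uᵀ z`, and `Uᵀ z` is the first half of `V u`; the factor is
`‖V‖² ≤ 4`. -/
theorem Valid.cons_le (h : R.Valid P L ρ C₀ σ G S) (k : ℕ) (ω : Ω) :
    R.cons k ω ≤ 4 * ∑ j, ‖R.u k ω j‖ ^ 2 := by
  have e1 : ∀ i, R.z k ω i - mean (R.z k ω) = rmul R.U (rmul R.Uᵀ (R.z k ω)) i := fun i => by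
    rw [rmul_mul, h.spectral.mul_transpose, sub_rmul, one_rmul, rmul_avgMat]
    rfl
  have h1 := sum_norm_sq_rmul_le R.U (rmul R.Uᵀ (R.z k ω))
  have h2 := sum_norm_sq_rmul_le R.V (R.u k ω)
  rw [h.rmul_V_u, Fintype.sum_sum_type] at h2
  have h3 : 0 ≤ ∑ i, ‖R.w k ω (Sum.inr i)‖ ^ 2 := Finset.sum_nonneg fun i _ => sq_nonneg _
  have h4 : specNorm R.U ^ 2 ≤ 1 := by
    have := pow_le_pow_left₀ (specNorm_nonneg _) h.spectral.specNorm_le_one 2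
    simpa using this
  have h5 : 0 ≤ ∑ j, ‖rmul R.Uᵀ (R.z k ω) j‖ ^ 2 := Finset.sum_nonneg fun i _ => sq_nonneg _
  have h6 : 0 ≤ ∑ j, ‖R.u k ω j‖ ^ 2 := Finset.sum_nonneg fun i _ => sq_nonneg _
  have h7 : ∑ i, ‖R.w k ω (Sum.inl i)‖ ^ 2 = ∑ j, ‖rmul R.Uᵀ (R.z k ω) j‖ ^ 2 := rfl
  calc R.cons k ω = ∑ i, ‖rmul R.U (rmul R.Uᵀ (R.z k ω)) i‖ ^ 2 :=
        Finset.sum_congr rfl fun i _ => by rw [e1]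
    _ ≤ specNorm R.U ^ 2 * ∑ j, ‖rmul R.Uᵀ (R.z k ω) j‖ ^ 2 := h1
    _ ≤ ∑ j, ‖rmul R.Uᵀ (R.z k ω) j‖ ^ 2 := mul_le_of_le_one_left h5 h4
    _ ≤ specNorm R.V ^ 2 * ∑ j, ‖R.u k ω j‖ ^ 2 := by linarith
    _ ≤ _ := mul_le_mul_of_nonneg_right h.transform.norm_sq_le h6

theorem Valid.sum_norm_z_sub_y (h : R.Valid P L ρ C₀ σ G S) (k : ℕ) (ω : Ω) :
    ∑ i, ‖R.z k ω i - R.y k ω‖ ^ 2 = R.cons k ω + n * ‖R.ν k ω‖ ^ 2 := by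
  rw [sum_norm_sub_sq h.n_pos, y, add_sub_cancel_left]
  rfl

theorem Valid.sum_norm_Fi_sub_le (h : R.Valid P L ρ C₀ σ G S) (k : ℕ) (ω : Ω) :
    ∑ i, ‖R.Fi i (R.y k ω) - R.Fi i (R.z k ω i)‖ ^ 2
      ≤ R.M ^ 2 * (4 * ∑ j, ‖R.u k ω j‖ ^ 2 + n * ‖R.ν k ω‖ ^ 2) := by
  have h1 : ∑ i, ‖R.Fi i (R.y k ω) - R.Fi i (R.z k ω i)‖ ^ 2
      ≤ ∑ i, R.M ^ 2 * ‖R.z k ω i - R.y k ω‖ ^ 2 := Finset.sum_le_sum fun i _ => by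
    rw [← mul_pow]
    have := h.norm_Fi_sub_le i (R.z k ω i) (R.y k ω)
    rw [norm_sub_rev (R.y k ω)] at this
    gcongr
  rw [← Finset.mul_sum, h.sum_norm_z_sub_y] at h1
  have := h.cons_le k ω
  exact h1.trans (by gcongr)

/-- `F(y)` is the mean of the component maps at `y`, so `r` is a mean of Lipschitz differences plus
`M ν`. Jensen and the parallelogram law finish. -/
theorem Valid.norm_r_sq_le (h : R.Valid P L ρ C₀ σ G S) (k : ℕ) (ω : Ω) :
    ‖R.r k ω‖ ^ 2 ≤ R.M ^ 2 * (8 * ((n : ℝ)⁻¹ * ∑ j, ‖R.u k ω j‖ ^ 2) + 4 * ‖R.ν k ω‖ ^ 2) := by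
  have hn : (0 : ℝ) < n := by have := h.n_pos; positivity
  have e1 : R.r k ω = mean (fun i => R.Fi i (R.z k ω i) - R.Fi i (R.y k ω)) + R.M • R.ν k ω := by
    rw [r, h.F_eq, mean_sub]
  have h1 := norm_mean_sq_le fun i => R.Fi i (R.z k ω i) - R.Fi i (R.y k ω)
  have h2 := h.sum_norm_Fi_sub_le k ω
  simp only [norm_sub_rev (R.Fi _ (R.y k ω))] at h2
  have h3 := h1.trans (mul_le_mul_of_nonneg_left h2 (inv_nonneg.2 hn.le))
  have h4 : ‖R.M • R.ν k ω‖ ^ 2 = R.M ^ 2 * ‖R.ν k ω‖ ^ 2 := by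
    rw [norm_smul, mul_pow, Real.norm_eq_abs, sq_abs]
  have h5 := parallelogram_law_with_norm ℝ
    (mean fun i => R.Fi i (R.z k ω i) - R.Fi i (R.y k ω)) (R.M • R.ν k ω)
  have h6 : (n : ℝ)⁻¹ * (R.M ^ 2 * (4 * ∑ j, ‖R.u k ω j‖ ^ 2 + n * ‖R.ν k ω‖ ^ 2))
      = R.M ^ 2 * (4 * ((n : ℝ)⁻¹ * ∑ j, ‖R.u k ω j‖ ^ 2) + ‖R.ν k ω‖ ^ 2) := by
    field_simp
  rw [h6] at h3
  rw [e1]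
  nlinarith [mul_self_nonneg ‖(mean fun i => R.Fi i (R.z k ω i) - R.Fi i (R.y k ω))
    - R.M • R.ν k ω‖]

theorem Valid.merit_succ_le (h : R.Valid P L ρ C₀ σ G S) (k : ℕ) (ω : Ω) :
    merit R.f R.φ R.γ (R.y (k + 1) ω) ≤ merit R.f R.φ R.γ (R.y k ω)
      - R.α / 4 * ‖R.F (R.y k ω)‖ ^ 2
      + R.α * R.M ^ 2 * (16 * ((n : ℝ)⁻¹ * ∑ j, ‖R.u k ω j‖ ^ 2) + 8 * ‖R.ν k ω‖ ^ 2) := by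
  rw [h.y_succ]
  have h1 := merit_step_le h.n_pos h.L_pos h.ρ_pos h.weaklyConvex h.smooth h.γ_pos h.γ_le h.α_pos
    h.α_le (R.y k ω) (R.r k ω)
  have h2 := mul_le_mul_of_nonneg_left (h.norm_r_sq_le k ω) (by linarith [h.α_pos] : 0 ≤ 2 * R.α)
  have e : R.F (R.y k ω) = Fnor (avgFun R.f) R.φ R.γ (R.y k ω) := rfl
  rw [← e] at h1
  linarith

/-- `Γ` contracts squared norms by `λ`, while the forcing consists of differences of Lipschitz maps:
`y` against `z`, and consecutive values of `y`. The latter are of order `α`, which pays for the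
large factor `D2`. -/
theorem Valid.sum_norm_uDet_sq_le (h : R.Valid P L ρ C₀ σ G S) (k : ℕ) (ω : Ω) :
    ∑ j, ‖R.uDet k ω j‖ ^ 2 ≤ (1 + lam R.W) / 2 * ∑ j, ‖R.u k ω j‖ ^ 2
      + 2 / (1 - lam R.W) * (R.α ^ 2 * (D1 R.U R.μ R.V ^ 2 * (R.M ^ 2 *
          (4 * ∑ j, ‖R.u k ω j‖ ^ 2 + n * ‖R.ν k ω‖ ^ 2))
        + D2 R.U R.μ (edB R.μ) R.V ^ 2 * (R.M ^ 2 * (n * (R.α ^ 2 *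
          (2 * ‖R.F (R.y k ω)‖ ^ 2 + 2 * ‖R.r k ω‖ ^ 2)))))) := by
  have hl := h.lam_pos
  have hl1 := h.lam_lt_one
  have h1 := sum_norm_sq_add_le (rmul (gammaMat R.μ (edB R.μ) (fun _ => 1) R.V) (R.u k ω))
    (R.α • rmul R.V⁻¹ (Sum.elim (rmul R.LU fun i => R.Fi i (R.y k ω) - R.Fi i (R.z k ω i))
      (rmul R.BLU fun i => R.Fi i (R.y (k + 1) ω) - R.Fi i (R.y k ω)))) hl hl1
  have h2 := sum_norm_sq_rmul_le (gammaMat R.μ (edB R.μ) (fun _ => 1) R.V) (R.u k ω)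
  have hβ : specNorm (gammaMat R.μ (edB R.μ) (fun _ => 1) R.V) = √(lam R.W) := h.transform.beta_eq
  rw [hβ, Real.sq_sqrt hl.le] at h2
  have h3 := R.sum_norm_sq_transform_le (fun i => R.Fi i (R.y k ω) - R.Fi i (R.z k ω i))
    (fun i => R.Fi i (R.y (k + 1) ω) - R.Fi i (R.y k ω))
  have h4 := h.sum_norm_Fi_sub_le k ω
  have h5 : ∑ i, ‖R.Fi i (R.y (k + 1) ω) - R.Fi i (R.y k ω)‖ ^ 2
      ≤ R.M ^ 2 * (n * (R.α ^ 2 * (2 * ‖R.F (R.y k ω)‖ ^ 2 + 2 * ‖R.r k ω‖ ^ 2))) := by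
    have hy : ‖R.y (k + 1) ω - R.y k ω‖ ^ 2
        ≤ R.α ^ 2 * (2 * ‖R.F (R.y k ω)‖ ^ 2 + 2 * ‖R.r k ω‖ ^ 2) := by
      rw [h.y_succ, sub_sub_cancel_left, norm_neg, norm_smul, mul_pow, Real.norm_eq_abs, sq_abs]
      refine mul_le_mul_of_nonneg_left ?_ (sq_nonneg _)
      have := parallelogram_law_with_norm ℝ (R.F (R.y k ω)) (R.r k ω)
      nlinarith [mul_self_nonneg ‖R.F (R.y k ω) - R.r k ω‖]
    have h6 : ∑ i, ‖R.Fi i (R.y (k + 1) ω) - R.Fi i (R.y k ω)‖ ^ 2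
        ≤ ∑ i : Fin n, R.M ^ 2 * ‖R.y (k + 1) ω - R.y k ω‖ ^ 2 := Finset.sum_le_sum fun i _ => by
      rw [← mul_pow]
      have := h.norm_Fi_sub_le i (R.y k ω) (R.y (k + 1) ω)
      gcongr
    refine h6.trans ?_
    rw [Finset.sum_const, Finset.card_univ, Fintype.card_fin, nsmul_eq_mul]
    have := mul_le_mul_of_nonneg_left hy (by positivity : 0 ≤ (n : ℝ) * R.M ^ 2)
    linarith
  have h7 := h3.trans (add_le_add (mul_le_mul_of_nonneg_left h4 (sq_nonneg _))
    (mul_le_mul_of_nonneg_left h5 (sq_nonneg _)))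
  have h8 := mul_le_mul_of_nonneg_left h7 (sq_nonneg R.α)
  simp only [Pi.smul_apply, norm_smul, mul_pow, Real.norm_eq_abs, sq_abs, ← Finset.mul_sum] at h1
  have h9 : 0 < 1 - lam R.W := by linarith
  have h10 : (1 + lam R.W) / (2 * lam R.W) * (lam R.W * ∑ j, ‖R.u k ω j‖ ^ 2)
      = (1 + lam R.W) / 2 * ∑ j, ‖R.u k ω j‖ ^ 2 := by field_simp
  calc ∑ j, ‖R.uDet k ω j‖ ^ 2 ≤ _ := h1
    _ ≤ (1 + lam R.W) / (2 * lam R.W) * (lam R.W * ∑ j, ‖R.u k ω j‖ ^ 2) + _ :=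
        add_le_add (mul_le_mul_of_nonneg_left h2 (by positivity))
          (mul_le_mul_of_nonneg_left h8 (by positivity))
    _ = _ := by rw [h10]

/-! ### Measurability and square integrability -/

variable (R) in
/-- The information available before iteration `k`. -/
def past (k : ℕ) : MeasurableSpace Ω := hist R.ξ {q | q.2 < k}

theorem Valid.past_le (h : R.Valid P L ρ C₀ σ G S) (k : ℕ) :
    R.past k ≤ (inferInstance : MeasurableSpace Ω) := hist_le h.oracle.measurable_sample _

theorem past_mono (k : ℕ) : R.past k ≤ R.past (k + 1) :=
  hist_mono fun q (hq : q.2 < k) => Nat.lt_succ_of_lt hq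

theorem Valid.measurable_err (h : R.Valid P L ρ C₀ σ G S) (i : Fin n) :
    Measurable fun q : EuclideanSpace ℝ (Fin p) × Ξ => R.err i q.1 q.2 := by
  have h1 := (h.weaklyConvex.continuous_prox h.γ_pos h.γρ_le).measurable
  have h2 := (continuous_gradient_prox h.L_pos h.weaklyConvex h.smooth h.γ_pos h.γρ_le i).measurable
  exact ((h.oracle.measurable_g i).comp ((h1.comp measurable_fst).prodMk measurable_snd)).sub
    (h2.comp measurable_fst)

variable (R) in
/-- The bound on the conditional variance of the noise. -/
noncomputable def varBound (C₀ σ : ℝ) (i : Fin n) (z : EuclideanSpace ℝ (Fin p)) : ℝ :=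
  C₀ * (R.f i (prox R.φ R.γ z) - infOnDom R.φ (R.f i)) + σ ^ 2

theorem Valid.continuous_comp_prox (h : R.Valid P L ρ C₀ σ G S) (i : Fin n) :
    Continuous fun z => R.f i (prox R.φ R.γ z) :=
  (quadLip_comp_prox h.L_pos h.weaklyConvex h.smooth h.γ_pos h.γρ_le i).continuous

theorem Valid.measurable_varBound (h : R.Valid P L ρ C₀ σ G S) (i : Fin n) :
    Measurable (R.varBound C₀ σ i) := by
  have := h.continuous_comp_prox i
  unfold varBound
  exact Continuous.measurable (by fun_prop)

variable [IsProbabilityMeasure P]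

theorem Valid.integrable_gap (h : R.Valid P L ρ C₀ σ G S) (i : Fin n)
    {X : Ω → EuclideanSpace ℝ (Fin p)} (hX : MemLp X 2 P) :
    Integrable (fun ω => R.f i (prox R.φ R.γ (X ω)) - infOnDom R.φ (R.f i)) P :=
  ((quadLip_comp_prox h.L_pos h.weaklyConvex h.smooth h.γ_pos h.γρ_le i).integrable_comp hX).sub
    (integrable_const _)

theorem Valid.integrable_varBound (h : R.Valid P L ρ C₀ σ G S) (i : Fin n)
    {X : Ω → EuclideanSpace ℝ (Fin p)} (hX : MemLp X 2 P) :
    Integrable (fun ω => R.varBound C₀ σ i (X ω)) P :=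
  ((h.integrable_gap i hX).const_mul C₀).add (integrable_const _)

/-- Second moment of the noise at an independent random point. -/
theorem Valid.err_sq_le (h : R.Valid P L ρ C₀ σ G S) (i : Fin n) (k : ℕ)
    {X : Ω → EuclideanSpace ℝ (Fin p)} (hX : IsL2 (R.past k) P X) :
    MemLp (fun ω => R.err i (X ω) (R.ξ i k ω)) 2 P ∧
      ∫ ω, ‖R.err i (X ω) (R.ξ i k ω)‖ ^ 2 ∂P ≤ ∫ ω, R.varBound C₀ σ i (X ω) ∂P := by
  have hmem := fun z => h.weaklyConvex.prox_mem h.γ_pos z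
  exact noise_sq_le (hX.meas.mono (h.past_le k) le_rfl) (h.oracle.measurable_sample i k)
    (indepFun_of_measurable_hist h.oracle.measurable_sample h.oracle.indep
      (T := {q | q.2 < k}) (by simp) hX.meas)
    (h.measurable_err i) (fun z => h.oracle.integrable_sq i k _ (hmem z))
    (fun z => h.oracle.variance_le i k _ (hmem z)) (h.measurable_varBound i)
    (h.integrable_varBound i hX.memLp)

/-- The noise is orthogonal to the past and to the noise of the other agents. -/
theorem Valid.integral_inner_err (h : R.Valid P L ρ C₀ σ G S) (i : Fin n) (k : ℕ)
    {T : Set (Fin n × ℕ)} (hT : (i, k) ∉ T) (hkT : {q | q.2 < k} ⊆ T)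
    {X A : Ω → EuclideanSpace ℝ (Fin p)} (hX : IsL2 (R.past k) P X)
    (hA : IsL2 (hist R.ξ T) P A) :
    ∫ ω, ⟪A ω, R.err i (X ω) (R.ξ i k ω)⟫_ℝ ∂P = 0 := by
  have hmem := fun z => h.weaklyConvex.prox_mem h.γ_pos z
  have hXT : Measurable[hist R.ξ T] X := hX.meas.mono (hist_mono hkT) le_rfl
  have hle := hist_le h.oracle.measurable_sample T
  refine integral_inner_noise_eq_zero (hA.meas.mono hle le_rfl) (hXT.mono hle le_rfl)
    (h.oracle.measurable_sample i k)
    (indepFun_of_measurable_hist h.oracle.measurable_sample h.oracle.indep hT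
      (hA.meas.prodMk hXT))
    (h.measurable_err i) (fun z => ?_) (fun z => ?_) hA.memLp (h.err_sq_le i k hX).1
  · exact (h.oracle.integrable i k _ (hmem z)).sub (integrable_const _)
  · simp only [err]
    rw [integral_sub (h.oracle.integrable i k _ (hmem z)) (integrable_const _),
      h.oracle.unbiased i k _ (hmem z)]
    simp

theorem Valid.isL2_e_of (h : R.Valid P L ρ C₀ σ G S) (k : ℕ) (i : Fin n)
    {T : Set (Fin n × ℕ)} (hT : (i, k) ∈ T) (hkT : {q | q.2 < k} ⊆ T)
    (hz : IsL2 (R.past k) P fun ω => R.z k ω i) : IsL2 (hist R.ξ T) P fun ω => R.e k ω i := by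
  have he : (fun ω => R.e k ω i) = fun ω => R.err i (R.z k ω i) (R.ξ i k ω) := rfl
  rw [he]
  refine ⟨?_, (h.err_sq_le i k hz).1⟩
  have h1 : Measurable[hist R.ξ T] fun ω => R.z k ω i := hz.meas.mono (hist_mono hkT) le_rfl
  have h2 : Measurable[hist R.ξ T] fun ω => (R.z k ω i, R.ξ i k ω) :=
    h1.prodMk (measurable_hist hT)
  have h3 := (h.measurable_err i).comp h2
  exact h3

theorem Valid.isL2_Fi (h : R.Valid P L ρ C₀ σ G S) (i : Fin n) {k : ℕ}
    {X : Ω → EuclideanSpace ℝ (Fin p)} (hX : IsL2 (R.past k) P X) :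
    IsL2 (R.past k) P fun ω => R.Fi i (X ω) :=
  hX.comp_lipschitz (h.past_le k) (h.norm_Fi_sub_le i)

theorem Valid.isL2_zd (h : R.Valid P L ρ C₀ σ G S) (k : ℕ) :
    (∀ i, IsL2 (R.past k) P fun ω => R.z k ω i) ∧ (∀ i, IsL2 (R.past k) P fun ω => R.d k ω i) := by
  induction k with
  | zero => exact ⟨fun i => IsL2.const _, fun i => IsL2.const _⟩
  | succ k ih =>
    obtain ⟨hz, hd⟩ := ih
    have hz' := fun i => (hz i).mono (past_mono k)
    have hd' := fun i => (hd i).mono (past_mono k)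
    have he : ∀ i, IsL2 (R.past (k + 1)) P fun ω => R.e k ω i := fun i =>
      h.isL2_e_of k i (by simp) (fun q (hq : q.2 < k) => Nat.lt_succ_of_lt hq) (hz i)
    have hzs : ∀ i, IsL2 (R.past (k + 1)) P fun ω => R.z (k + 1) ω i := fun i => by
      simp only [z_succ]
      refine IsL2.sub (IsL2.rmul _ (fun j => ?_) i) (IsL2.rmul _ hd' i)
      exact (hz' j).sub (((h.isL2_Fi j (hz' j)).add (he j)).smul _)
    refine ⟨hzs, fun i => ?_⟩
    simp only [d_succ]
    exact (hd' i).add (IsL2.rmul _ hzs i)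

theorem Valid.isL2_z (h : R.Valid P L ρ C₀ σ G S) (k : ℕ) (i : Fin n) :
    IsL2 (R.past k) P fun ω => R.z k ω i := (h.isL2_zd k).1 i

theorem Valid.isL2_e (h : R.Valid P L ρ C₀ σ G S) (k : ℕ) (i : Fin n) :
    IsL2 (R.past (k + 1)) P fun ω => R.e k ω i :=
  h.isL2_e_of k i (by simp) (fun q (hq : q.2 < k) => Nat.lt_succ_of_lt hq) (h.isL2_z k i)

theorem Valid.isL2_ν (h : R.Valid P L ρ C₀ σ G S) (k : ℕ) : IsL2 (R.past k) P (R.ν k) := by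
  induction k with
  | zero => exact IsL2.const 0
  | succ k ih =>
    exact ((ih.mono (past_mono k)).smul _).add ((IsL2.mean (h.isL2_e k)).smul _)

theorem Valid.isL2_y (h : R.Valid P L ρ C₀ σ G S) (k : ℕ) : IsL2 (R.past k) P (R.y k) :=
  (IsL2.mean (h.isL2_z k)).add (h.isL2_ν k)

theorem Valid.isL2_F (h : R.Valid P L ρ C₀ σ G S) (k : ℕ) :
    IsL2 (R.past k) P fun ω => R.F (R.y k ω) :=
  (h.isL2_y k).comp_lipschitz (h.past_le k) h.norm_F_sub_le

theorem Valid.isL2_r (h : R.Valid P L ρ C₀ σ G S) (k : ℕ) : IsL2 (R.past k) P (R.r k) :=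
  ((IsL2.mean fun i => h.isL2_Fi i (h.isL2_z k i)).sub (h.isL2_F k)).add ((h.isL2_ν k).smul _)

theorem Valid.isL2_u (h : R.Valid P L ρ C₀ σ G S) (k : ℕ) (j : Fin (n - 1) ⊕ Fin (n - 1)) :
    IsL2 (R.past k) P fun ω => R.u k ω j := by
  refine IsL2.rmul _ (fun j => ?_) j
  rcases j with j | j
  · exact IsL2.rmul _ (h.isL2_z k) j
  · refine IsL2.add (IsL2.rmul _ (fun i => ?_) j)
      (IsL2.smul _ (IsL2.rmul _ (fun i => h.isL2_Fi i (h.isL2_y k)) j))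
    exact ((h.isL2_zd k).2 i).sub (IsL2.rmul _ (h.isL2_z k) i)

/-- The next corrected average is known before the iteration. -/
theorem Valid.isL2_y_succ (h : R.Valid P L ρ C₀ σ G S) (k : ℕ) :
    IsL2 (R.past k) P (R.y (k + 1)) := by
  have : R.y (k + 1) = fun ω => R.y k ω - R.α • (R.F (R.y k ω) + R.r k ω) :=
    funext fun ω => h.y_succ k ω
  rw [this]
  exact (h.isL2_y k).sub (((h.isL2_F k).add (h.isL2_r k)).smul _)

/-- `uDet` involves `y (k + 1)`, which is nevertheless determined by the past. Without the filtered
correction its product with the fresh noise would not average out. -/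
theorem Valid.isL2_uDet (h : R.Valid P L ρ C₀ σ G S) (k : ℕ) (j : Fin (n - 1) ⊕ Fin (n - 1)) :
    IsL2 (R.past k) P fun ω => R.uDet k ω j := by
  refine IsL2.add (IsL2.rmul _ (h.isL2_u k) j) (IsL2.smul _ (IsL2.rmul _ (fun j => ?_) j))
  rcases j with j | j
  · exact IsL2.rmul _ (fun i => (h.isL2_Fi i (h.isL2_y k)).sub (h.isL2_Fi i (h.isL2_z k i))) j
  · exact IsL2.rmul _
      (fun i => (h.isL2_Fi i (h.isL2_y_succ k)).sub (h.isL2_Fi i (h.isL2_y k))) j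

end Run

end NormED

/-! ### Recursions for expected quantities -/

namespace NormED

open Matrix
open scoped InnerProductSpace

/-- `f` is integrable with expectation `a`. -/
structure HasExp {Ω : Type*} [MeasurableSpace Ω] (P : Measure Ω) (f : Ω → ℝ) (a : ℝ) : Prop where
  integrable : Integrable f P
  integral_eq : ∫ ω, f ω ∂P = a

namespace HasExp

variable {Ω : Type*} [MeasurableSpace Ω] {P : Measure Ω} {f g : Ω → ℝ} {a b : ℝ}

theorem add (hf : HasExp P f a) (hg : HasExp P g b) : HasExp P (fun ω => f ω + g ω) (a + b) :=
  ⟨hf.integrable.add hg.integrable, by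
    rw [integral_add hf.integrable hg.integrable, hf.integral_eq, hg.integral_eq]⟩

theorem sub (hf : HasExp P f a) (hg : HasExp P g b) : HasExp P (fun ω => f ω - g ω) (a - b) :=
  ⟨hf.integrable.sub hg.integrable, by
    rw [integral_sub hf.integrable hg.integrable, hf.integral_eq, hg.integral_eq]⟩

theorem const_mul (c : ℝ) (hf : HasExp P f a) : HasExp P (fun ω => c * f ω) (c * a) :=
  ⟨hf.integrable.const_mul c, by rw [integral_const_mul, hf.integral_eq]⟩

theorem const [IsProbabilityMeasure P] (c : ℝ) : HasExp P (fun _ => c) c :=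
  ⟨integrable_const c, by simp⟩

theorem sum {ι : Type*} [Fintype ι] {f : ι → Ω → ℝ} {a : ι → ℝ} (hf : ∀ i, HasExp P (f i) (a i)) :
    HasExp P (fun ω => ∑ i, f i ω) (∑ i, a i) :=
  ⟨integrable_finsetSum _ fun i _ => (hf i).integrable, by
    rw [integral_finsetSum _ fun i _ => (hf i).integrable]
    exact Finset.sum_congr rfl fun i _ => (hf i).integral_eq⟩

/-- Pathwise inequalities become inequalities of expectations once both sides are assembled by the
closure rules above. -/
theorem le (hf : HasExp P f a) (hg : HasExp P g b) (h : ∀ ω, f ω ≤ g ω) : a ≤ b := by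
  rw [← hf.integral_eq, ← hg.integral_eq]
  exact integral_mono hf.integrable hg.integrable h

end HasExp

namespace Run

variable {n p : ℕ} {Ω Ξ : Type*} {R : Run n p Ω Ξ} [MeasurableSpace Ω] [MeasurableSpace Ξ]
  {P : Measure Ω} {L ρ C₀ σ : ℝ} {G : SimpleGraph (Fin n)} {S : Set (EuclideanSpace ℝ (Fin p))}

variable (R P) in
/-- Expected merit function. -/
noncomputable def hE (k : ℕ) : ℝ := ∫ ω, merit R.f R.φ R.γ (R.y k ω) ∂P

variable (R P) in
/-- Expected squared normal map. -/
noncomputable def aE (k : ℕ) : ℝ := ∫ ω, ‖R.F (R.y k ω)‖ ^ 2 ∂P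

variable (R P) in
/-- Expected squared filtered noise. -/
noncomputable def νE (k : ℕ) : ℝ := ∫ ω, ‖R.ν k ω‖ ^ 2 ∂P

variable (R P) in
/-- Expected squared consensus error per agent. -/
noncomputable def uE (k : ℕ) : ℝ := ∫ ω, (n : ℝ)⁻¹ * ∑ j, ‖R.u k ω j‖ ^ 2 ∂P

variable (R P) in
/-- Average noise variance. -/
noncomputable def eE (k : ℕ) : ℝ := (n : ℝ)⁻¹ * ∑ i, ∫ ω, ‖R.e k ω i‖ ^ 2 ∂P

theorem aE_nonneg (k : ℕ) : 0 ≤ R.aE P k := integral_nonneg fun _ => sq_nonneg _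

theorem νE_nonneg (k : ℕ) : 0 ≤ R.νE P k := integral_nonneg fun _ => sq_nonneg _

theorem uE_nonneg (k : ℕ) : 0 ≤ R.uE P k := integral_nonneg fun _ =>
  mul_nonneg (by positivity) (Finset.sum_nonneg fun _ _ => sq_nonneg _)

theorem Valid.hE_nonneg (h : R.Valid P L ρ C₀ σ G S) (k : ℕ) : 0 ≤ R.hE P k :=
  integral_nonneg fun _ => merit_nonneg h.weaklyConvex h.smooth h.γ_pos _

variable [IsProbabilityMeasure P]

theorem Valid.hasExp_a (h : R.Valid P L ρ C₀ σ G S) (k : ℕ) :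
    HasExp P (fun ω => ‖R.F (R.y k ω)‖ ^ 2) (R.aE P k) :=
  ⟨integrable_norm_sq_of_memLp (h.isL2_F k).memLp, rfl⟩

theorem Valid.hasExp_ν (h : R.Valid P L ρ C₀ σ G S) (k : ℕ) :
    HasExp P (fun ω => ‖R.ν k ω‖ ^ 2) (R.νE P k) :=
  ⟨integrable_norm_sq_of_memLp (h.isL2_ν k).memLp, rfl⟩

theorem Valid.hasExp_u (h : R.Valid P L ρ C₀ σ G S) (k : ℕ) :
    HasExp P (fun ω => (n : ℝ)⁻¹ * ∑ j, ‖R.u k ω j‖ ^ 2) (R.uE P k) :=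
  ⟨(integrable_finsetSum _ fun j _ =>
    integrable_norm_sq_of_memLp (h.isL2_u k j).memLp).const_mul _, rfl⟩

theorem Valid.hasExp_e (h : R.Valid P L ρ C₀ σ G S) (k : ℕ) :
    HasExp P (fun ω => (n : ℝ)⁻¹ * ∑ i, ‖R.e k ω i‖ ^ 2) (R.eE P k) :=
  (HasExp.sum fun i => ⟨integrable_norm_sq_of_memLp (h.isL2_e k i).memLp, rfl⟩).const_mul _

theorem Valid.integrable_merit (h : R.Valid P L ρ C₀ σ G S) {X : Ω → EuclideanSpace ℝ (Fin p)}
    (hX : MemLp X 2 P) (hF : MemLp (fun ω => R.F (X ω)) 2 P) :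
    Integrable (fun ω => merit R.f R.φ R.γ (X ω)) P := by
  have h1 : Integrable (fun ω => avgFun R.f (prox R.φ R.γ (X ω))) P :=
    (integrable_finsetSum _ fun i _ =>
      (quadLip_comp_prox h.L_pos h.weaklyConvex h.smooth h.γ_pos h.γρ_le i).integrable_comp
        hX).const_mul _
  have h2 := (quadLip_toReal_prox h.ρ_pos h.weaklyConvex h.γ_pos h.γρ_le).integrable_comp hX
  have h3 := (integrable_norm_sq_of_memLp hF).const_mul (R.γ / 2)
  exact ((h1.add h2).sub (integrable_const _)).add h3

theorem Valid.hasExp_merit (h : R.Valid P L ρ C₀ σ G S) (k : ℕ) :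
    HasExp P (fun ω => merit R.f R.φ R.γ (R.y k ω)) (R.hE P k) :=
  ⟨h.integrable_merit (h.isL2_y k).memLp (h.isL2_F k).memLp, rfl⟩

/-- Decrease of the expected merit function. -/
theorem Valid.hE_succ_le (h : R.Valid P L ρ C₀ σ G S) (k : ℕ) :
    R.hE P (k + 1) ≤ R.hE P k - R.α / 4 * R.aE P k
      + R.α * R.M ^ 2 * (16 * R.uE P k + 8 * R.νE P k) :=
  (h.hasExp_merit (k + 1)).le (((h.hasExp_merit k).sub ((h.hasExp_a k).const_mul _)).add
    ((((h.hasExp_u k).const_mul 16).add ((h.hasExp_ν k).const_mul 8)).const_mul _))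
    (h.merit_succ_le k)

theorem Valid.integral_inner_e (h : R.Valid P L ρ C₀ σ G S) (k : ℕ) (i : Fin n)
    {A : Ω → EuclideanSpace ℝ (Fin p)} (hA : IsL2 (R.past k) P A) :
    ∫ ω, ⟪A ω, R.e k ω i⟫_ℝ ∂P = 0 :=
  h.integral_inner_err i k (T := {q | q.2 < k}) (by simp) le_rfl (h.isL2_z k i) hA

/-- The sample of agent `j` is adjoined to the past; the sample `(i, k)` remains outside, so the
noise of agent `i` is still centred given the enlarged information. -/
theorem Valid.integral_inner_e_e (h : R.Valid P L ρ C₀ σ G S) (k : ℕ) {i j : Fin n}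
    (hij : j ≠ i) : ∫ ω, ⟪R.e k ω j, R.e k ω i⟫_ℝ ∂P = 0 := by
  refine h.integral_inner_err i k (T := {q | q.2 < k ∨ q = (j, k)}) ?_ (fun q hq => Or.inl hq)
    (h.isL2_z k i) ?_
  · simp [hij.symm]
  · exact h.isL2_e_of k j (by simp) (fun q hq => Or.inl hq) (h.isL2_z k j)

/-- The averaged noise has variance reduced by the factor `n`. -/
theorem Valid.integral_mean_e_sq (h : R.Valid P L ρ C₀ σ G S) (k : ℕ) :
    ∫ ω, ‖mean (R.e k ω)‖ ^ 2 ∂P = (n : ℝ)⁻¹ * R.eE P k := by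
  have e1 : ∀ ω, ‖mean (R.e k ω)‖ ^ 2
      = (n : ℝ)⁻¹ * ((n : ℝ)⁻¹ * ∑ i, ∑ j, ⟪R.e k ω j, R.e k ω i⟫_ℝ) := fun ω => by
    rw [← real_inner_self_eq_norm_sq, mean, inner_smul_left, inner_smul_right, inner_sum]
    simp only [sum_inner, conj_trivial]
  have hint : ∀ i j, Integrable (fun ω => ⟪R.e k ω j, R.e k ω i⟫_ℝ) P := fun i j =>
    integrable_inner_of_memLp (h.isL2_e k j).memLp (h.isL2_e k i).memLp
  simp only [e1]
  rw [integral_const_mul, integral_const_mul, eE,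
    integral_finsetSum _ fun i _ => integrable_finsetSum _ fun j _ => hint i j]
  congr 2
  refine Finset.sum_congr rfl fun i _ => ?_
  rw [integral_finsetSum _ fun j _ => hint i j, Finset.sum_eq_single i]
  · simp only [real_inner_self_eq_norm_sq]
  · exact fun j _ hj => h.integral_inner_e_e k hj
  · simp

/-- Recursion of the filtered noise. -/
theorem Valid.νE_succ_le (h : R.Valid P L ρ C₀ σ G S) (k : ℕ) :
    R.νE P (k + 1) ≤ (1 - R.α * R.M) * R.νE P k + R.α ^ 2 * ((n : ℝ)⁻¹ * R.eE P k) := by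
  set c := 1 - R.α * R.M with hc
  have hme : IsL2 (R.past (k + 1)) P fun ω => mean (R.e k ω) := IsL2.mean (h.isL2_e k)
  have e1 : ∀ ω, ‖R.ν (k + 1) ω‖ ^ 2 = c ^ 2 * ‖R.ν k ω‖ ^ 2
      + 2 * c * R.α * ⟪R.ν k ω, mean (R.e k ω)⟫_ℝ + R.α ^ 2 * ‖mean (R.e k ω)‖ ^ 2 := fun ω => by
    have : R.ν (k + 1) ω = c • R.ν k ω + R.α • mean (R.e k ω) := rfl
    rw [this, norm_add_sq_real, inner_smul_left, inner_smul_right, norm_smul, norm_smul, mul_pow,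
      mul_pow, Real.norm_eq_abs, Real.norm_eq_abs, sq_abs, sq_abs, conj_trivial]
    ring
  have hcross : ∫ ω, ⟪R.ν k ω, mean (R.e k ω)⟫_ℝ ∂P = 0 := by
    simp only [mean, inner_smul_right, inner_sum]
    rw [integral_const_mul, integral_finsetSum _ fun i _ =>
      integrable_inner_of_memLp (h.isL2_ν k).memLp (h.isL2_e k i).memLp]
    simp [h.integral_inner_e k _ (h.isL2_ν k)]
  have key : R.νE P (k + 1) = c ^ 2 * R.νE P k + R.α ^ 2 * ((n : ℝ)⁻¹ * R.eE P k) := by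
    have hx : HasExp P (fun ω => ⟪R.ν k ω, mean (R.e k ω)⟫_ℝ) 0 :=
      ⟨integrable_inner_of_memLp (h.isL2_ν k).memLp hme.memLp, hcross⟩
    have hm : HasExp P (fun ω => ‖mean (R.e k ω)‖ ^ 2) ((n : ℝ)⁻¹ * R.eE P k) :=
      ⟨integrable_norm_sq_of_memLp hme.memLp, h.integral_mean_e_sq k⟩
    have := ((((h.hasExp_ν k).const_mul (c ^ 2)).add (hx.const_mul (2 * c * R.α))).add
      (hm.const_mul (R.α ^ 2))).integral_eq
    rw [νE]
    simp only [e1]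
    rw [this]
    ring
  -- Here `0 ≤ c ≤ 1` because `α M ≤ 1`; the contraction `1 - α M` is all that is needed later.
  have h1 : c ^ 2 ≤ c := by
    have h2 := h.αM_le
    have h3 := mul_pos h.α_pos h.M_pos
    nlinarith
  rw [key]
  have := mul_le_mul_of_nonneg_right h1 (νE_nonneg (R := R) (P := P) k)
  linarith

/-- Recursion of the transformed consensus error. -/
theorem Valid.uE_succ_le (h : R.Valid P L ρ C₀ σ G S) (k : ℕ) :
    R.uE P (k + 1) ≤ (1 + lam R.W) / 2 * R.uE P k
      + 2 / (1 - lam R.W) * (R.α ^ 2 * (D1 R.U R.μ R.V ^ 2 * (R.M ^ 2 *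
          (4 * R.uE P k + R.νE P k))
        + D2 R.U R.μ (edB R.μ) R.V ^ 2 * (R.M ^ 2 * (R.α ^ 2 *
          (2 * R.aE P k + 2 * (R.M ^ 2 * (8 * R.uE P k + 4 * R.νE P k)))))))
      + R.α ^ 2 * (D1 R.U R.μ R.V ^ 2 * R.eE P k) := by
  have hn : (0 : ℝ) < n := by have := h.n_pos; positivity
  have hl1 := h.lam_lt_one
  -- The noise enters only the first block before `V⁻¹`, so its size is governed by `D1` alone.
  set Q : Matrix (Fin (n - 1) ⊕ Fin (n - 1)) (Fin n) ℝ := 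
    R.V⁻¹ * (Matrix.fromRows R.LU (0 : Matrix (Fin (n - 1)) (Fin n) ℝ) :
      Matrix (Fin (n - 1) ⊕ Fin (n - 1)) (Fin n) ℝ) with hQ
  have hQe : ∀ ω, rmul R.V⁻¹ (Sum.elim (rmul R.LU (R.e k ω)) (rmul R.BLU 0))
      = rmul Q (R.e k ω) := fun ω => by
    rw [hQ, ← rmul_mul]
    congr 1
    ext1 j
    rcases j with j | j <;> simp [rmul]
  have hQle : ∀ ω, ∑ j, ‖rmul Q (R.e k ω) j‖ ^ 2
      ≤ D1 R.U R.μ R.V ^ 2 * ∑ i, ‖R.e k ω i‖ ^ 2 := fun ω => by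
    rw [← hQe]
    simpa using R.sum_norm_sq_transform_le (R.e k ω) 0
  have hQL : ∀ j, IsL2 (R.past (k + 1)) P fun ω => rmul Q (R.e k ω) j :=
    fun j => IsL2.rmul _ (h.isL2_e k) j
  have hD := h.isL2_uDet k
  -- exact expansion
  have e1 : ∀ ω, (n : ℝ)⁻¹ * ∑ j, ‖R.u (k + 1) ω j‖ ^ 2
      = (n : ℝ)⁻¹ * ∑ j, ‖R.uDet k ω j‖ ^ 2
        - (n : ℝ)⁻¹ * (2 * R.α) * ∑ i, ⟪rmul Qᵀ (R.uDet k ω) i, R.e k ω i⟫_ℝ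
        + (n : ℝ)⁻¹ * R.α ^ 2 * ∑ j, ‖rmul Q (R.e k ω) j‖ ^ 2 := fun ω => by
    rw [← sum_inner_rmul, h.u_succ, hQe, Finset.mul_sum, Finset.mul_sum, Finset.mul_sum,
      Finset.mul_sum, ← Finset.sum_sub_distrib, ← Finset.sum_add_distrib]
    refine Finset.sum_congr rfl fun j _ => ?_
    rw [Pi.sub_apply, Pi.smul_apply, norm_sub_sq_real, inner_smul_right, norm_smul, mul_pow,
      Real.norm_eq_abs, sq_abs]
    ring
  have hle : ∀ ω, (n : ℝ)⁻¹ * ∑ j, ‖R.u (k + 1) ω j‖ ^ 2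
      ≤ (1 + lam R.W) / 2 * ((n : ℝ)⁻¹ * ∑ j, ‖R.u k ω j‖ ^ 2)
      + 2 / (1 - lam R.W) * (R.α ^ 2 * (D1 R.U R.μ R.V ^ 2 * (R.M ^ 2 *
          (4 * ((n : ℝ)⁻¹ * ∑ j, ‖R.u k ω j‖ ^ 2) + ‖R.ν k ω‖ ^ 2))
        + D2 R.U R.μ (edB R.μ) R.V ^ 2 * (R.M ^ 2 * (R.α ^ 2 *
          (2 * ‖R.F (R.y k ω)‖ ^ 2 + 2 * (R.M ^ 2 *
            (8 * ((n : ℝ)⁻¹ * ∑ j, ‖R.u k ω j‖ ^ 2) + 4 * ‖R.ν k ω‖ ^ 2)))))))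
      - (n : ℝ)⁻¹ * (2 * R.α) * ∑ i, ⟪rmul Qᵀ (R.uDet k ω) i, R.e k ω i⟫_ℝ
      + R.α ^ 2 * (D1 R.U R.μ R.V ^ 2 * ((n : ℝ)⁻¹ * ∑ i, ‖R.e k ω i‖ ^ 2)) := fun ω => by
    rw [e1]
    have h1 := mul_le_mul_of_nonneg_left (h.sum_norm_uDet_sq_le k ω) (inv_nonneg.2 hn.le)
    have h2 := mul_le_mul_of_nonneg_left (hQle ω) (by positivity : 0 ≤ (n : ℝ)⁻¹ * R.α ^ 2)
    have h3 := h.norm_r_sq_le k ω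
    set q := ∑ j, ‖R.u k ω j‖ ^ 2 with hq
    set D := D2 R.U R.μ (edB R.μ) R.V ^ 2 with hDD
    have hD0 : 0 ≤ D := sq_nonneg _
    have h5 : 0 < 1 - lam R.W := by linarith
    have e2 : (n : ℝ)⁻¹ * ((1 + lam R.W) / 2 * q
        + 2 / (1 - lam R.W) * (R.α ^ 2 * (D1 R.U R.μ R.V ^ 2 * (R.M ^ 2 *
            (4 * q + n * ‖R.ν k ω‖ ^ 2))
          + D * (R.M ^ 2 * (n * (R.α ^ 2 *
            (2 * ‖R.F (R.y k ω)‖ ^ 2 + 2 * ‖R.r k ω‖ ^ 2)))))))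
        = (1 + lam R.W) / 2 * ((n : ℝ)⁻¹ * q)
        + 2 / (1 - lam R.W) * (R.α ^ 2 * (D1 R.U R.μ R.V ^ 2 * (R.M ^ 2 *
            (4 * ((n : ℝ)⁻¹ * q) + ‖R.ν k ω‖ ^ 2))
          + D * (R.M ^ 2 * (R.α ^ 2 *
            (2 * ‖R.F (R.y k ω)‖ ^ 2 + 2 * ‖R.r k ω‖ ^ 2))))) := by
      field_simp
    rw [e2] at h1
    have h4 : 2 / (1 - lam R.W) * (R.α ^ 2 * (D1 R.U R.μ R.V ^ 2 * (R.M ^ 2 *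
            (4 * ((n : ℝ)⁻¹ * q) + ‖R.ν k ω‖ ^ 2))
          + D * (R.M ^ 2 * (R.α ^ 2 *
            (2 * ‖R.F (R.y k ω)‖ ^ 2 + 2 * ‖R.r k ω‖ ^ 2)))))
        ≤ 2 / (1 - lam R.W) * (R.α ^ 2 * (D1 R.U R.μ R.V ^ 2 * (R.M ^ 2 *
            (4 * ((n : ℝ)⁻¹ * q) + ‖R.ν k ω‖ ^ 2))
          + D * (R.M ^ 2 * (R.α ^ 2 *
            (2 * ‖R.F (R.y k ω)‖ ^ 2 + 2 * (R.M ^ 2 *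
              (8 * ((n : ℝ)⁻¹ * q) + 4 * ‖R.ν k ω‖ ^ 2))))))) := by
      gcongr
    linarith
  -- The cross term has mean zero, since `Qᵀ uDet` is known before the samples of iteration `k`.
  have ic : HasExp P (fun ω => ∑ i, ⟪rmul Qᵀ (R.uDet k ω) i, R.e k ω i⟫_ℝ)
      (∑ _i : Fin n, (0 : ℝ)) := HasExp.sum fun i =>
    ⟨integrable_inner_of_memLp (IsL2.rmul Qᵀ hD i).memLp (h.isL2_e k i).memLp,
      h.integral_inner_e k i (IsL2.rmul Qᵀ hD i)⟩
  have iu := h.hasExp_u k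
  have iν := h.hasExp_ν k
  have ia := h.hasExp_a k
  have key := (h.hasExp_u (k + 1)).le (((((iu.const_mul ((1 + lam R.W) / 2)).add
    ((((((((iu.const_mul 4).add iν).const_mul (R.M ^ 2)).const_mul
      (D1 R.U R.μ R.V ^ 2)).add ((((ia.const_mul 2).add
      ((((iu.const_mul 8).add (iν.const_mul 4)).const_mul (R.M ^ 2)).const_mul 2)).const_mul
        (R.α ^ 2)).const_mul (R.M ^ 2) |>.const_mul
          (D2 R.U R.μ (edB R.μ) R.V ^ 2)))).const_mul (R.α ^ 2)).const_mul
            (2 / (1 - lam R.W)))).sub (ic.const_mul ((n : ℝ)⁻¹ * (2 * R.α)))).add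
    (((h.hasExp_e k).const_mul (D1 R.U R.μ R.V ^ 2)).const_mul (R.α ^ 2)))) hle
  simpa using key

end Run

end NormED

/-! ### Noise variance, stationarity measure and initial values -/

namespace NormED

open Matrix
open scoped InnerProductSpace

/-- The average gap of the components is controlled by the gap of `ψ` and the heterogeneity. -/
theorem mean_gap_le {n p : ℕ} {f : Fin n → EuclideanSpace ℝ (Fin p) → ℝ}
    {φ : EuclideanSpace ℝ (Fin p) → EReal} {ρ : ℝ} (hφ : IsWeaklyConvex φ ρ)
    {x : EuclideanSpace ℝ (Fin p)} (hx : x ∈ dom φ) :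
    (n : ℝ)⁻¹ * ∑ i, (f i x - infOnDom φ (f i)) ≤ psiGap f φ x + sigmaF f φ := by
  have h1 := hφ.infOnDom_le hx
  rw [Finset.sum_sub_distrib, mul_sub, psiGap, sigmaF]
  have : avgFun f x = (n : ℝ)⁻¹ * ∑ i, f i x := rfl
  linarith

namespace Run

variable {n p : ℕ} {Ω Ξ : Type*} {R : Run n p Ω Ξ} [MeasurableSpace Ω] [MeasurableSpace Ξ]
  {P : Measure Ω} {L ρ C₀ σ : ℝ} {G : SimpleGraph (Fin n)} {S : Set (EuclideanSpace ℝ (Fin p))}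

theorem Valid.continuous_Fnat_prox (h : R.Valid P L ρ C₀ σ G S) :
    Continuous fun z => Fnat (avgFun R.f) R.φ R.γ (prox R.φ R.γ z) := by
  have h1 := h.weaklyConvex.continuous_prox h.γ_pos h.γρ_le
  have h2 : Continuous fun z => gradient (avgFun R.f) (prox R.φ R.γ z) := by
    have h3 := continuous_gradient_prox h.L_pos h.weaklyConvex h.smooth h.γ_pos h.γρ_le
    have e : (fun z => gradient (avgFun R.f) (prox R.φ R.γ z))
        = fun z => (n : ℝ)⁻¹ • ∑ i, gradient (R.f i) (prox R.φ R.γ z) := funext fun z =>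
      h.smooth.gradient_avgFun (h.smooth.dom_subset (h.weaklyConvex.prox_mem h.γ_pos z))
    rw [e]
    fun_prop
  exact h1.sub (h1.comp (h1.sub (h2.const_smul R.γ)))

/-- Gaps at the local points are compared with those at `prox y` through `gap_le`; there
`mean_gap_le` brings in the merit and the heterogeneity. The constant `16 / 9` is the squared
Lipschitz constant of the prox. -/
theorem Valid.mean_gap_prox_le (h : R.Valid P L ρ C₀ σ G S) (k : ℕ) (ω : Ω) :
    (n : ℝ)⁻¹ * ∑ i, (R.f i (prox R.φ R.γ (R.z k ω i)) - infOnDom R.φ (R.f i))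
      ≤ 2 * (merit R.f R.φ R.γ (R.y k ω) + sigmaF R.f R.φ)
        + 16 / 9 * L * (4 * ((n : ℝ)⁻¹ * ∑ j, ‖R.u k ω j‖ ^ 2) + ‖R.ν k ω‖ ^ 2) := by
  have hn : (0 : ℝ) < n := by have := h.n_pos; positivity
  have hmem := fun z => h.weaklyConvex.prox_mem h.γ_pos z
  have h1 : ∀ i, R.f i (prox R.φ R.γ (R.z k ω i)) - infOnDom R.φ (R.f i)
      ≤ 2 * (R.f i (prox R.φ R.γ (R.y k ω)) - infOnDom R.φ (R.f i))
        + 16 / 9 * L * ‖R.z k ω i - R.y k ω‖ ^ 2 := fun i => by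
    have h2 := h.smooth.gap_le h.L_pos h.weaklyConvex i (hmem (R.y k ω)) (hmem (R.z k ω i))
    have h3 := pow_le_pow_left₀ (norm_nonneg _)
      (h.weaklyConvex.norm_prox_sub_le' h.γ_pos h.γρ_le (R.y k ω) (R.z k ω i)) 2
    rw [mul_pow] at h3
    have h4 := mul_le_mul_of_nonneg_left h3 h.L_pos.le
    linarith
  have h2 := mul_le_mul_of_nonneg_left (Finset.sum_le_sum fun i (_ : i ∈ Finset.univ) => h1 i)
    (inv_nonneg.2 hn.le)
  rw [Finset.sum_add_distrib, ← Finset.mul_sum, ← Finset.mul_sum, h.sum_norm_z_sub_y] at h2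
  have h3 := mean_gap_le (f := R.f) h.weaklyConvex (hmem (R.y k ω))
  have h4 : psiGap R.f R.φ (prox R.φ R.γ (R.y k ω)) ≤ merit R.f R.φ R.γ (R.y k ω) :=
    le_add_of_nonneg_right (by have := h.γ_pos; positivity)
  have h5 := mul_le_mul_of_nonneg_left (h.cons_le k ω)
    (mul_nonneg (inv_nonneg.2 hn.le) (mul_nonneg (by norm_num) h.L_pos.le : 0 ≤ 16 / 9 * L))
  have e : (n : ℝ)⁻¹ * (16 / 9 * L * (n * ‖R.ν k ω‖ ^ 2)) = 16 / 9 * L * ‖R.ν k ω‖ ^ 2 := by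
    field_simp
  linarith

theorem Valid.sum_norm_Fnat_sq_le (h : R.Valid P L ρ C₀ σ G S) (k : ℕ) (ω : Ω) :
    (n : ℝ)⁻¹ * ∑ i, ‖R.γ⁻¹ • Fnat (avgFun R.f) R.φ R.γ (prox R.φ R.γ (R.z k ω i))‖ ^ 2
      ≤ 16 / 9 * (2 * ‖R.F (R.y k ω)‖ ^ 2 + 2 * R.M ^ 2 *
        (4 * ((n : ℝ)⁻¹ * ∑ j, ‖R.u k ω j‖ ^ 2) + ‖R.ν k ω‖ ^ 2)) := by
  have hn : (0 : ℝ) < n := by have := h.n_pos; positivity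
  have h1 : ∀ i, ‖R.γ⁻¹ • Fnat (avgFun R.f) R.φ R.γ (prox R.φ R.γ (R.z k ω i))‖ ^ 2
      ≤ 16 / 9 * (2 * ‖R.F (R.y k ω)‖ ^ 2) + 16 / 9 * (2 * R.M ^ 2) * ‖R.z k ω i - R.y k ω‖ ^ 2 :=
    fun i => by
    have h2 := pow_le_pow_left₀ (norm_nonneg _)
      (norm_Fnat_prox_le (avgFun R.f) h.weaklyConvex h.γ_pos h.γρ_le (R.z k ω i)) 2
    have h3 := pow_le_pow_left₀ (norm_nonneg _) (h.norm_F_sub_le (R.y k ω) (R.z k ω i)) 2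
    have h4 : ‖R.F (R.z k ω i)‖ ^ 2
        ≤ 2 * ‖R.F (R.y k ω)‖ ^ 2 + 2 * ‖R.F (R.z k ω i) - R.F (R.y k ω)‖ ^ 2 := by
      have h5 := norm_le_norm_add_norm_sub' (R.F (R.z k ω i)) (R.F (R.y k ω))
      have h6 := pow_le_pow_left₀ (norm_nonneg _) h5 2
      linarith [sq_nonneg (‖R.F (R.y k ω)‖ - ‖R.F (R.z k ω i) - R.F (R.y k ω)‖)]
    have e : Fnor (avgFun R.f) R.φ R.γ (R.z k ω i) = R.F (R.z k ω i) := rfl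
    rw [e, mul_pow] at h2
    rw [mul_pow] at h3
    linarith
  have h2 := mul_le_mul_of_nonneg_left (Finset.sum_le_sum fun i (_ : i ∈ Finset.univ) => h1 i)
    (inv_nonneg.2 hn.le)
  rw [Finset.sum_add_distrib, Finset.sum_const, Finset.card_univ, Fintype.card_fin, nsmul_eq_mul,
    ← Finset.mul_sum, h.sum_norm_z_sub_y] at h2
  have h5 := mul_le_mul_of_nonneg_left (h.cons_le k ω) (by positivity :
    0 ≤ (n : ℝ)⁻¹ * (16 / 9 * (2 * R.M ^ 2)))
  have e : (n : ℝ)⁻¹ * (n * (16 / 9 * (2 * ‖R.F (R.y k ω)‖ ^ 2)) + 16 / 9 * (2 * R.M ^ 2) *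
      (R.cons k ω + n * ‖R.ν k ω‖ ^ 2)) = 16 / 9 * (2 * ‖R.F (R.y k ω)‖ ^ 2)
      + (n : ℝ)⁻¹ * (16 / 9 * (2 * R.M ^ 2)) * R.cons k ω
      + 16 / 9 * (2 * R.M ^ 2) * ‖R.ν k ω‖ ^ 2 := by
    field_simp
    ring
  linarith

variable [IsProbabilityMeasure P]

/-- Bound on the average noise variance. -/
theorem Valid.eE_le (h : R.Valid P L ρ C₀ σ G S) {Δ : ℝ} (hΔ : sigmaF R.f R.φ ≤ Δ) (k : ℕ) :
    R.eE P k ≤ C₀ * (2 * (R.hE P k + Δ) + 16 / 9 * L * (4 * R.uE P k + R.νE P k)) + σ ^ 2 := by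
  have hn : (0 : ℝ) < n := by have := h.n_pos; positivity
  have hv : ∀ i, HasExp P (fun ω => R.varBound C₀ σ i (R.z k ω i))
      (∫ ω, R.varBound C₀ σ i (R.z k ω i) ∂P) := fun i =>
    ⟨h.integrable_varBound i (h.isL2_z k i).memLp, rfl⟩
  have h1 : R.eE P k ≤ (n : ℝ)⁻¹ * ∑ i, ∫ ω, R.varBound C₀ σ i (R.z k ω i) ∂P :=
    mul_le_mul_of_nonneg_left (Finset.sum_le_sum fun i _ => (h.err_sq_le i k (h.isL2_z k i)).2)
      (inv_nonneg.2 hn.le)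
  refine h1.trans (((HasExp.sum hv).const_mul _).le
    ((((((h.hasExp_merit k).add (.const Δ)).const_mul 2).add
      ((((h.hasExp_u k).const_mul 4).add (h.hasExp_ν k)).const_mul (16 / 9 * L))).const_mul C₀).add
        (.const (σ ^ 2))) fun ω => ?_)
  have h2 := mul_le_mul_of_nonneg_left (h.mean_gap_prox_le k ω) h.C₀_nonneg
  have h3 := mul_le_mul_of_nonneg_left hΔ h.C₀_nonneg
  have e : (n : ℝ)⁻¹ * ∑ i, R.varBound C₀ σ i (R.z k ω i)
      = C₀ * ((n : ℝ)⁻¹ * ∑ i, (R.f i (prox R.φ R.γ (R.z k ω i)) - infOnDom R.φ (R.f i)))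
        + σ ^ 2 := by
    simp only [varBound, Finset.sum_add_distrib, Finset.sum_const, Finset.card_univ,
      Fintype.card_fin, nsmul_eq_mul, ← Finset.mul_sum]
    field_simp
  rw [e]
  linarith

theorem Valid.integrable_Fnat_sq (h : R.Valid P L ρ C₀ σ G S) (k : ℕ) (i : Fin n) :
    Integrable (fun ω =>
      ‖R.γ⁻¹ • Fnat (avgFun R.f) R.φ R.γ (prox R.φ R.γ (R.z k ω i))‖ ^ 2) P := by
  have hF : MemLp (fun ω => R.F (R.z k ω i)) 2 P :=
    ((h.isL2_z k i).comp_lipschitz (h.past_le k) h.norm_F_sub_le).memLp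
  have hm : AEStronglyMeasurable
      (fun ω => R.γ⁻¹ • Fnat (avgFun R.f) R.φ R.γ (prox R.φ R.γ (R.z k ω i))) P :=
    (h.continuous_Fnat_prox.const_smul R.γ⁻¹).comp_aestronglyMeasurable (h.isL2_z k i).memLp.1
  refine integrable_norm_sq_of_memLp ((hF.norm.const_mul (4 / 3)).mono' hm (.of_forall fun ω => ?_))
  exact norm_Fnat_prox_le (avgFun R.f) h.weaklyConvex h.γ_pos h.γρ_le (R.z k ω i)

theorem Valid.mean_integral_Fnat_sq_le (h : R.Valid P L ρ C₀ σ G S) (k : ℕ) :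
    (n : ℝ)⁻¹ * ∑ i, ∫ ω,
        ‖R.γ⁻¹ • Fnat (avgFun R.f) R.φ R.γ (prox R.φ R.γ (R.z k ω i))‖ ^ 2 ∂P
      ≤ 16 / 9 * (2 * R.aE P k + 2 * R.M ^ 2 * (4 * R.uE P k + R.νE P k)) :=
  ((HasExp.sum fun i => ⟨h.integrable_Fnat_sq k i, rfl⟩).const_mul _).le
    ((((h.hasExp_a k).const_mul 2).add ((((h.hasExp_u k).const_mul 4).add
      (h.hasExp_ν k)).const_mul (2 * R.M ^ 2))).const_mul (16 / 9)) (h.sum_norm_Fnat_sq_le k)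

theorem νE_zero : R.νE P 0 = 0 := by simp [νE, ν]

theorem y_zero (ω : Ω) : R.y 0 ω = mean R.z₀ := by
  rw [y, ν, add_zero]; rfl

theorem Valid.hE_zero_le (h : R.Valid P L ρ C₀ σ G S) {Δ : ℝ}
    (h1 : psiGap R.f R.φ (prox R.φ R.γ (mean R.z₀)) ≤ Δ)
    (h2 : ‖Fnor (avgFun R.f) R.φ R.γ (mean R.z₀)‖ ^ 2 ≤ Δ) :
    R.hE P 0 ≤ Δ + R.γ / 2 * Δ := by
  have h3 := mul_le_mul_of_nonneg_left h2 (by linarith [h.γ_pos] : 0 ≤ R.γ / 2)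
  simp only [hE, y_zero, integral_const, probReal_univ, one_smul, merit]
  linarith

/-- Second moment of the component normal maps. -/
theorem Valid.mean_norm_Fi_sq_le (h : R.Valid P L ρ C₀ σ G S) (y : EuclideanSpace ℝ (Fin p)) :
    (n : ℝ)⁻¹ * ∑ i, ‖R.Fi i y‖ ^ 2
      ≤ 2 * L * (psiGap R.f R.φ (prox R.φ R.γ y) + sigmaF R.f R.φ) + ‖R.F y‖ ^ 2 := by
  have hn : (0 : ℝ) < n := by have := h.n_pos; positivity
  have hx := h.weaklyConvex.prox_mem h.γ_pos y
  set x := prox R.φ R.γ y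
  have h1 := sum_norm_sub_sq h.n_pos (fun i => R.Fi i y) 0
  have h2 := sum_norm_sub_sq h.n_pos (fun i => gradient (R.f i) x) 0
  -- At a common point the normal maps and the gradients differ by the same vector for all agents,
  -- so their deviations from the mean agree.
  have e : ∀ i, R.Fi i y - mean (fun i => R.Fi i y)
      = gradient (R.f i) x - mean (fun i => gradient (R.f i) x) := fun i => by
    have e1 : mean (fun i => gradient (R.f i) x) = gradient (avgFun R.f) x :=
      (h.smooth.gradient_avgFun (h.smooth.dom_subset hx)).symm
    rw [← h.F_eq, e1]
    simp only [Fi, F, Fnor]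
    abel
  simp only [e, sub_zero, zero_sub, norm_neg] at h1 h2
  rw [← h.F_eq] at h1
  have h3 := mul_le_mul_of_nonneg_left
    (Finset.sum_le_sum fun i (_ : i ∈ Finset.univ) => h.smooth.norm_gradient_sq_le h.L_pos i hx)
    (inv_nonneg.2 hn.le)
  rw [← Finset.mul_sum] at h3
  have h4 := mul_le_mul_of_nonneg_left (mean_gap_le (f := R.f) h.weaklyConvex hx)
    (by linarith [h.L_pos] : 0 ≤ 2 * L)
  have h5 : ∑ i, ‖R.Fi i y‖ ^ 2 ≤ ∑ i, ‖gradient (R.f i) x‖ ^ 2 + n * ‖R.F y‖ ^ 2 := by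
    have : 0 ≤ n * ‖mean (fun i => gradient (R.f i) x)‖ ^ 2 := by positivity
    linarith
  have h6 := mul_le_mul_of_nonneg_left h5 (inv_nonneg.2 hn.le)
  rw [mul_add, ← mul_assoc, inv_mul_cancel₀ hn.ne', one_mul] at h6
  linarith

/-- Since `d = 0` initially, the second component is `-Λ_b Uᵀ z₀` plus the shift. With `Λ_b ≤ 1` the
consensus error counts once in the first component and twice in the second, hence the factor 3. -/
theorem Valid.uE_zero_le (h : R.Valid P L ρ C₀ σ G S) {Δ : ℝ} (h0 : sigmaF R.f R.φ ≤ Δ)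
    (h1 : psiGap R.f R.φ (prox R.φ R.γ (mean R.z₀)) ≤ Δ)
    (h2 : ‖Fnor (avgFun R.f) R.φ R.γ (mean R.z₀)‖ ^ 2 ≤ Δ)
    (h3 : specNorm R.V⁻¹ ^ 2 * (∑ i, ‖R.z₀ i - mean R.z₀‖ ^ 2) / n ≤ Δ) :
    R.uE P 0 ≤ 3 * Δ + 2 * (R.α * D2 R.U R.μ (edB R.μ) R.V) ^ 2 * (4 * L * Δ + Δ) := by
  have hn : (0 : ℝ) < n := by have := h.n_pos; positivity
  set c := ∑ i, ‖R.z₀ i - mean R.z₀‖ ^ 2 with hc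
  set y := mean R.z₀ with hy
  set s := specNorm R.V⁻¹ with hs
  have hUB := h.spectral.transpose_mul_sqrt h.sqrt_posSemidef h.sqrt_mul_self
    fun i => (h.μ_lt_one i).le
  have hG : (n : ℝ)⁻¹ * ∑ i, ‖R.Fi i y‖ ^ 2 ≤ 4 * L * Δ + Δ := by
    have h4 := h.mean_norm_Fi_sq_le y
    have h5 := mul_le_mul_of_nonneg_left (add_le_add h1 h0) (by linarith [h.L_pos] : 0 ≤ 2 * L)
    have h6 : ‖R.F y‖ ^ 2 ≤ Δ := h2
    linarith
  have hUz : ∑ j, ‖rmul R.Uᵀ R.z₀ j‖ ^ 2 ≤ c := by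
    have e : rmul R.Uᵀ R.z₀ = rmul R.Uᵀ (R.z₀ - fun _ => y) := by
      rw [rmul_sub, rmul_transpose_const h.spectral, sub_zero]
    rw [e]
    refine (sum_norm_sq_rmul_le _ _).trans ?_
    have h4 := pow_le_pow_left₀ (specNorm_nonneg _) h.spectral.specNorm_transpose_le_one 2
    have h5 : 0 ≤ c := Finset.sum_nonneg fun i _ => sq_nonneg _
    have := mul_le_mul_of_nonneg_right h4 h5
    rw [one_pow, one_mul] at this
    exact this
  have hbUz : ∑ j, ‖rmul R.Uᵀ (0 - rmul R.B R.z₀) j‖ ^ 2 ≤ c := by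
    have e : rmul R.Uᵀ (0 - rmul R.B R.z₀) = -rmul (diagonal (edB R.μ)) (rmul R.Uᵀ R.z₀) := by
      rw [rmul_sub, rmul_mul, hUB, ← rmul_mul]
      ext1 j; simp [rmul]
    rw [e]
    refine le_trans (Finset.sum_le_sum fun j _ => ?_) hUz
    have e2 : rmul (diagonal (edB R.μ)) (rmul R.Uᵀ R.z₀) j
        = edB R.μ j • rmul R.Uᵀ R.z₀ j := by
      simp [rmul, Matrix.diagonal_apply, ite_smul]
    rw [Pi.neg_apply, norm_neg, e2, norm_smul, mul_pow, Real.norm_eq_abs, sq_abs]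
    refine mul_le_of_le_one_left (sq_nonneg _) ?_
    rw [edB, Real.sq_sqrt (by linarith [h.μ_lt_one j])]
    linarith [h.spectral.nonneg h.posSemidef j]
  have hw : ∀ ω, ∑ j, ‖R.w 0 ω j‖ ^ 2
      ≤ 3 * c + 2 * R.α ^ 2 * (specNorm R.BLU ^ 2 * ∑ i, ‖R.Fi i y‖ ^ 2) := fun ω => by
    have e : R.w 0 ω = Sum.elim (rmul R.Uᵀ R.z₀)
        (rmul R.Uᵀ (0 - rmul R.B R.z₀) + R.α • rmul R.BLU fun i => R.Fi i y) := by
      rw [w, y_zero]; rfl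
    have h4 := sum_norm_sq_rmul_le R.BLU fun i => R.Fi i y
    have h5 := mul_le_mul_of_nonneg_left h4 (by positivity : 0 ≤ 2 * R.α ^ 2)
    have h6 : ∑ j, ‖rmul R.Uᵀ (0 - rmul R.B R.z₀) j + R.α • rmul R.BLU (fun i => R.Fi i y) j‖ ^ 2
        ≤ 2 * ∑ j, ‖rmul R.Uᵀ (0 - rmul R.B R.z₀) j‖ ^ 2
          + 2 * R.α ^ 2 * ∑ j, ‖rmul R.BLU (fun i => R.Fi i y) j‖ ^ 2 := by
      rw [Finset.mul_sum, Finset.mul_sum, ← Finset.sum_add_distrib]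
      refine Finset.sum_le_sum fun j _ => ?_
      have h7 := pow_le_pow_left₀ (norm_nonneg _) (norm_add_le
        (rmul R.Uᵀ (0 - rmul R.B R.z₀) j) (R.α • rmul R.BLU (fun i => R.Fi i y) j)) 2
      have h8 : ‖R.α • rmul R.BLU (fun i => R.Fi i y) j‖ ^ 2
          = R.α ^ 2 * ‖rmul R.BLU (fun i => R.Fi i y) j‖ ^ 2 := by
        rw [norm_smul, mul_pow, Real.norm_eq_abs, sq_abs]
      linarith [sq_nonneg (‖rmul R.Uᵀ (0 - rmul R.B R.z₀) j‖
        - ‖R.α • rmul R.BLU (fun i => R.Fi i y) j‖)]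
    rw [e, Fintype.sum_sum_type]
    simp only [Sum.elim_inl, Sum.elim_inr, Pi.add_apply, Pi.smul_apply]
    linarith
  have hu : ∀ ω, (n : ℝ)⁻¹ * ∑ j, ‖R.u 0 ω j‖ ^ 2
      ≤ 3 * Δ + 2 * (R.α * D2 R.U R.μ (edB R.μ) R.V) ^ 2 * (4 * L * Δ + Δ) := fun ω => by
    have h4 := (sum_norm_sq_rmul_le R.V⁻¹ (R.w 0 ω)).trans
      (mul_le_mul_of_nonneg_left (hw ω) (sq_nonneg s))
    have h5 := mul_le_mul_of_nonneg_left h4 (inv_nonneg.2 hn.le)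
    have e2 : D2 R.U R.μ (edB R.μ) R.V = s * specNorm R.BLU := rfl
    have h6 := mul_le_mul_of_nonneg_left hG
      (by positivity : 0 ≤ 2 * (R.α * (s * specNorm R.BLU)) ^ 2)
    have h7 : (n : ℝ)⁻¹ * (s ^ 2 * c) ≤ Δ := by
      rw [div_eq_inv_mul] at h3; exact h3
    rw [e2]
    refine h5.trans ?_
    linarith
  exact (h.hasExp_u 0).le (.const _) hu

end Run

end NormED

/-! ### Scalar recursions and the Lyapunov function -/

namespace NormED

/-- A perturbed descent recursion. -/
theorem sum_le_of_descent {Φ s : ℕ → ℝ} {b c : ℝ} (hΦ : ∀ k, 0 ≤ Φ k) (hs : ∀ k, 0 ≤ s k)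
    (hb : 0 ≤ b) (hc : 0 ≤ c) (h : ∀ k, Φ (k + 1) ≤ (1 + c) * Φ k - s k + b) (K : ℕ) :
    ∑ k ∈ Finset.range K, s k ≤ Real.exp (c * K) * (Φ 0 + K * b) := by
  -- Keeping `Φ K` on the left makes the claim inductive.
  have h1 : ∀ K : ℕ, Φ K + ∑ k ∈ Finset.range K, s k ≤ (1 + c) ^ K * (Φ 0 + K * b) := by
    intro K
    induction K with
    | zero => simp
    | succ K ih =>
      have h2 := h K
      have h3 : 0 ≤ ∑ k ∈ Finset.range K, s k := Finset.sum_nonneg fun k _ => hs k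
      have h4 : 1 ≤ (1 + c) ^ (K + 1) := one_le_pow₀ (by linarith)
      have h5 := mul_le_mul_of_nonneg_left ih (by linarith : 0 ≤ 1 + c)
      have h6 := mul_le_mul_of_nonneg_right h4 hb
      have h7 := mul_nonneg hc h3
      rw [Finset.sum_range_succ]
      have e : (1 + c) ^ (K + 1) * (Φ 0 + (K + 1 : ℕ) * b)
          = (1 + c) * ((1 + c) ^ K * (Φ 0 + K * b)) + (1 + c) ^ (K + 1) * b := by
        push_cast; ring
      rw [e]
      linarith
  have h2 : (1 + c) ^ K ≤ Real.exp (c * K) := by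
    rw [mul_comm, Real.exp_nat_mul]
    exact pow_le_pow_left₀ (by linarith) (by linarith [Real.add_one_le_exp c]) K
  have h3 : 0 ≤ Φ 0 + K * b := add_nonneg (hΦ 0) (by positivity)
  have h4 := mul_le_mul_of_nonneg_right h2 h3
  linarith [h1 K, hΦ K]

/-- The recursion of the consensus error with the step size conditions inserted. -/
theorem consensus_step {α M δ d1 d2 a N Q Ve Q' : ℝ}
    (hα : 0 < α) (hM : 0 < M) (hδ : 0 < δ) (hδ1 : δ ≤ 1) (hd1 : 0 ≤ d1) (hd1' : d1 ≤ 1)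
    (hd2 : 0 ≤ d2) (hαM : 24 * (α * M) ≤ δ) (hαd : 294 * (d2 + 1) * (α * M) ≤ √δ)
    (ha : 0 ≤ a) (hN : 0 ≤ N) (hQ : 0 ≤ Q)
    (H3 : Q' ≤ (1 - δ / 2) * Q + 2 / δ * (α ^ 2 * (d1 ^ 2 * (M ^ 2 * (4 * Q + N))
        + d2 ^ 2 * (M ^ 2 * (α ^ 2 * (2 * a + 2 * (M ^ 2 * (8 * Q + 4 * N)))))))
      + α ^ 2 * (d1 ^ 2 * Ve)) :
    Q' ≤ (1 - δ / 3) * Q + α * M / 10 * N + α ^ 2 / 20000 * a + α ^ 2 * (d1 ^ 2 * Ve) := by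
  obtain ⟨x, hx⟩ : ∃ x, x = α * M := ⟨_, rfl⟩
  rw [← hx] at hαM hαd
  have hx0 : 0 < x := hx ▸ mul_pos hα hM
  have hs : √δ ^ 2 = δ := Real.sq_sqrt hδ.le
  have hxd : (294 * (d2 + 1)) ^ 2 * x ^ 2 ≤ δ := by
    rw [← hs, ← mul_pow]
    exact pow_le_pow_left₀ (by positivity) hαd 2
  have hd1sq : d1 ^ 2 ≤ 1 := pow_le_one₀ hd1 hd1'
  -- The division by `δ` from Young's inequality is absorbed by the step size: `24 x ≤ δ` handles
  -- the `d1` part and the square-root condition the `d2` part.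
  have hx2 : x ^ 2 / δ ≤ x / 24 := by
    rw [div_le_div_iff₀ hδ (by norm_num)]
    nlinarith
  have hx2d : d2 ^ 2 * x ^ 2 / δ ≤ 1 / 294 ^ 2 := by
    rw [div_le_div_iff₀ hδ (by norm_num)]
    nlinarith [mul_nonneg hd2 (sq_nonneg x), sq_nonneg x]
  rw [← hx]
  have e : 2 / δ * (α ^ 2 * (d1 ^ 2 * (M ^ 2 * (4 * Q + N))
      + d2 ^ 2 * (M ^ 2 * (α ^ 2 * (2 * a + 2 * (M ^ 2 * (8 * Q + 4 * N)))))))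
      = 2 * (x ^ 2 / δ) * (d1 ^ 2 * (4 * Q + N))
        + 2 * (d2 ^ 2 * x ^ 2 / δ) * (α ^ 2 * (2 * a) + 2 * x ^ 2 * (8 * Q + 4 * N)) := by
    rw [hx]; ring
  rw [e] at H3
  have h1 : d1 ^ 2 * (4 * Q + N) ≤ 4 * Q + N := mul_le_of_le_one_left (by positivity) hd1sq
  have h2 : 2 * (x ^ 2 / δ) * (d1 ^ 2 * (4 * Q + N)) ≤ 2 * (x / 24) * (4 * Q + N) := by
    gcongr
  have h3 : 2 * (d2 ^ 2 * x ^ 2 / δ) * (α ^ 2 * (2 * a) + 2 * x ^ 2 * (8 * Q + 4 * N))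
      ≤ 2 * (1 / 294 ^ 2) * (α ^ 2 * (2 * a) + 2 * x ^ 2 * (8 * Q + 4 * N)) := by
    gcongr
  have h4 : x ^ 2 ≤ x / 24 := by nlinarith
  have h5 : x * Q ≤ δ / 24 * Q := mul_le_mul_of_nonneg_right (by linarith) hQ
  have h6 : x ^ 2 * Q ≤ x / 24 * Q := mul_le_mul_of_nonneg_right h4 hQ
  have h7 : x ^ 2 * N ≤ x / 24 * N := mul_le_mul_of_nonneg_right h4 hN
  have h8 : 0 ≤ α ^ 2 * a := by positivity
  have h9 : 0 ≤ δ * Q := by positivity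
  have h10 : 0 ≤ x * N := by positivity
  linarith

/-- One step of the Lyapunov function combining the expected merit, the consensus error and the
filtered noise. -/
theorem lyapunov_step {α M δ d1 d2 C₀ L σ Δ n h a N Q Ve h' N' Q' : ℝ}
    (hα : 0 < α) (hM : 0 < M) (hδ : 0 < δ) (hδ1 : δ ≤ 1) (hd1 : 0 ≤ d1) (hd1' : d1 ≤ 1)
    (hd2 : 0 ≤ d2) (hC₀ : 0 ≤ C₀) (hL : 0 < L) (hn : 1 ≤ n)
    (hαM : 24 * (α * M) ≤ δ) (hαd : 294 * (d2 + 1) * (α * M) ≤ √δ) (hMCL : 7 * (C₀ + L) ≤ M)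
    (ha : 0 ≤ a) (hN : 0 ≤ N) (hQ : 0 ≤ Q)
    (H1 : h' ≤ h - α / 4 * a + α * M ^ 2 * (16 * Q + 8 * N))
    (H2 : N' ≤ (1 - α * M) * N + α ^ 2 * (n⁻¹ * Ve))
    (H3 : Q' ≤ (1 - δ / 2) * Q + 2 / δ * (α ^ 2 * (d1 ^ 2 * (M ^ 2 * (4 * Q + N))
        + d2 ^ 2 * (M ^ 2 * (α ^ 2 * (2 * a + 2 * (M ^ 2 * (8 * Q + 4 * N)))))))
      + α ^ 2 * (d1 ^ 2 * Ve))
    (H4 : Ve ≤ C₀ * (2 * (h + Δ) + 16 / 9 * L * (4 * Q + N)) + σ ^ 2) :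
    h' + 60 * α * M ^ 2 / δ * Q' + 10 * M * N'
      ≤ h + 60 * α * M ^ 2 / δ * Q + 10 * M * N
        + (10 * M * α ^ 2 * n⁻¹ + 60 * α ^ 3 * M ^ 2 * d1 ^ 2 / δ)
          * (2 * C₀ * h + (2 * C₀ * Δ + σ ^ 2))
        - (α / 5 * a + 3 * (α * M ^ 2) * Q + α * M ^ 2 * N) := by
  obtain ⟨x, hx⟩ : ∃ x, x = α * M := ⟨_, rfl⟩
  rw [← hx] at hαM hαd
  have hx0 : 0 < x := hx ▸ mul_pos hα hM
  have HQ := consensus_step hα hM hδ hδ1 hd1 hd1' hd2 (hx ▸ hαM) (hx ▸ hαd) ha hN hQ H3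
  rw [← hx] at HQ H2
  clear H3
  have hs : √δ ^ 2 = δ := Real.sq_sqrt hδ.le
  have hxd : (294 * (d2 + 1)) ^ 2 * x ^ 2 ≤ δ := by
    rw [← hs, ← mul_pow]
    exact pow_le_pow_left₀ (by positivity) hαd 2
  have hd1sq : d1 ^ 2 ≤ 1 := pow_le_one₀ hd1 hd1'
  have hninv : n⁻¹ ≤ 1 := inv_le_one_of_one_le₀ hn
  have hninv0 : 0 < n⁻¹ := by positivity
  have hx2 : x ^ 2 / δ ≤ x / 24 := by
    rw [div_le_div_iff₀ hδ (by norm_num)]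
    nlinarith
  have hx2' : x ^ 2 / δ ≤ 1 / 294 ^ 2 := by
    rw [div_le_div_iff₀ hδ (by norm_num)]
    nlinarith [mul_nonneg hd2 (sq_nonneg x), mul_nonneg (mul_nonneg hd2 hd2) (sq_nonneg x)]
  -- coefficients of the Lyapunov function
  obtain ⟨A, hA⟩ : ∃ A, A = 60 * α * M ^ 2 / δ := ⟨_, rfl⟩
  have hA0 : 0 ≤ A := by rw [hA]; positivity
  -- The contraction `δ / 3` of `Q` yields `20 α M² Q`, which outweighs `16 α M² Q` in the merit
  -- recursion and leaves a surplus of at least 3 after small errors.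
  have hAδ : A * δ = 60 * (α * M ^ 2) := by rw [hA]; field_simp
  have hAx : A * x = 60 * M * (x ^ 2 / δ) := by rw [hA, hx]; ring
  have hAα : A * α ^ 2 = 60 * α * (x ^ 2 / δ) := by rw [hA, hx]; ring
  have hKv : 60 * α ^ 3 * M ^ 2 * d1 ^ 2 / δ = A * (α ^ 2 * d1 ^ 2) := by rw [hA]; ring
  obtain ⟨Kv, hKvd⟩ : ∃ Kv, Kv = 10 * M * α ^ 2 * n⁻¹ + 60 * α ^ 3 * M ^ 2 * d1 ^ 2 / δ := ⟨_, rfl⟩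
  have hKv0 : 0 ≤ Kv := by rw [hKvd]; positivity
  rw [← hA, ← hKvd]
  have hKvle : Kv ≤ 13 * (α * x) := by
    have h1 : 10 * M * α ^ 2 * n⁻¹ ≤ 10 * M * α ^ 2 := mul_le_of_le_one_right (by positivity) hninv
    have h2 : A * (α ^ 2 * d1 ^ 2) ≤ A * α ^ 2 :=
      mul_le_mul_of_nonneg_left (mul_le_of_le_one_right (by positivity) hd1sq) hA0
    have h3 : 60 * α * (x ^ 2 / δ) ≤ 60 * α * (x / 24) := by gcongr
    have h4 : M * α ^ 2 = α * x := by rw [hx]; ring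
    rw [hKvd, hKv]
    have h5 : 0 ≤ α * x := by positivity
    linarith only [h1, h2, h3, h4, h5, hAα]
  have hCL : C₀ * L ≤ M ^ 2 / 196 := by
    have := pow_le_pow_left₀ (by positivity) hMCL 2
    linarith only [sq_nonneg (C₀ - L), this]
  have h1 := mul_le_mul_of_nonneg_left HQ hA0
  -- The contraction of `N` with weight `10 M` yields `10 α M² N` against `8 α M² N`; a surplus of 1
  -- survives the small errors.
  have h2 := mul_le_mul_of_nonneg_left H2 (by positivity : 0 ≤ 10 * M)
  have h3 := mul_le_mul_of_nonneg_left H4 hKv0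
  have h4 : Kv * (C₀ * (16 / 9 * L * (4 * Q + N)))
      ≤ 13 * (α * x) * (16 / 9 * (M ^ 2 / 196) * (4 * Q + N)) := by
    have : C₀ * (16 / 9 * L * (4 * Q + N)) ≤ 16 / 9 * (M ^ 2 / 196) * (4 * Q + N) := by
      have := mul_le_mul_of_nonneg_right hCL (by positivity : 0 ≤ 16 / 9 * (4 * Q + N))
      linarith only [this]
    exact mul_le_mul hKvle this (by positivity) (by positivity)
  have h5 : α * x * (M ^ 2 * (4 * Q + N)) ≤ α * (1 / 24) * (M ^ 2 * (4 * Q + N)) := by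
    gcongr; linarith only [hαM, hδ1]
  have h6 : A * x * N ≤ 60 * M * (x / 24) * N := by
    rw [hAx]; gcongr
  have h7 : A * α ^ 2 * a ≤ 60 * α * (1 / 294 ^ 2) * a := by
    rw [hAα]; gcongr
  have e1 : A * ((1 - δ / 3) * Q + x / 10 * N + α ^ 2 / 20000 * a + α ^ 2 * (d1 ^ 2 * Ve))
      = A * Q - A * δ / 3 * Q + A * x * N / 10 + A * α ^ 2 * a / 20000
        + A * (α ^ 2 * d1 ^ 2) * Ve := by ring
  have e2 : 10 * M * ((1 - x) * N + α ^ 2 * (n⁻¹ * Ve))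
      = 10 * M * N - 10 * (M * x * N) + 10 * M * α ^ 2 * n⁻¹ * Ve := by ring
  have e3 : Kv * Ve = 10 * M * α ^ 2 * n⁻¹ * Ve + A * (α ^ 2 * d1 ^ 2) * Ve := by
    rw [hKvd, hKv]; ring
  have e4 : M * x = α * M ^ 2 := by rw [hx]; ring
  rw [e1, hAδ] at h1
  rw [e2, e4] at h2
  have e5 : 60 * M * (x / 24) * N = 60 / 24 * (α * M ^ 2 * N) := by rw [← e4]; ring
  rw [e5] at h6
  have hq1 : 0 ≤ α * M ^ 2 * Q := by positivity
  have hq2 : 0 ≤ α * M ^ 2 * N := by positivity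
  have hq3 : 0 ≤ α * a := by positivity
  linarith only [H1, h1, h2, h3, h4, h5, h6, h7, e3, hq1, hq2, hq3]

end NormED

namespace NormED

/-! ### From the Lyapunov recursion to the stationarity measure -/

namespace Run

variable {n p : ℕ} {Ω Ξ : Type*} {R : Run n p Ω Ξ} [MeasurableSpace Ω] [MeasurableSpace Ξ]
  {P : Measure Ω} [IsProbabilityMeasure P] {L ρ C₀ σ : ℝ} {G : SimpleGraph (Fin n)}
  {S : Set (EuclideanSpace ℝ (Fin p))}

theorem Valid.statMeasure_le_sum (h : R.Valid P L ρ C₀ σ G S) (K : ℕ) :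
    statMeasure P (avgFun R.f) R.φ R.γ (edX R.W R.B R.α R.γ R.φ R.g R.ξ R.z₀) K
      ≤ (K : ℝ)⁻¹ * (18 / R.α) * ∑ k ∈ Finset.range K, (R.α / 5 * R.aE P k
        + 3 * (R.α * R.M ^ 2) * R.uE P k + R.α * R.M ^ 2 * R.νE P k) := by
  have hα := h.α_pos
  have e : statMeasure P (avgFun R.f) R.φ R.γ (edX R.W R.B R.α R.γ R.φ R.g R.ξ R.z₀) K
      = (K : ℝ)⁻¹ * ∑ k ∈ Finset.range K, (n : ℝ)⁻¹ * ∑ i, ∫ ω,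
        ‖R.γ⁻¹ • Fnat (avgFun R.f) R.φ R.γ (prox R.φ R.γ (R.z k ω i))‖ ^ 2 ∂P := by
    rw [statMeasure, ← Finset.mul_sum, ← mul_assoc, one_div, mul_inv, mul_comm (n : ℝ)⁻¹]
    rfl
  rw [e, mul_assoc, Finset.mul_sum (a := 18 / R.α)]
  refine mul_le_mul_of_nonneg_left (Finset.sum_le_sum fun k _ => ?_) (by positivity)
  refine (h.mean_integral_Fnat_sq_le k).trans ?_
  -- The constant 18 is chosen so that `18 / 5` exceeds the coefficient `32 / 9` of the squared
  -- normal map; the other two coefficients have room to spare.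
  have e2 : 18 / R.α * (R.α / 5 * R.aE P k + 3 * (R.α * R.M ^ 2) * R.uE P k
      + R.α * R.M ^ 2 * R.νE P k)
      = 18 / 5 * R.aE P k + 54 * (R.M ^ 2 * R.uE P k) + 18 * (R.M ^ 2 * R.νE P k) := by
    field_simp; ring
  rw [e2]
  have h1 := aE_nonneg (R := R) (P := P) k
  have h2 := mul_nonneg (sq_nonneg R.M) (uE_nonneg (R := R) (P := P) k)
  have h3 := mul_nonneg (sq_nonneg R.M) (νE_nonneg (R := R) (P := P) k)
  linarith

/-- The averaged stationarity measure in terms of the initial Lyapunov value. -/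
theorem Valid.statMeasure_le (h : R.Valid P L ρ C₀ σ G S) {Δ Kv : ℝ}
    (hΔ : sigmaF R.f R.φ ≤ Δ) (hΔ0 : 0 ≤ Δ) (hD1 : 0 ≤ D1 R.U R.μ R.V)
    (hD1' : D1 R.U R.μ R.V ≤ 1) (hD2 : 0 ≤ D2 R.U R.μ (edB R.μ) R.V)
    (hαM : 24 * (R.α * R.M) ≤ 1 - lam R.W)
    (hαd : 294 * (D2 R.U R.μ (edB R.μ) R.V + 1) * (R.α * R.M) ≤ √(1 - lam R.W))
    (hMCL : 7 * (C₀ + L) ≤ R.M)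
    (hKv : Kv = 10 * R.M * R.α ^ 2 * (n : ℝ)⁻¹
      + 60 * R.α ^ 3 * R.M ^ 2 * D1 R.U R.μ R.V ^ 2 / (1 - lam R.W)) (K : ℕ) :
    statMeasure P (avgFun R.f) R.φ R.γ (edX R.W R.B R.α R.γ R.φ R.g R.ξ R.z₀) K
      ≤ (K : ℝ)⁻¹ * (18 / R.α) * (Real.exp (2 * C₀ * Kv * K) *
        (R.hE P 0 + 60 * R.α * R.M ^ 2 / (1 - lam R.W) * R.uE P 0
          + K * (Kv * (2 * C₀ * Δ + σ ^ 2)))) := by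
  have hα := h.α_pos
  have hM := h.M_pos
  have hδ : 0 < 1 - lam R.W := sub_pos.2 h.lam_lt_one
  have hC := h.C₀_nonneg
  refine (h.statMeasure_le_sum K).trans (mul_le_mul_of_nonneg_left ?_ (by positivity))
  have hKv0 : 0 ≤ Kv := by rw [hKv]; positivity
  have key := sum_le_of_descent
    (Φ := fun k => R.hE P k + 60 * R.α * R.M ^ 2 / (1 - lam R.W) * R.uE P k
      + 10 * R.M * R.νE P k)
    (s := fun k => R.α / 5 * R.aE P k + 3 * (R.α * R.M ^ 2) * R.uE P k
      + R.α * R.M ^ 2 * R.νE P k)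
    (b := Kv * (2 * C₀ * Δ + σ ^ 2)) (c := 2 * C₀ * Kv) (fun k => ?_) (fun k => ?_)
    (by positivity) (by positivity) (fun k => ?_) K
  · simpa only [νE_zero, mul_zero, add_zero] using key
  · have h1 := h.hE_nonneg k
    have h2 := uE_nonneg (R := R) (P := P) k
    have h3 := νE_nonneg (R := R) (P := P) k
    positivity
  · have h1 := aE_nonneg (R := R) (P := P) k
    have h2 := uE_nonneg (R := R) (P := P) k
    have h3 := νE_nonneg (R := R) (P := P) k
    positivity
  · have hn : (1 : ℝ) ≤ n := by exact_mod_cast h.n_pos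
    have h3 := h.uE_succ_le k
    have e : (1 + lam R.W) / 2 = 1 - (1 - lam R.W) / 2 := by ring
    rw [e] at h3
    have hu := uE_nonneg (R := R) (P := P) k
    have hν := νE_nonneg (R := R) (P := P) k
    have key := lyapunov_step hα hM hδ (by linarith [h.lam_pos]) hD1 hD1' hD2 hC h.L_pos hn
      hαM hαd hMCL (aE_nonneg k) hν hu (h.hE_succ_le k) (h.νE_succ_le k) h3 (h.eE_le hΔ k)
    rw [← hKv] at key
    -- Variance growth multiplies only the merit part; this nonnegative amount enlarges it to the
    -- whole Lyapunov function, as `sum_le_of_descent` requires.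
    have h4 : 0 ≤ C₀ * Kv * (60 * R.α * R.M ^ 2 / (1 - lam R.W) * R.uE P k
      + 10 * R.M * R.νE P k) := by positivity
    linarith

end Run

/-! ### Bounds on the parameters -/

section Parameters

variable {n K : ℕ} {L ρ C₀ v d1 d2 β : ℝ}

theorem inv_gammaPar (L ρ C₀ d1 : ℝ) :
    (gammaPar L ρ C₀ d1)⁻¹ = 4 * (ρ + L + (d1 ^ 2 + 1) * C₀) := by
  rw [gammaPar, one_div, inv_inv]

theorem gammaPar_pos (hL : 0 < L) (hρ : 0 < ρ) (hC₀ : 0 ≤ C₀) : 0 < gammaPar L ρ C₀ d1 := by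
  rw [gammaPar]; positivity

theorem le_inv_gammaPar (hC₀ : 0 ≤ C₀) : 4 * (ρ + L + C₀) ≤ (gammaPar L ρ C₀ d1)⁻¹ := by
  rw [inv_gammaPar]
  have := mul_nonneg (sq_nonneg d1) hC₀
  linarith

theorem inv_gammaPar_le (hC₀ : 0 ≤ C₀) (hd1 : d1 ^ 2 ≤ 1) :
    (gammaPar L ρ C₀ d1)⁻¹ ≤ 4 * (ρ + L + 2 * C₀) := by
  rw [inv_gammaPar]
  have := mul_le_mul_of_nonneg_right hd1 hC₀
  linarith

theorem gammaPar_mul_le (hL : 0 < L) (hρ : 0 < ρ) (hC₀ : 0 ≤ C₀) :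
    gammaPar L ρ C₀ d1 * (ρ + L) ≤ 1 / 4 := by
  have h1 := le_inv_gammaPar (L := L) (ρ := ρ) (d1 := d1) hC₀
  have h2 := gammaPar_pos (d1 := d1) hL hρ hC₀
  have h3 := mul_le_mul_of_nonneg_left h1 h2.le
  rw [mul_inv_cancel₀ h2.ne'] at h3
  have := mul_nonneg h2.le hC₀
  linarith

/-- The lower bound serves twice: it gives `7 (C₀ + L) ≤ M`, and it turns a bound on `α M` into `α ≤
γ / 100`. -/
theorem le_LF (hL : 0 < L) (hρ : 0 < ρ) (hC₀ : 0 ≤ C₀) :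
    7 / 4 * (gammaPar L ρ C₀ d1)⁻¹ ≤ LF L ρ (gammaPar L ρ C₀ d1) := by
  have h1 := le_inv_gammaPar (L := L) (ρ := ρ) (d1 := d1) hC₀
  have h2 := gammaPar_pos (d1 := d1) hL hρ hC₀
  have h3 := gammaPar_mul_le (d1 := d1) hL hρ hC₀
  have h4 : 0 < gammaPar L ρ C₀ d1 * ρ := mul_pos h2 hρ
  have h5 : 0 < gammaPar L ρ C₀ d1 * L := mul_pos h2 hL
  rw [LF, le_div_iff₀ (by linarith), div_eq_mul_inv (2 : ℝ)]
  have h6 : (gammaPar L ρ C₀ d1)⁻¹ * (gammaPar L ρ C₀ d1 * ρ) = ρ := by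
    rw [← mul_assoc, inv_mul_cancel₀ h2.ne', one_mul]
  linarith

/-- An upper bound of `L_F` in terms of the problem constants. -/
noncomputable def lfBound (L ρ C₀ : ℝ) : ℝ := 4 / 3 * (L + 8 * (ρ + L + 2 * C₀))

theorem LF_le (hL : 0 < L) (hρ : 0 < ρ) (hC₀ : 0 ≤ C₀) (hd1 : d1 ^ 2 ≤ 1) :
    LF L ρ (gammaPar L ρ C₀ d1) ≤ lfBound L ρ C₀ := by
  have h1 := inv_gammaPar_le (L := L) (ρ := ρ) hC₀ hd1
  have h2 := gammaPar_pos (d1 := d1) hL hρ hC₀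
  have h3 := gammaPar_mul_le (d1 := d1) hL hρ hC₀
  have h5 : 0 < gammaPar L ρ C₀ d1 * L := mul_pos h2 hL
  have h6 : 0 < 1 - gammaPar L ρ C₀ d1 * ρ := by linarith
  rw [LF, lfBound, div_le_iff₀ h6, div_eq_mul_inv (2 : ℝ)]
  have h7 : 3 / 4 ≤ 1 - gammaPar L ρ C₀ d1 * ρ := by linarith
  have h8 : 0 ≤ 4 / 3 * (L + 8 * (ρ + L + 2 * C₀)) := by positivity
  have := mul_le_mul_of_nonneg_left h7 h8
  linarith

theorem LF_le_T2 (hL : 0 < L) (hC₀ : 0 ≤ C₀) {γ : ℝ} (hγ : 0 < γ) :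
    LF L ρ γ ≤ T2 L ρ C₀ γ v := by
  refine Real.le_sqrt_of_sq_le ?_
  have : 0 ≤ 2 * (2 * L ^ 2 + (γ ^ 2)⁻¹) * v ^ 2 + 4 * C₀ * L * v ^ 2 + 4 * C₀ * γ⁻¹ := by
    positivity
  linarith

theorem LF_le_T3 (hL : 0 < L) (hC₀ : 0 ≤ C₀) {γ : ℝ} (hγ : 0 < γ) :
    LF L ρ γ ≤ T3 L ρ C₀ γ v d1 := by
  refine Real.le_sqrt_of_sq_le ?_
  have : 0 ≤ v ^ 2 * (LF L ρ γ ^ 2 * d1 ^ 2 + 2 * L * (L + C₀) + (γ ^ 2)⁻¹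
    + 4 * d1 ^ 2 * C₀ * L) + 2 * (γ ^ 2)⁻¹ := by positivity
  linarith

/-- The consequences of the choice of the step size. -/
structure StepBounds (n K : ℕ) (L ρ C₀ v d1 d2 δ α : ℝ) : Prop where
  pos : 0 < α
  mul_sqrt_le : α * (114 * (C₀ + L) * √((K : ℝ) / n)) ≤ 1
  mul_T2_le : 62208 * (α * T2 L ρ C₀ (gammaPar L ρ C₀ d1) v) ≤ 1
  mul_LF_le : 24 * (α * LF L ρ (gammaPar L ρ C₀ d1)) ≤ δ
  mul_d2_le : 294 * (d2 + 1) * (α * T2 L ρ C₀ (gammaPar L ρ C₀ d1) v) ≤ √δ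
  cube_le : α ^ 3 * (5460 * d1 ^ 2 * C₀ * T2 L ρ C₀ (gammaPar L ρ C₀ d1) v ^ 2 * K) ≤ δ

/-- A reciprocal of a sum of nonnegative terms satisfies one condition per term. Positivity of `η4`
makes the sum positive. -/
theorem inv_sum_mul_le {η0 η1 η2 η3 η4 η5 η6 η7 η8 : ℝ} (p0 : 0 ≤ η0) (p1 : 0 ≤ η1) (p2 : 0 ≤ η2)
    (p3 : 0 ≤ η3) (p4 : 0 < η4) (p5 : 0 ≤ η5) (p6 : 0 ≤ η6) (p7 : 0 ≤ η7) (p8 : 0 ≤ η8) {α : ℝ}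
    (hα : α = 1 / (η0 + (η1 + η2 + η3 + η4 + η5 + η6 + η7 + η8))) :
    0 < α ∧ α * η0 ≤ 1 ∧ α * η3 ≤ 1 ∧ α * η4 ≤ 1 ∧ α * η5 ≤ 1 ∧ α * η7 ≤ 1 := by
  obtain ⟨D, hD⟩ : ∃ x, x = η0 + (η1 + η2 + η3 + η4 + η5 + η6 + η7 + η8) := ⟨_, rfl⟩
  have hD0 : 0 < D := by linarith
  have hle : ∀ x, x ≤ D → α * x ≤ 1 := fun x hx => by
    rw [hα, ← hD, one_div, inv_mul_le_iff₀ hD0]; linarith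
  refine ⟨by rw [hα, ← hD]; positivity, hle _ ?_, hle _ ?_, hle _ ?_, hle _ ?_, hle _ ?_⟩ <;>
    linarith

theorem le_mPar (n K : ℕ) : (432 : ℝ) ≤ mPar n K := by
  rw [mPar]; push_cast; linarith [(Nat.cast_nonneg ⌈√((K : ℝ) / n)⌉₊ : (0 : ℝ) ≤ _)]

theorem sum_beta_pos {m : ℕ} (hm : 0 < m) :
    0 < ∑ t ∈ Finset.range m, β ^ (2 * t) := by
  obtain ⟨m, rfl⟩ := Nat.exists_eq_succ_of_ne_zero hm.ne'
  have h1 : 0 ≤ ∑ k ∈ Finset.range m, β ^ (2 * (k + 1)) :=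
    Finset.sum_nonneg fun k _ => by rw [pow_mul]; positivity
  rw [Finset.sum_range_succ', mul_zero, pow_zero]
  linarith

theorem sum_beta_le (hβ : β ^ 2 < 1) (m : ℕ) : ∑ t ∈ Finset.range m, β ^ (2 * t) ≤ m := by
  refine (Finset.sum_le_sum (g := fun _ => (1 : ℝ)) fun t _ => ?_).trans (by simp)
  rw [pow_mul]
  exact pow_le_one₀ (sq_nonneg _) hβ.le

theorem mPar_pos (n K : ℕ) : 0 < mPar n K := Nat.succ_pos _

theorem stepBounds_alphaPar (hL : 0 < L) (hρ : 0 < ρ) (hC₀ : 0 ≤ C₀) (hv : 0 ≤ v)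
    (hd1 : 0 ≤ d1) (hd2 : 0 ≤ d2) (hβ : β ^ 2 < 1) :
    StepBounds n K L ρ C₀ v d1 d2 (1 - β ^ 2) (alphaPar n K L ρ C₀ v d1 d2 β) := by
  have hγ := gammaPar_pos (d1 := d1) hL hρ hC₀
  have hLF0 : 0 < LF L ρ (gammaPar L ρ C₀ d1) :=
    lt_of_lt_of_le (by positivity) (le_LF (d1 := d1) hL hρ hC₀)
  have hT2 : LF L ρ (gammaPar L ρ C₀ d1) ≤ T2 L ρ C₀ (gammaPar L ρ C₀ d1) v := LF_le_T2 hL hC₀ hγ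
  have hT3 : LF L ρ (gammaPar L ρ C₀ d1) ≤ T3 L ρ C₀ (gammaPar L ρ C₀ d1) v d1 :=
    LF_le_T3 hL hC₀ hγ
  have hm := le_mPar n K
  have hδ : 0 < 1 - β ^ 2 := by linarith
  have hS0 := sum_beta_pos (β := β) (mPar_pos n K)
  have hSm := sum_beta_le hβ (mPar n K)
  -- The geometric sum is at most `m`, so the root is at least `√600 > 24`.
  have hroot : 24 ≤ √(600 * mPar n K / ∑ t ∈ Finset.range (mPar n K), β ^ (2 * t)) := by
    refine Real.le_sqrt_of_sq_le ?_
    rw [le_div_iff₀ hS0]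
    linarith
  have ht20 := hLF0.trans_le hT2
  have ht30 := hLF0.trans_le hT3
  have hm0 : (0 : ℝ) ≤ mPar n K := Nat.cast_nonneg _
  obtain ⟨hα0, h0, h3, h4, h5, h7⟩ := inv_sum_mul_le
    (η0 := 114 * (C₀ + L) * √((K : ℝ) / n))
    (mul_nonneg (mul_nonneg (by norm_num) (add_nonneg hC₀ hL.le)) (Real.sqrt_nonneg _))
    (Real.sqrt_nonneg _)
    (mul_nonneg (mul_nonneg (mul_nonneg (by norm_num) hm0) hv) (Real.sqrt_nonneg _))
    (mul_nonneg (div_nonneg ht30.le hδ.le) (Real.sqrt_nonneg _))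
    (mul_pos (mul_pos (by norm_num) (by linarith)) ht20)
    (div_nonneg (mul_nonneg (mul_nonneg (by norm_num) (by linarith)) ht20.le) (Real.sqrt_nonneg _))
    (mul_nonneg (mul_nonneg (mul_nonneg (by norm_num) hd1) hLF0.le) (Real.sqrt_nonneg _))
    (Real.rpow_nonneg (div_nonneg (mul_nonneg (mul_nonneg (mul_nonneg (mul_nonneg (by norm_num)
      (sq_nonneg _)) hC₀) (sq_nonneg _)) (Nat.cast_nonneg _)) hδ.le) _)
    (Real.rpow_nonneg (div_nonneg (mul_nonneg (mul_nonneg (mul_nonneg (mul_nonneg (mul_nonneg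
      (mul_nonneg (by norm_num) (sq_nonneg _)) (sq_nonneg _)) hC₀) (sq_nonneg _)) (sq_nonneg _))
      (Nat.cast_nonneg _)) (Nat.cast_nonneg _)) _)
    (α := alphaPar n K L ρ C₀ v d1 d2 β) rfl
  generalize alphaPar n K L ρ C₀ v d1 d2 β = α at *
  generalize hT : T2 L ρ C₀ (gammaPar L ρ C₀ d1) v = t2 at *
  generalize hTT : T3 L ρ C₀ (gammaPar L ρ C₀ d1) v d1 = t3 at *
  generalize hMM : LF L ρ (gammaPar L ρ C₀ d1) = M at *
  generalize (mPar n K : ℝ) = m at *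
  refine ⟨hα0, h0, ?_, ?_, ?_, ?_⟩
  -- `62208 = 144 · 432`, from the term `144 m t2` and `m ≥ 432`.
  · rw [hT]
    have h6 := mul_le_mul_of_nonneg_right hm (mul_pos hα0 ht20).le
    linarith
  · rw [hMM]
    have h6 := mul_le_mul_of_nonneg_left (mul_le_mul_of_nonneg_left hroot
      (div_nonneg ht30.le hδ.le)) hα0.le
    have e : α * (t3 / (1 - β ^ 2) * 24) = 24 * (α * t3) / (1 - β ^ 2) := by ring
    have h9 := h6.trans h3
    rw [e, div_le_one hδ] at h9
    have h8 := mul_le_mul_of_nonneg_left hT3 hα0.le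
    linarith
  · rw [hT]
    have e : α * (294 * (d2 + 1) * t2 / √(1 - β ^ 2))
        = 294 * (d2 + 1) * (α * t2) / √(1 - β ^ 2) := by ring
    rwa [e, div_le_one (Real.sqrt_pos.2 hδ)] at h5
  · rw [hT]
    have hX : 0 ≤ 5460 * d1 ^ 2 * C₀ * t2 ^ 2 * K / (1 - β ^ 2) :=
      div_nonneg (by positivity) hδ.le
    have h6 := pow_le_pow_left₀ (mul_nonneg hα0.le (Real.rpow_nonneg hX _)) h7 3
    have h8 : ((5460 * d1 ^ 2 * C₀ * t2 ^ 2 * K / (1 - β ^ 2)) ^ (1 / 3 : ℝ)) ^ 3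
        = 5460 * d1 ^ 2 * C₀ * t2 ^ 2 * K / (1 - β ^ 2) := by
      rw [← Real.rpow_natCast, ← Real.rpow_mul hX]
      norm_num
    rw [mul_pow, h8, one_pow, ← mul_div_assoc, div_le_one hδ] at h6
    exact h6

end Parameters

end NormED

/-! ### Initial value, exponential factor and averaged bound -/

namespace NormED

/-- The constant in front of the initial Lyapunov value. -/
noncomputable def initBound (L ρ C₀ Δ : ℝ) : ℝ :=
  Δ + Δ / L + 8 * lfBound L ρ C₀ * Δ + (4 * L + 1) * Δ / L

/-- The weight of the consensus error is at most `5 M / 2` because `24 α M ≤ δ`. The possibly large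
`d2` occurs only as `M (α d2)²`, which is at most `1 / M` since `α d2 M ≤ 1`. -/
theorem initial_le {α M δ d2 γ L ρ C₀ Δ h₀ q₀ : ℝ} (hα : 0 < α) (hδ : 0 < δ) (hδ1 : δ ≤ 1)
    (hd2 : 0 ≤ d2) (hL : 0 < L) (hΔ : 0 ≤ Δ) (hγ : γ * L ≤ 1 / 4)
    (hαM : 24 * (α * M) ≤ δ) (hαd : 294 * (d2 + 1) * (α * M) ≤ √δ) (hM : 7 * L ≤ M)
    (hMb : M ≤ lfBound L ρ C₀) (hq0 : 0 ≤ q₀)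
    (hh : h₀ ≤ Δ + γ / 2 * Δ) (hq : q₀ ≤ 3 * Δ + 2 * (α * d2) ^ 2 * (4 * L * Δ + Δ)) :
    h₀ + 60 * α * M ^ 2 / δ * q₀ ≤ initBound L ρ C₀ Δ := by
  have hM0 : 0 < M := by linarith
  have hαM0 : 0 < α * M := mul_pos hα hM0
  have h1 : 60 * α * M ^ 2 / δ ≤ 5 / 2 * M := by
    rw [div_le_iff₀ hδ]
    have := mul_le_mul_of_nonneg_left hαM (by linarith : 0 ≤ 5 / 2 * M)
    linarith
  have hs1 : √δ ≤ 1 := Real.sqrt_le_one.2 hδ1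
  have h2 : α * d2 * M ≤ 1 := by
    have : 0 ≤ α * M * d2 := mul_nonneg hαM0.le hd2
    linarith
  have h3 : M * (α * d2) ^ 2 ≤ 1 / (7 * L) := by
    have h4 : M * (α * d2) ^ 2 ≤ 1 / M := by
      rw [le_div_iff₀ hM0]
      have := pow_le_pow_left₀ (mul_nonneg (mul_nonneg hα.le hd2) hM0.le) h2 2
      linarith
    exact h4.trans (one_div_le_one_div_of_le (by linarith) hM)
  have h4 : 60 * α * M ^ 2 / δ * q₀ ≤ 5 / 2 * M * q₀ := mul_le_mul_of_nonneg_right h1 hq0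
  have h5 := mul_le_mul_of_nonneg_left hq (by linarith : 0 ≤ 5 / 2 * M)
  have h6 := mul_le_mul_of_nonneg_right h3 (by positivity : 0 ≤ 4 * L * Δ + Δ)
  have h7 : γ / 2 * Δ ≤ Δ / L := by
    rw [le_div_iff₀ hL]
    have := mul_le_mul_of_nonneg_right hγ hΔ
    linarith
  have h8 := mul_le_mul_of_nonneg_right hMb hΔ
  have h9 : 1 / (7 * L) * (4 * L * Δ + Δ) = 1 / 7 * ((4 * L + 1) * Δ / L) := by
    field_simp
  have h10 : 0 ≤ (4 * L + 1) * Δ / L := by positivity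
  have h11 : 0 ≤ M * Δ := by positivity
  rw [initBound]
  rw [h9] at h6
  linarith

/-- The two parts of `Kv` are tamed by different parts of the step size: the one of order `α² K / n`
by the term `114 (C₀ + L) √(K / n)`, the one of order `α³ K / δ` by the cube root in η. -/
theorem exponent_le {α M δ d1 t2 n K L ρ C₀ Kv : ℝ} (hα : 0 < α) (hδ : 0 < δ)
    (hL : 0 < L) (hC₀ : 0 ≤ C₀) (hn : 0 < n) (hK : 0 ≤ K) (hM0 : 0 < M)
    (hMb : M ≤ lfBound L ρ C₀) (hMt : M ≤ t2)
    (h1 : α * (114 * (C₀ + L) * √(K / n)) ≤ 1)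
    (h2 : α ^ 3 * (5460 * d1 ^ 2 * C₀ * t2 ^ 2 * K) ≤ δ)
    (hKv : Kv = 10 * M * α ^ 2 * n⁻¹ + 60 * α ^ 3 * M ^ 2 * d1 ^ 2 / δ) :
    2 * C₀ * Kv * K ≤ lfBound L ρ C₀ / L + 1 := by
  have h3 : α ^ 2 * (C₀ + L) ^ 2 * (K / n) ≤ 1 / 114 ^ 2 := by
    have h4 := pow_le_pow_left₀ (by positivity) h1 2
    have h5 : √(K / n) ^ 2 = K / n := Real.sq_sqrt (by positivity)
    have e : (α * (114 * (C₀ + L) * √(K / n))) ^ 2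
      = 114 ^ 2 * (α ^ 2 * (C₀ + L) ^ 2 * √(K / n) ^ 2) := by ring
    rw [e, h5] at h4
    linarith
  have h4 : C₀ * L ≤ (C₀ + L) ^ 2 := by
    linarith only [mul_nonneg hC₀ hL.le, sq_nonneg C₀, sq_nonneg L]
  have h5 : α ^ 2 * (C₀ * L) * (K / n) ≤ 1 / 114 ^ 2 :=
    le_trans (by gcongr) h3
  have h6 : 20 * M * (α ^ 2 * C₀ * (K / n)) ≤ lfBound L ρ C₀ / L := by
    rw [le_div_iff₀ hL]
    have := mul_le_mul_of_nonneg_left h5 (by positivity : 0 ≤ 20 * M)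
    linarith
  have h7 : α ^ 3 * (C₀ * M ^ 2 * d1 ^ 2 * K) * 120 ≤ δ := by
    have : M ^ 2 ≤ t2 ^ 2 := pow_le_pow_left₀ hM0.le hMt 2
    have h8 := mul_le_mul_of_nonneg_left this (by positivity : 0 ≤ α ^ 3 * (C₀ * d1 ^ 2 * K))
    have h9 : 0 ≤ α ^ 3 * (C₀ * d1 ^ 2 * K) * t2 ^ 2 := by positivity
    linarith
  have e : 2 * C₀ * Kv * K = 20 * M * (α ^ 2 * C₀ * (K / n))
      + α ^ 3 * (C₀ * M ^ 2 * d1 ^ 2 * K) * 120 / δ := by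
    rw [hKv]; ring
  rw [e]
  have := (div_le_one hδ).2 h7
  linarith

/-- After division by `α K`, the initial value contributes `1 / (α K)` and the noise `Kv / α`, that
is `α / n` from the filtered average and `α² / δ` from consensus. -/
theorem averaged_bound_le {α M δ d1 d2 t2 γ n K L ρ C₀ Δ σ h₀ q₀ Kv : ℝ} (hα : 0 < α)
    (hδ : 0 < δ) (hδ1 : δ ≤ 1) (hd1 : 0 ≤ d1) (hd1' : d1 ≤ 1) (hd2 : 0 ≤ d2)
    (hL : 0 < L) (hC₀ : 0 ≤ C₀) (hΔ : 0 ≤ Δ) (hn : 0 < n) (hK : 0 < K)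
    (hγ : γ * L ≤ 1 / 4) (hαM : 24 * (α * M) ≤ δ) (hαd : 294 * (d2 + 1) * (α * M) ≤ √δ)
    (hM : 7 * L ≤ M) (hMb : M ≤ lfBound L ρ C₀) (hMt : M ≤ t2) (hq0 : 0 ≤ q₀)
    (hh : h₀ ≤ Δ + γ / 2 * Δ) (hq : q₀ ≤ 3 * Δ + 2 * (α * d2) ^ 2 * (4 * L * Δ + Δ))
    (h1 : α * (114 * (C₀ + L) * √(K / n)) ≤ 1)
    (h2 : α ^ 3 * (5460 * d1 ^ 2 * C₀ * t2 ^ 2 * K) ≤ δ)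
    (hKv : Kv = 10 * M * α ^ 2 * n⁻¹ + 60 * α ^ 3 * M ^ 2 * d1 ^ 2 / δ) :
    K⁻¹ * (18 / α) * (Real.exp (2 * C₀ * Kv * K) *
        (h₀ + 60 * α * M ^ 2 / δ * q₀ + K * (Kv * (2 * C₀ * Δ + σ ^ 2))))
      ≤ Real.exp (lfBound L ρ C₀ / L + 1) * (18 * initBound L ρ C₀ Δ * (1 / (α * K))
        + 180 * (2 * C₀ * Δ + σ ^ 2) * lfBound L ρ C₀ * (α / n)
        + 1080 * (2 * C₀ * Δ + σ ^ 2) * lfBound L ρ C₀ ^ 2 * (α ^ 2 / δ)) := by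
  have hM0 : 0 < M := by linarith
  have h3 := initial_le hα hδ hδ1 hd2 hL hΔ hγ hαM hαd hM hMb hq0 hh hq
  have h4 := Real.exp_le_exp.2 (exponent_le hα hδ hL hC₀ hn hK.le hM0 hMb hMt h1 h2 hKv)
  obtain ⟨C1, hC1⟩ : ∃ C1, C1 = 2 * C₀ * Δ + σ ^ 2 := ⟨_, rfl⟩
  obtain ⟨Mb, hMbd⟩ : ∃ Mb, Mb = lfBound L ρ C₀ := ⟨_, rfl⟩
  have hC10 : 0 ≤ C1 := by rw [hC1]; positivity
  have hKv0 : 0 ≤ Kv := by rw [hKv]; positivity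
  have hd1sq : d1 ^ 2 ≤ 1 := pow_le_one₀ hd1 hd1'
  rw [← hC1, ← hMbd]
  rw [← hMbd] at hMb h4
  have e : K⁻¹ * (18 / α) * (Real.exp (2 * C₀ * Kv * K) *
        (h₀ + 60 * α * M ^ 2 / δ * q₀ + K * (Kv * C1)))
      = Real.exp (2 * C₀ * Kv * K) * (18 * (h₀ + 60 * α * M ^ 2 / δ * q₀) * (1 / (α * K))
        + 18 * C1 * (Kv / α)) := by
    field_simp
  have h5 : Kv / α ≤ 10 * Mb * (α / n) + 60 * Mb ^ 2 * (α ^ 2 / δ) := by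
    have e2 : Kv / α = 10 * M * (α / n) + 60 * (M ^ 2 * d1 ^ 2) * (α ^ 2 / δ) := by
      rw [hKv]; field_simp
    rw [e2]
    have h6 : M ^ 2 * d1 ^ 2 ≤ Mb ^ 2 :=
      (mul_le_of_le_one_right (sq_nonneg _) hd1sq).trans (pow_le_pow_left₀ hM0.le hMb 2)
    gcongr
  have hF : 0 ≤ initBound L ρ C₀ Δ := by
    have : 0 ≤ lfBound L ρ C₀ := by rw [← hMbd]; linarith
    rw [initBound]; positivity
  have hMb0 : 0 < Mb := by linarith
  rw [e]
  have h7 : 18 * (h₀ + 60 * α * M ^ 2 / δ * q₀) * (1 / (α * K)) + 18 * C1 * (Kv / α)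
      ≤ 18 * initBound L ρ C₀ Δ * (1 / (α * K))
      + 18 * C1 * (10 * Mb * (α / n) + 60 * Mb ^ 2 * (α ^ 2 / δ)) := by gcongr
  refine (mul_le_mul_of_nonneg_left h7 (Real.exp_pos _).le).trans ?_
  · have e3 : 18 * C1 * (10 * Mb * (α / n) + 60 * Mb ^ 2 * (α ^ 2 / δ))
        = 180 * C1 * Mb * (α / n) + 1080 * C1 * Mb ^ 2 * (α ^ 2 / δ) := by ring
    rw [e3, ← add_assoc]
    refine mul_le_mul_of_nonneg_right h4 ?_
    positivity

end NormED

namespace NormED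

/-! ### Elementary inequalities for the five rate terms -/

section Rates

theorem rpow_one_div_le_of_le_pow {x y : ℝ} {k : ℕ} (hk : k ≠ 0) (hx : 0 ≤ x) (hy : 0 ≤ y)
    (h : x ≤ y ^ k) : x ^ (1 / (k : ℝ)) ≤ y := by
  rw [one_div]
  calc x ^ ((k : ℝ)⁻¹) ≤ (y ^ k) ^ ((k : ℝ)⁻¹) := Real.rpow_le_rpow hx h (by positivity)
    _ = y := Real.pow_rpow_inv_natCast hy hk

theorem rpow_one_div_pow {x : ℝ} {k : ℕ} (hk : k ≠ 0) (hx : 0 ≤ x) :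
    (x ^ (1 / (k : ℝ))) ^ k = x := by
  rw [one_div]; exact Real.rpow_inv_natCast_pow hx hk

theorem sq_sqrt_sqrt_pow {x : ℝ} (hx : 0 ≤ x) : √(√x) ^ 4 = x := by
  have : √(√x) ^ 4 = (√(√x) ^ 2) ^ 2 := by ring
  rw [this, Real.sq_sqrt (Real.sqrt_nonneg _), Real.sq_sqrt hx]

theorem mPar_le (n K : ℕ) : (mPar n K : ℝ) ≤ √((K : ℝ) / n) + 433 := by
  rw [mPar]
  have := (Nat.ceil_lt_add_one (Real.sqrt_nonneg ((K : ℝ) / n))).le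
  push_cast
  linarith

/-- The ratio of the number of terms of a geometric sum to its value. -/
theorem div_sum_beta_le {β : ℝ} (hβ : β ^ 2 < 1) {m : ℕ} (hm : 0 < m) :
    (m : ℝ) / ∑ t ∈ Finset.range m, β ^ (2 * t) ≤ 1 + m * (1 - β ^ 2) := by
  rw [div_le_iff₀ (sum_beta_pos hm)]
  simp only [pow_mul]
  -- Multiplying out, `(1 - β²) ∑ β^(2t) = 1 - β^(2m)`, and it remains that `m β^(2m)` is at most
  -- the sum, whose terms are all at least `β^(2m)`.
  have h1 := mul_neg_geom_sum (β ^ 2) m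
  have h2 : (m : ℝ) * (β ^ 2) ^ m ≤ ∑ t ∈ Finset.range m, (β ^ 2) ^ t := by
    have := Finset.card_nsmul_le_sum (Finset.range m) (fun t => (β ^ 2) ^ t) ((β ^ 2) ^ m)
      fun t ht => pow_le_pow_of_le_one (sq_nonneg _) hβ.le (Finset.mem_range.1 ht).le
    simpa using this
  rw [add_mul, one_mul, mul_assoc, h1]
  linarith

variable {n K : ℕ} {l : ℝ}

/-- The five terms of the rate. -/
structure IsRateTerms (n K : ℕ) (l r1 r2 r3 r4 r5 : ℝ) : Prop where
  eq1 : r1 = 1 / √((n : ℝ) * K)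
  eq2 : r2 = 1 / (√(1 - l) * ((n : ℝ) * K ^ 3) ^ (1 / 4 : ℝ))
  eq3 : r3 = (1 / ((1 - l) * (K : ℝ) ^ 2)) ^ (1 / 3 : ℝ)
  eq4 : r4 = (1 / ((n : ℝ) ^ 2 * (1 - l) * (K : ℝ) ^ 3)) ^ (1 / 5 : ℝ)
  eq5 : r5 = n / ((1 - l) * K)
  n_pos : 0 < n
  K_pos : 0 < K
  l_nonneg : 0 ≤ l
  l_lt : l < 1

namespace IsRateTerms

variable {r1 r2 r3 r4 r5 : ℝ}

theorem n_one (h : IsRateTerms n K l r1 r2 r3 r4 r5) : (1 : ℝ) ≤ n := by exact_mod_cast h.n_pos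

theorem K_one (h : IsRateTerms n K l r1 r2 r3 r4 r5) : (1 : ℝ) ≤ K := by exact_mod_cast h.K_pos

theorem δ_pos (h : IsRateTerms n K l r1 r2 r3 r4 r5) : 0 < 1 - l := by linarith [h.l_lt]

theorem pos1 (h : IsRateTerms n K l r1 r2 r3 r4 r5) : 0 < r1 := by
  have := h.n_one; have := h.K_one
  rw [h.eq1]; positivity

theorem pos2 (h : IsRateTerms n K l r1 r2 r3 r4 r5) : 0 < r2 := by
  have := h.n_one; have := h.K_one; have := h.δ_pos
  rw [h.eq2]; positivity

theorem pos3 (h : IsRateTerms n K l r1 r2 r3 r4 r5) : 0 < r3 := by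
  have := h.n_one; have := h.K_one; have := h.δ_pos
  rw [h.eq3]; positivity

theorem pos4 (h : IsRateTerms n K l r1 r2 r3 r4 r5) : 0 < r4 := by
  have := h.n_one; have := h.K_one; have := h.δ_pos
  rw [h.eq4]; positivity

theorem pos5 (h : IsRateTerms n K l r1 r2 r3 r4 r5) : 0 < r5 := by
  have := h.n_one; have := h.K_one; have := h.δ_pos
  rw [h.eq5]; positivity

theorem edRate_eq (h : IsRateTerms n K l r1 r2 r3 r4 r5) :
    edRate n K l = r1 + r2 + r3 + r4 + r5 := by
  rw [edRate, h.eq1, h.eq2, h.eq3, h.eq4, h.eq5]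

theorem sqrt_div (h : IsRateTerms n K l r1 r2 r3 r4 r5) : √((K : ℝ) / n) / K = r1 := by
  have h1 := h.n_one; have h2 := h.K_one
  have hn : (0 : ℝ) < n := by linarith
  have hK : (0 : ℝ) < K := by linarith
  rw [h.eq1, div_eq_div_iff hK.ne' (by positivity), ← Real.sqrt_mul (by positivity)]
  have : (K : ℝ) / n * (n * K) = K ^ 2 := by field_simp
  rw [this, Real.sqrt_sq hK.le, one_mul]

theorem inv_δK_le (h : IsRateTerms n K l r1 r2 r3 r4 r5) : 1 / ((1 - l) * K) ≤ r5 := by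
  have h2 := h.K_one; have h3 := h.δ_pos
  rw [h.eq5]
  exact div_le_div_of_nonneg_right h.n_one (by positivity)

theorem inv_K_le (h : IsRateTerms n K l r1 r2 r3 r4 r5) : 1 / (K : ℝ) ≤ r5 := by
  have h2 := h.K_one; have h3 := h.δ_pos
  refine le_trans ?_ h.inv_δK_le
  refine one_div_le_one_div_of_le (by positivity) ?_
  exact mul_le_of_le_one_left (by positivity) (by linarith [h.l_nonneg])

theorem inv_sqrtδK_le (h : IsRateTerms n K l r1 r2 r3 r4 r5) : 1 / (√(1 - l) * K) ≤ r5 := by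
  have h2 := h.K_one; have h3 := h.δ_pos
  refine le_trans ?_ h.inv_δK_le
  refine one_div_le_one_div_of_le (by positivity) ?_
  refine mul_le_mul_of_nonneg_right ?_ (by positivity)
  exact Real.le_sqrt_of_sq_le (by nlinarith [h.l_nonneg])

theorem mPar_div_le (h : IsRateTerms n K l r1 r2 r3 r4 r5) :
    (mPar n K : ℝ) / K ≤ r1 + 433 * r5 := by
  have hK : (0 : ℝ) < K := by linarith [h.K_one]
  have h1 := div_le_div_of_nonneg_right (mPar_le n K) hK.le
  have h2 := h.inv_K_le
  rw [add_div, h.sqrt_div] at h1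
  have : (433 : ℝ) / K = 433 * (1 / K) := by ring
  linarith

theorem sqrt_sqrt_div (h : IsRateTerms n K l r1 r2 r3 r4 r5) :
    √(√((K : ℝ) / n)) / (√(1 - l) * K) = r2 := by
  have h1 := h.n_one; have h2 := h.K_one; have h3 := h.δ_pos
  have hn : (0 : ℝ) < n := by linarith
  have hK : (0 : ℝ) < K := by linarith
  have e : √(√((K : ℝ) / n)) * ((n : ℝ) * K ^ 3) ^ (1 / 4 : ℝ) = K := by
    refine (pow_left_inj₀ (by positivity) hK.le (n := 4) (by norm_num)).1 ?_
    have := rpow_one_div_pow (k := 4) (by norm_num) (by positivity : 0 ≤ (n : ℝ) * K ^ 3)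
    push_cast at this
    rw [mul_pow, sq_sqrt_sqrt_pow (by positivity), this]
    field_simp
  rw [h.eq2, div_eq_div_iff (by positivity) (by positivity), one_mul]
  calc √(√((K : ℝ) / n)) * (√(1 - l) * ((n : ℝ) * K ^ 3) ^ (1 / 4 : ℝ))
      = √(1 - l) * (√(√((K : ℝ) / n)) * ((n : ℝ) * K ^ 3) ^ (1 / 4 : ℝ)) := by ring
    _ = √(1 - l) * K := by rw [e]

/-- The second rate term is `√m / (√(1 - λ) K)` up to rounding in `m`; the constant is `21` because
`433 ≤ 21²`. -/
theorem sqrt_mPar_div_le (h : IsRateTerms n K l r1 r2 r3 r4 r5) :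
    √(mPar n K) / (√(1 - l) * K) ≤ r2 + 21 * r5 := by
  have h2 := h.K_one; have h3 := h.δ_pos
  have h1 : √(mPar n K) ≤ √(√((K : ℝ) / n)) + 21 := by
    rw [Real.sqrt_le_left (by positivity)]
    have h4 := Real.sq_sqrt (Real.sqrt_nonneg ((K : ℝ) / n))
    have h5 := Real.sqrt_nonneg (√((K : ℝ) / n))
    have h6 := mPar_le n K
    nlinarith
  have h4 := div_le_div_of_nonneg_right h1 (by positivity : 0 ≤ √(1 - l) * (K : ℝ))
  rw [add_div, h.sqrt_sqrt_div] at h4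
  have : 21 / (√(1 - l) * (K : ℝ)) = 21 * (1 / (√(1 - l) * K)) := by ring
  linarith [h.inv_sqrtδK_le]

theorem cbrt_div_le (h : IsRateTerms n K l r1 r2 r3 r4 r5) {X : ℝ} (hX : 0 ≤ X) :
    (X * K / (1 - l)) ^ (1 / 3 : ℝ) ≤ (X + 1) * r3 * K := by
  have h2 := h.K_one; have h3 := h.δ_pos; have h4 := h.pos3
  have hK : (0 : ℝ) < K := by linarith
  have key := rpow_one_div_le_of_le_pow (k := 3) (x := X * K / (1 - l)) (y := (X + 1) * r3 * K)
    (by norm_num) (by positivity) (by positivity) ?_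
  · exact_mod_cast key
  have e : r3 ^ 3 = 1 / ((1 - l) * (K : ℝ) ^ 2) := by
    have := rpow_one_div_pow (k := 3) (by norm_num)
      (by positivity : 0 ≤ 1 / ((1 - l) * (K : ℝ) ^ 2))
    rw [h.eq3]; exact_mod_cast this
  have e2 : ((X + 1) * r3 * K) ^ 3 = (X + 1) ^ 3 * (K / (1 - l)) := by
    rw [mul_pow, mul_pow, e]; field_simp
  rw [e2, mul_div_assoc]
  have : X ≤ (X + 1) ^ 3 := by nlinarith [mul_nonneg hX hX, mul_nonneg hX (mul_nonneg hX hX)]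
  gcongr

/-- The part `K / n` of `m²` reproduces `r4⁵`. The constant part `374978 = 2 · 433²` leaves `1 / ((1
- λ) n K⁴)`, which is below `r4⁵` if `n ≤ K` and below `r5⁵` if `K ≤ n`, as then `r5 ≥ 1 / (1 - λ) ≥
1`. -/
theorem fifth_root_div_le (h : IsRateTerms n K l r1 r2 r3 r4 r5) {X d : ℝ} (hX : 0 ≤ X)
    (hd : d ^ 2 ≤ 1 / (1 - l)) :
    (X * (mPar n K : ℝ) ^ 2 * d ^ 2 * K / n) ^ (1 / 5 : ℝ)
      ≤ 400000 * (X + 1) * (r4 + r5) * K := by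
  have h1 := h.n_one; have h2 := h.K_one; have h3 := h.δ_pos; have h4 := h.pos4
  have h5 := h.pos5
  have hK : (0 : ℝ) < K := by linarith
  have hn : (0 : ℝ) < n := by linarith
  have key := rpow_one_div_le_of_le_pow (k := 5) (x := X * (mPar n K : ℝ) ^ 2 * d ^ 2 * K / n)
    (y := 400000 * (X + 1) * (r4 + r5) * K)
    (by norm_num) (by positivity) (by positivity) ?_
  · exact_mod_cast key
  have e : r4 ^ 5 = 1 / ((n : ℝ) ^ 2 * (1 - l) * (K : ℝ) ^ 3) := by
    have := rpow_one_div_pow (k := 5) (by norm_num)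
      (by positivity : 0 ≤ 1 / ((n : ℝ) ^ 2 * (1 - l) * (K : ℝ) ^ 3))
    rw [h.eq4]; exact_mod_cast this
  -- comparison of the remainder with the two terms
  have hrem : 1 / ((1 - l) * n * (K : ℝ) ^ 4) ≤ r4 ^ 5 + r5 ^ 5 := by
    have hr5 : 0 < r5 ^ 5 := by positivity
    have hr4 : 0 < r4 ^ 5 := by positivity
    rcases le_total (n : ℝ) K with hnK | hnK
    · have : 1 / ((1 - l) * n * (K : ℝ) ^ 4) ≤ r4 ^ 5 := by
        rw [e]
        refine one_div_le_one_div_of_le (by positivity) ?_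
        have := mul_le_mul_of_nonneg_right hnK (by positivity : 0 ≤ (1 - l) * n * (K : ℝ) ^ 3)
        linarith
      linarith
    · have h6 : 1 / (1 - l) ≤ r5 := by
        rw [h.eq5, div_le_div_iff₀ h3 (by positivity)]
        have := mul_le_mul_of_nonneg_right hnK h3.le
        linarith
      have h7 : 1 ≤ r5 := le_trans (by
        rw [le_div_iff₀ h3]; linarith [h.l_nonneg]) h6
      have h8 : 1 / ((1 - l) * n * (K : ℝ) ^ 4) ≤ 1 / (1 - l) := by
        refine one_div_le_one_div_of_le h3 ?_
        have : 1 ≤ (n : ℝ) * K ^ 4 := one_le_mul_of_one_le_of_one_le h1 (one_le_pow₀ h2)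
        nlinarith
      have h9 : r5 ≤ r5 ^ 5 := le_self_pow₀ h7 (by norm_num)
      linarith
  have hm : (mPar n K : ℝ) ^ 2 ≤ 2 * (K / n) + 374978 := by
    have h6 := pow_le_pow_left₀ (Nat.cast_nonneg _) (mPar_le n K) 2
    have h7 := Real.sq_sqrt (by positivity : 0 ≤ (K : ℝ) / n)
    nlinarith [sq_nonneg (√((K : ℝ) / n) - 433)]
  have hsum : (r4 ^ 5 + r5 ^ 5) ≤ (r4 + r5) ^ 5 := by
    have : (r4 + r5) ^ 5 = r4 ^ 5 + r5 ^ 5 + (5 * r4 ^ 4 * r5 + 10 * r4 ^ 3 * r5 ^ 2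
      + 10 * r4 ^ 2 * r5 ^ 3 + 5 * r4 * r5 ^ 4) := by ring
    have : 0 ≤ 5 * r4 ^ 4 * r5 + 10 * r4 ^ 3 * r5 ^ 2
      + 10 * r4 ^ 2 * r5 ^ 3 + 5 * r4 * r5 ^ 4 := by positivity
    linarith
  have h6 : X * (mPar n K : ℝ) ^ 2 * d ^ 2 * K / n
      ≤ X * (2 * (K / n) + 374978) * (1 / (1 - l)) * K / n := by gcongr
  have e3 : X * (2 * ((K : ℝ) / n) + 374978) * (1 / (1 - l)) * K / n
      = X * (2 * r4 ^ 5 + 374978 * (1 / ((1 - l) * n * (K : ℝ) ^ 4))) * K ^ 5 := by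
    rw [e]; field_simp
  have h7 : X * (2 * r4 ^ 5 + 374978 * (1 / ((1 - l) * n * (K : ℝ) ^ 4))) * K ^ 5
      ≤ (X + 1) * (400000 * (r4 + r5) ^ 5) * K ^ 5 := by
    have : 2 * r4 ^ 5 + 374978 * (1 / ((1 - l) * n * (K : ℝ) ^ 4)) ≤ 400000 * (r4 + r5) ^ 5 := by
      have : 0 ≤ r5 ^ 5 := by positivity
      have : 0 ≤ r4 ^ 5 := by positivity
      linarith
    gcongr
    linarith
  have h8 : (X + 1) * 400000 ≤ (400000 * (X + 1)) ^ 5 := by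
    rw [mul_comm (X + 1)]
    exact le_self_pow₀ (by linarith) (by norm_num)
  have h9 := mul_le_mul_of_nonneg_right h8 (by positivity : 0 ≤ (r4 + r5) ^ 5 * (K : ℝ) ^ 5)
  have e4 : (400000 * (X + 1) * (r4 + r5) * K) ^ 5
      = (400000 * (X + 1)) ^ 5 * ((r4 + r5) ^ 5 * (K : ℝ) ^ 5) := by ring
  rw [e4]
  rw [e3] at h6
  linarith

/-- For horizons of order `n³ / (1 - l)²` the first term dominates. -/
theorem le_of_transient (h : IsRateTerms n K l r1 r2 r3 r4 r5)
    (hK : (n : ℝ) ^ 3 / (1 - l) ^ 2 ≤ K) : r1 + r2 + r3 + r4 + r5 ≤ 5 * r1 := by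
  have h1 := h.n_one; have h2 := h.K_one; have h3 := h.δ_pos
  have hK0 : (0 : ℝ) < K := by linarith
  have hn : (0 : ℝ) < n := by linarith
  have hK3 : (n : ℝ) ^ 3 ≤ K * (1 - l) ^ 2 := by rwa [div_le_iff₀ (by positivity)] at hK
  -- The full condition `n³ ≤ K (1 - λ)²` is needed for `r3` and `r5`; for `r2` and `r4` this weaker
  -- form suffices.
  have hK1 : (n : ℝ) ≤ K * (1 - l) ^ 2 := (le_self_pow₀ h1 (by norm_num)).trans hK3
  obtain ⟨s, hs⟩ : ∃ s, s = √((n : ℝ) * K) := ⟨_, rfl⟩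
  have hs0 : 0 < s := by rw [hs]; positivity
  have hs2 : s ^ 2 = n * K := by rw [hs]; exact Real.sq_sqrt (by positivity)
  have hr1 : r1 = 1 / s := by rw [hs]; exact h.eq1
  obtain ⟨δ, hδ⟩ : ∃ δ, δ = 1 - l := ⟨_, rfl⟩
  rw [← hδ] at h3 hK3 hK1
  -- the four comparisons
  have c5 : r5 ≤ r1 := by
    rw [hr1, h.eq5, ← hδ, div_le_div_iff₀ (by positivity) hs0, one_mul]
    refine (pow_le_pow_iff_left₀ (by positivity) (by positivity) (n := 2) (by norm_num)).1 ?_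
    have := mul_le_mul_of_nonneg_right hK3 hK0.le
    rw [mul_pow, hs2]
    linarith
  have c2 : r2 ≤ r1 := by
    rw [hr1, h.eq2, ← hδ]
    refine one_div_le_one_div_of_le hs0 ?_
    refine (pow_le_pow_iff_left₀ (by positivity) (by positivity) (n := 4) (by norm_num)).1 ?_
    have e := rpow_one_div_pow (k := 4) (by norm_num) (by positivity : 0 ≤ (n : ℝ) * K ^ 3)
    push_cast at e
    have e2 : √δ ^ 4 = δ ^ 2 := by
      have : √δ ^ 4 = (√δ ^ 2) ^ 2 := by ring
      rw [this, Real.sq_sqrt h3.le]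
    have e3 : s ^ 4 = (n * K) ^ 2 := by rw [← hs2]; ring
    have := mul_le_mul_of_nonneg_right hK1 (by positivity : 0 ≤ (n : ℝ) * K ^ 2)
    rw [mul_pow, e, e2, e3]
    linarith
  have c3 : r3 ≤ r1 := by
    have key := rpow_one_div_le_of_le_pow (k := 3) (x := 1 / (δ * (K : ℝ) ^ 2)) (y := r1)
      (by norm_num) (by positivity) h.pos1.le ?_
    · rw [h.eq3, ← hδ]; exact_mod_cast key
    rw [hr1, div_pow, one_pow]
    refine one_div_le_one_div_of_le (by positivity) ?_
    refine (pow_le_pow_iff_left₀ (by positivity) (by positivity) (n := 2) (by norm_num)).1 ?_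
    have e3 : (s ^ 3) ^ 2 = (n * K) ^ 3 := by rw [← hs2]; ring
    have := mul_le_mul_of_nonneg_right hK3 (by positivity : 0 ≤ (K : ℝ) ^ 3)
    rw [e3]
    linarith
  have c4 : r4 ≤ r1 := by
    have key := rpow_one_div_le_of_le_pow (k := 5) (x := 1 / ((n : ℝ) ^ 2 * δ * (K : ℝ) ^ 3))
      (y := r1) (by norm_num) (by positivity) h.pos1.le ?_
    · rw [h.eq4, ← hδ]; exact_mod_cast key
    rw [hr1, div_pow, one_pow]
    refine one_div_le_one_div_of_le (by positivity) ?_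
    refine (pow_le_pow_iff_left₀ (by positivity) (by positivity) (n := 2) (by norm_num)).1 ?_
    have e3 : (s ^ 5) ^ 2 = (n * K) ^ 5 := by rw [← hs2]; ring
    have := mul_le_mul_of_nonneg_right hK1 (by positivity : 0 ≤ (n : ℝ) ^ 4 * K ^ 5)
    rw [e3]
    linarith
  linarith

end IsRateTerms

end Rates

end NormED

namespace NormED

/-! ### Bounding the step size parameter by the rate -/

section Eta

variable {n K : ℕ} {L ρ C₀ v d1 d2 β : ℝ}

/-- An upper bound of `γ⁻¹`. -/
noncomputable def invGammaBound (L ρ C₀ : ℝ) : ℝ := 4 * (ρ + L + 2 * C₀)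

noncomputable def t1Bound (L ρ C₀ : ℝ) : ℝ :=
  √(2 * lfBound L ρ C₀ ^ 2 + 16 * (invGammaBound L ρ C₀ ^ 2 + 2 * L ^ 2) / 3 + 4 * C₀ * L / 3)

noncomputable def t2Bound (L ρ C₀ : ℝ) : ℝ :=
  √(lfBound L ρ C₀ ^ 2 + 2 * (2 * L ^ 2 + invGammaBound L ρ C₀ ^ 2) * 4 + 4 * C₀ * L * 4
    + 4 * C₀ * invGammaBound L ρ C₀)

noncomputable def t3Bound (L ρ C₀ : ℝ) : ℝ :=
  √(4 * (lfBound L ρ C₀ ^ 2 + 2 * L * (L + C₀) + invGammaBound L ρ C₀ ^ 2 + 4 * C₀ * L)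
    + lfBound L ρ C₀ ^ 2 + 2 * invGammaBound L ρ C₀ ^ 2)

/-- Bounds of the auxiliary constants. -/
theorem aux_constants_le (hL : 0 < L) (hρ : 0 < ρ) (hC₀ : 0 ≤ C₀) (hn : 0 < n) (hv : v ^ 2 ≤ 4)
    (hd1 : d1 ^ 2 ≤ 1) :
    T1 n L ρ C₀ (gammaPar L ρ C₀ d1) d1 ≤ t1Bound L ρ C₀ ∧
    T2 L ρ C₀ (gammaPar L ρ C₀ d1) v ≤ t2Bound L ρ C₀ ∧
    T3 L ρ C₀ (gammaPar L ρ C₀ d1) v d1 ≤ t3Bound L ρ C₀ := by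
  have hγ := gammaPar_pos (d1 := d1) hL hρ hC₀
  have hi := inv_gammaPar_le (L := L) (ρ := ρ) hC₀ hd1
  have hM := LF_le hL hρ hC₀ hd1
  have hM0 : 0 < LF L ρ (gammaPar L ρ C₀ d1) :=
    lt_of_lt_of_le (by positivity) (le_LF (d1 := d1) hL hρ hC₀)
  generalize gammaPar L ρ C₀ d1 = γ at *
  have hi2 : (γ ^ 2)⁻¹ ≤ invGammaBound L ρ C₀ ^ 2 := by
    rw [← inv_pow]; exact pow_le_pow_left₀ (by positivity) hi 2
  have hi' : γ⁻¹ ≤ invGammaBound L ρ C₀ := hi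
  have hM2 : LF L ρ γ ^ 2 ≤ lfBound L ρ C₀ ^ 2 := pow_le_pow_left₀ hM0.le hM 2
  have hLF2 : LF L ρ γ ^ 2 * d1 ^ 2 ≤ lfBound L ρ C₀ ^ 2 :=
    (mul_le_of_le_one_right (sq_nonneg _) hd1).trans hM2
  have hCL : 0 ≤ C₀ * L := by positivity
  have hCLd : d1 ^ 2 * (C₀ * L) ≤ C₀ * L := mul_le_of_le_one_left hCL hd1
  have hCLv : C₀ * L * v ^ 2 ≤ C₀ * L * 4 := mul_le_mul_of_nonneg_left hv hCL
  refine ⟨Real.sqrt_le_sqrt ?_, Real.sqrt_le_sqrt ?_, Real.sqrt_le_sqrt ?_⟩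
  · have h1 : 4 * C₀ * L / (3 * n) ≤ 4 * C₀ * L / 3 := by
      refine div_le_div_of_nonneg_left (by positivity) (by norm_num) ?_
      have : (1 : ℝ) ≤ n := by exact_mod_cast hn
      linarith
    linarith
  · have h1 : (2 * L ^ 2 + (γ ^ 2)⁻¹) * v ^ 2 ≤ (2 * L ^ 2 + invGammaBound L ρ C₀ ^ 2) * 4 := by
      gcongr
    have h2 : C₀ * γ⁻¹ ≤ C₀ * invGammaBound L ρ C₀ := mul_le_mul_of_nonneg_left hi' hC₀
    linarith
  · have h1 : LF L ρ γ ^ 2 * d1 ^ 2 + 2 * L * (L + C₀) + (γ ^ 2)⁻¹ + 4 * d1 ^ 2 * C₀ * L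
        ≤ lfBound L ρ C₀ ^ 2 + 2 * L * (L + C₀) + invGammaBound L ρ C₀ ^ 2 + 4 * C₀ * L := by
      linarith
    have h2 : 0 ≤ LF L ρ γ ^ 2 * d1 ^ 2 + 2 * L * (L + C₀) + (γ ^ 2)⁻¹ + 4 * d1 ^ 2 * C₀ * L := by
      positivity
    have h3 := mul_le_mul hv h1 h2 (by norm_num)
    linarith

/-- The constant in the upper bound of `η`. -/
noncomputable def etaBound (L ρ C₀ : ℝ) : ℝ :=
  433 * (880 * C₀ * invGammaBound L ρ C₀ + 1 + 12 * t1Bound L ρ C₀ + 144 * t2Bound L ρ C₀)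
    + 550 * t3Bound L ρ C₀ + 588 * t2Bound L ρ C₀ + 72 * lfBound L ρ C₀
    + (5460 * C₀ * t2Bound L ρ C₀ ^ 2 + 1)
    + 400000 * (5460 * C₀ * t2Bound L ρ C₀ ^ 2 * lfBound L ρ C₀ ^ 2 + 1)

/-- After division by `K`, terms of order `m` fall under `r1` and `r5`, the `t3` term under `r2` and
`r5`, the cube root under `r3`, the fifth root under `r4` and `r5`, and the rest under `r5`. Bounds
on the constants enter as variables, so the arithmetic stays free of their definitions. -/
theorem eta_terms_le {a1 a2 a3 Mb Gi t1 t2 t3 M Γ l r1 r2 r3 r4 r5 : ℝ}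
    (h : IsRateTerms n K l r1 r2 r3 r4 r5) (hβ : β ^ 2 = l)
    (hC₀ : 0 ≤ C₀) (ht1 : t1 ≤ a1) (ht2 : t2 ≤ a2) (ht3 : t3 ≤ a3) (hM : M ≤ Mb) (hΓ : Γ ≤ Gi)
    (ht10 : 0 ≤ t1) (ht20 : 0 ≤ t2) (ht30 : 0 ≤ t3) (hM0 : 0 ≤ M) (hΓ0 : 0 ≤ Γ) (hv0 : 0 ≤ v)
    (hv : v ^ 2 ≤ 4) (hd10 : 0 ≤ d1) (hd1 : d1 ≤ 1) (hd2 : d2 ^ 2 ≤ 1 / (1 - l)) :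
    √(16 * mPar n K * C₀ * Γ * (8 + 3 * d1 ^ 2) * (v ^ 2 + 1))
      + 2 * √2 * mPar n K * v * t1
      + t3 / (1 - β ^ 2) * √(600 * mPar n K / ∑ t ∈ Finset.range (mPar n K), β ^ (2 * t))
      + 144 * mPar n K * t2
      + 294 * (d2 + 1) * t2 / √(1 - β ^ 2)
      + 24 * d1 * M * √(v ^ 2 + 1)
      + (5460 * d1 ^ 2 * C₀ * t2 ^ 2 * K / (1 - β ^ 2)) ^ (1 / 3 : ℝ)
      + (5460 * (mPar n K : ℝ) ^ 2 * d2 ^ 2 * C₀ * t2 ^ 2 * M ^ 2 * K / n) ^ (1 / 5 : ℝ)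
    ≤ (433 * (880 * C₀ * Gi + 1 + 12 * a1 + 144 * a2) + 550 * a3 + 588 * a2 + 72 * Mb
        + (5460 * C₀ * a2 ^ 2 + 1) + 400000 * (5460 * C₀ * a2 ^ 2 * Mb ^ 2 + 1))
      * ((r1 + r2 + r3 + r4 + r5) * K) := by
  have hK : (0 : ℝ) < K := by linarith [h.K_one]
  have hδ := h.δ_pos
  have hδ1 : 1 - l ≤ 1 := by linarith [h.l_nonneg]
  have p1 := h.pos1
  have p2 := h.pos2
  have p3 := h.pos3
  have p4 := h.pos4
  have p5 := h.pos5
  have ha1 : 0 ≤ a1 := ht10.trans ht1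
  have ha2 : 0 ≤ a2 := ht20.trans ht2
  have ha3 : 0 ≤ a3 := ht30.trans ht3
  have hMb : 0 ≤ Mb := hM0.trans hM
  have hGi : 0 ≤ Gi := hΓ0.trans hΓ
  have hd1sq : d1 ^ 2 ≤ 1 := pow_le_one₀ hd10 hd1
  have hv2 : v ≤ 2 := (pow_le_pow_iff_left₀ hv0 zero_le_two two_ne_zero).1 (by linarith only [hv])
  have hm := (div_le_iff₀ hK).1 h.mPar_div_le
  have hratio := div_sum_beta_le (β := β) (by rw [hβ]; exact h.l_lt) (mPar_pos n K)
  have hm432 := le_mPar n K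
  have hsm := h.sqrt_mPar_div_le
  have e7 := h.cbrt_div_le (X := 5460 * C₀ * a2 ^ 2) (by positivity)
  have e8 := h.fifth_root_div_le (X := 5460 * C₀ * a2 ^ 2 * Mb ^ 2) (by positivity) hd2
  rw [hβ] at hratio ⊢
  obtain ⟨s, hs⟩ : ∃ s, s = ∑ t ∈ Finset.range (mPar n K), β ^ (2 * t) := ⟨_, rfl⟩
  obtain ⟨m, hmd⟩ : ∃ m : ℝ, m = mPar n K := ⟨_, rfl⟩
  rw [← hs, ← hmd] at hratio ⊢
  rw [← hmd] at hm hm432 hsm e8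
  clear hs hmd
  obtain ⟨q, hq⟩ : ∃ q, q = √(1 - l) := ⟨_, rfl⟩
  have hq0 : 0 < q := by rw [hq]; exact Real.sqrt_pos.2 hδ
  have hq2 : q ^ 2 = 1 - l := by rw [hq]; exact Real.sq_sqrt hδ.le
  have hq1 : q ≤ 1 := by rw [hq]; exact Real.sqrt_le_one.2 hδ1
  have i5 : 1 / (1 - l) ≤ r5 * K := by
    have := h.inv_δK_le
    rwa [← div_div, div_le_iff₀ hK] at this
  have iK : 1 ≤ r5 * K := by
    have := h.inv_K_le
    rwa [div_le_iff₀ hK] at this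
  have ism : √m / q ≤ (r2 + 21 * r5) * K := by
    rw [← hq] at hsm
    rwa [← div_div, div_le_iff₀ hK] at hsm
  -- term by term
  have b1 : √(16 * m * C₀ * Γ * (8 + 3 * d1 ^ 2) * (v ^ 2 + 1)) ≤ (880 * C₀ * Gi + 1) * m := by
    rw [Real.sqrt_le_left (by positivity)]
    have h1 : 16 * m * C₀ * Γ * (8 + 3 * d1 ^ 2) * (v ^ 2 + 1)
        ≤ 16 * m * C₀ * Gi * (8 + 3 * 1) * (4 + 1) := by gcongr
    have h2 : 880 * C₀ * Gi ≤ (880 * C₀ * Gi + 1) ^ 2 := by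
      have : 0 ≤ 880 * C₀ * Gi := by positivity
      exact (le_add_of_nonneg_right zero_le_one).trans
        (le_self_pow₀ (le_add_of_nonneg_left this) two_ne_zero)
    have h3 : m ≤ m ^ 2 := le_self_pow₀ (by linarith only [hm432]) two_ne_zero
    have h4 := mul_le_mul h2 h3 (by linarith only [hm432]) (by positivity)
    rw [mul_pow]
    linarith only [h1, h4]
  have b2 : 2 * √2 * m * v * t1 ≤ 12 * a1 * m := by
    have h1 : √2 ≤ 3 := by rw [Real.sqrt_le_left (by norm_num)]; norm_num
    have h2 : 2 * √2 * m * v * t1 ≤ 2 * 3 * m * 2 * a1 := by gcongr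
    linarith only [h2]
  -- As `m / s ≤ 1 + m (1 - λ)`, the root is at most `25 (1 + √m q)` with `q² = 1 - λ`. Division by
  -- `1 - λ` leaves `1 / (1 - λ) + √m / q`.
  have b3 : t3 / (1 - l) * √(600 * m / s) ≤ 25 * a3 * ((r2 + 22 * r5) * K) := by
    have h1 : √(600 * m / s) ≤ 25 * (1 + √m * q) := by
      rw [Real.sqrt_le_left (by positivity)]
      have h2 : 600 * m / s = 600 * (m / s) := by ring
      have h3 : (25 * (1 + √m * q)) ^ 2 = 625 * (1 + 2 * (√m * q) + √m ^ 2 * q ^ 2) := by ring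
      rw [h2, h3, hq2, Real.sq_sqrt (by linarith)]
      have h4 : 0 ≤ √m * q := by positivity
      have h5 : 0 ≤ m * (1 - l) := mul_nonneg (by linarith only [hm432]) hδ.le
      linarith only [h4, h5, hratio]
    have h2 : t3 / (1 - l) * √(600 * m / s) ≤ a3 / (1 - l) * (25 * (1 + √m * q)) := by gcongr
    have h3 : a3 / (1 - l) * (25 * (1 + √m * q)) = 25 * a3 * (1 / (1 - l) + √m / q) := by
      rw [← hq2]; field_simp
    have h4 : 25 * a3 * (1 / (1 - l) + √m / q) ≤ 25 * a3 * ((r2 + 22 * r5) * K) := by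
      refine mul_le_mul_of_nonneg_left ?_ (by positivity)
      linarith only [i5, ism]
    exact h2.trans (h3.le.trans h4)
  have b4 : 144 * m * t2 ≤ 144 * a2 * m := by
    have := mul_le_mul_of_nonneg_left ht2 (by linarith only [hm432] : 0 ≤ 144 * m)
    linarith only [this]
  have b5 : 294 * (d2 + 1) * t2 / √(1 - l) ≤ 588 * a2 * (r5 * K) := by
    rw [← hq]
    have h1 : d2 ≤ 1 / q := by
      refine le_of_sq_le_sq ?_ (by positivity)
      rw [div_pow, one_pow, hq2]; exact hd2
    have h2 : 1 ≤ 1 / q := by rw [le_div_iff₀ hq0]; linarith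
    have h3 : 294 * (d2 + 1) * t2 / q ≤ 294 * (1 / q + 1 / q) * a2 / q := by
      gcongr
    have h4 : 294 * (1 / q + 1 / q) * a2 / q = 588 * a2 * (1 / (1 - l)) := by
      rw [← hq2]; ring
    rw [h4] at h3
    exact h3.trans (mul_le_mul_of_nonneg_left i5 (by positivity))
  have b6 : 24 * d1 * M * √(v ^ 2 + 1) ≤ 72 * Mb * (r5 * K) := by
    have h1 : √(v ^ 2 + 1) ≤ 3 := by rw [Real.sqrt_le_left (by norm_num)]; linarith
    have h2 : 24 * d1 * M * √(v ^ 2 + 1) ≤ 24 * 1 * Mb * 3 := by gcongr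
    have h3 := mul_le_mul_of_nonneg_left iK (by positivity : 0 ≤ 72 * Mb)
    linarith only [h2, h3]
  have b7 : (5460 * d1 ^ 2 * C₀ * t2 ^ 2 * K / (1 - l)) ^ (1 / 3 : ℝ)
      ≤ (5460 * C₀ * a2 ^ 2 + 1) * r3 * K := by
    refine le_trans (Real.rpow_le_rpow (by positivity) ?_ (by norm_num)) e7
    have h1 : 5460 * d1 ^ 2 * C₀ * t2 ^ 2 ≤ 5460 * 1 * C₀ * a2 ^ 2 := by gcongr
    rw [mul_one] at h1
    gcongr
  have b8 : (5460 * m ^ 2 * d2 ^ 2 * C₀ * t2 ^ 2 * M ^ 2 * K / n) ^ (1 / 5 : ℝ)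
      ≤ 400000 * (5460 * C₀ * a2 ^ 2 * Mb ^ 2 + 1) * (r4 + r5) * K := by
    refine le_trans (Real.rpow_le_rpow (by positivity) ?_ (by norm_num)) e8
    have h1 : 5460 * m ^ 2 * d2 ^ 2 * C₀ * t2 ^ 2 * M ^ 2
        ≤ 5460 * C₀ * a2 ^ 2 * Mb ^ 2 * m ^ 2 * d2 ^ 2 := by
      have : 5460 * m ^ 2 * d2 ^ 2 * C₀ * t2 ^ 2 * M ^ 2
        ≤ 5460 * m ^ 2 * d2 ^ 2 * C₀ * a2 ^ 2 * Mb ^ 2 := by gcongr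
      linarith
    gcongr
  -- collecting the terms
  obtain ⟨cm, hcm⟩ : ∃ c, c = 880 * C₀ * Gi + 1 + 12 * a1 + 144 * a2 := ⟨_, rfl⟩
  obtain ⟨c7, hc7⟩ : ∃ c, c = 5460 * C₀ * a2 ^ 2 + 1 := ⟨_, rfl⟩
  obtain ⟨c8, hc8⟩ : ∃ c, c = 400000 * (5460 * C₀ * a2 ^ 2 * Mb ^ 2 + 1) := ⟨_, rfl⟩
  have hcm0 : 0 ≤ cm := by rw [hcm]; positivity
  have hc70 : 0 ≤ c7 := by rw [hc7]; positivity
  have hc80 : 0 ≤ c8 := by rw [hc8]; positivity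
  have g1 : cm * m ≤ 433 * cm * ((r1 + r2 + r3 + r4 + r5) * K) := by
    have h1 : m ≤ 433 * ((r1 + r2 + r3 + r4 + r5) * K) := by
      refine hm.trans ?_
      have : (r1 + 433 * r5) * K ≤ (433 * (r1 + r2 + r3 + r4 + r5)) * K := by
        gcongr; linarith
      linarith
    have := mul_le_mul_of_nonneg_left h1 hcm0
    linarith
  have hcol : ∀ {c x y : ℝ}, 0 ≤ c → 0 ≤ y → x ≤ y * (r1 + r2 + r3 + r4 + r5) →
      c * (x * K) ≤ c * y * ((r1 + r2 + r3 + r4 + r5) * K) := fun {c x y} hc hy hx => by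
    have := mul_le_mul_of_nonneg_left (mul_le_mul_of_nonneg_right hx hK.le) hc
    linarith
  have g3 := hcol (c := 25 * a3) (x := r2 + 22 * r5) (y := 22) (by positivity) (by norm_num)
    (by linarith)
  have g5 := hcol (c := 588 * a2) (x := r5) (y := 1) (by positivity) (by norm_num) (by linarith)
  have g6 := hcol (c := 72 * Mb) (x := r5) (y := 1) (by positivity) (by norm_num) (by linarith)
  have g7 := hcol (c := c7) (x := r3) (y := 1) (by positivity) (by norm_num) (by linarith)
  have g8 := hcol (c := c8) (x := r4 + r5) (y := 1) (by positivity) (by norm_num) (by linarith)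
  rw [← hcm, ← hc7, ← hc8]
  rw [← hc7] at b7
  rw [← hc8] at b8
  have g9 : (880 * C₀ * Gi + 1) * m + 12 * a1 * m + 144 * a2 * m = cm * m := by rw [hcm]; ring
  linarith only [b1, b2, b3, b4, b5, b6, b7, b8, g1, g3, g5, g6, g7, g8, g9]

theorem etaPar_le {l r1 r2 r3 r4 r5 : ℝ} (h : IsRateTerms n K l r1 r2 r3 r4 r5) (hβ : β ^ 2 = l)
    (hL : 0 < L) (hρ : 0 < ρ) (hC₀ : 0 ≤ C₀) (hv0 : 0 ≤ v) (hv : v ^ 2 ≤ 4)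
    (hd10 : 0 ≤ d1) (hd1 : d1 ≤ 1) (hd2 : d2 ^ 2 ≤ 1 / (1 - l)) :
    etaPar n K L ρ C₀ v d1 d2 β
      ≤ etaBound L ρ C₀ * ((r1 + r2 + r3 + r4 + r5) * K) := by
  have hd1sq : d1 ^ 2 ≤ 1 := pow_le_one₀ hd10 hd1
  obtain ⟨h1, h2, h3⟩ := aux_constants_le (v := v) hL hρ hC₀ h.n_pos hv hd1sq
  have hM0 : 0 < LF L ρ (gammaPar L ρ C₀ d1) :=
    lt_of_lt_of_le (by have := gammaPar_pos (d1 := d1) hL hρ hC₀; positivity)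
      (le_LF (d1 := d1) hL hρ hC₀)
  exact eta_terms_le h hβ hC₀ h1 h2 h3 (LF_le hL hρ hC₀ hd1sq) (inv_gammaPar_le hC₀ hd1sq)
    (Real.sqrt_nonneg _) (Real.sqrt_nonneg _) (Real.sqrt_nonneg _) hM0.le
    (inv_nonneg.2 (gammaPar_pos hL hρ hC₀).le) hv0 hv hd10 hd1 hd2

/-- The three terms of the averaged bound in terms of the rate. -/
theorem alphaPar_rates {l r1 r2 r3 r4 r5 : ℝ} (h : IsRateTerms n K l r1 r2 r3 r4 r5)
    (hβ : β ^ 2 = l) (hL : 0 < L) (hρ : 0 < ρ) (hC₀ : 0 ≤ C₀) (hv0 : 0 ≤ v) (hv : v ^ 2 ≤ 4)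
    (hd10 : 0 ≤ d1) (hd1 : d1 ≤ 1) (hd2 : d2 ^ 2 ≤ 1 / (1 - l)) {α : ℝ}
    (hα : α = alphaPar n K L ρ C₀ v d1 d2 β) (hα0 : 0 < α)
    (hαs : α * (114 * (C₀ + L) * √((K : ℝ) / n)) ≤ 1) :
    1 / (α * K) ≤ (114 * (C₀ + L) + etaBound L ρ C₀) * (r1 + r2 + r3 + r4 + r5) ∧
    α / n ≤ 1 / L * (r1 + r2 + r3 + r4 + r5) ∧
    α ^ 2 / (1 - l) ≤ 1 / L ^ 2 * (r1 + r2 + r3 + r4 + r5) := by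
  have hK : (0 : ℝ) < K := by linarith [h.K_one]
  have hn : (0 : ℝ) < n := by linarith [h.n_one]
  have hδ := h.δ_pos
  have p1 := h.pos1
  have p2 := h.pos2
  have p3 := h.pos3
  have p4 := h.pos4
  have p5 := h.pos5
  have hsq := h.sqrt_div
  have hη := etaPar_le h hβ hL hρ hC₀ hv0 hv hd10 hd1 hd2
  obtain ⟨s, hs⟩ : ∃ s, s = √((K : ℝ) / n) := ⟨_, rfl⟩
  rw [← hs] at hsq hαs
  have hs0 : 0 < s := by rw [hs]; positivity
  have hs2 : s ^ 2 = K / n := by rw [hs]; exact Real.sq_sqrt (by positivity)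
  have hLs : α * (L * s) ≤ 1 := by
    refine le_trans (mul_le_mul_of_nonneg_left ?_ hα0.le) hαs
    refine mul_le_mul_of_nonneg_right ?_ hs0.le
    linarith
  refine ⟨?_, ?_, ?_⟩
  · have e : 1 / (α * K) = 114 * (C₀ + L) * (s / K) + etaPar n K L ρ C₀ v d1 d2 β / K := by
      rw [← div_div, hα, alphaPar, one_div_one_div, ← hs]; ring
    rw [e, hsq]
    have h1 : etaPar n K L ρ C₀ v d1 d2 β / K
        ≤ etaBound L ρ C₀ * (r1 + r2 + r3 + r4 + r5) := by
      rw [div_le_iff₀ hK]; linarith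
    have h2 : 114 * (C₀ + L) * r1 ≤ 114 * (C₀ + L) * (r1 + r2 + r3 + r4 + r5) := by
      refine mul_le_mul_of_nonneg_left (by linarith) (by positivity)
    linarith
  -- From `α L √(K / n) ≤ 1` one gets `α / n ≤ 1 / (L √(n K))`; squaring the same inequality gives
  -- the next bound, with `r5`.
  · have h1 : α / n ≤ 1 / L * r1 := by
      rw [← hsq, div_le_iff₀ hn]
      have e : 1 / L * (s / K) * n = 1 / (L * s) * (s ^ 2 * n / K) := by field_simp
      have e2 : s ^ 2 * n / K = 1 := by rw [hs2]; field_simp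
      rw [e, e2, mul_one, le_div_iff₀ (by positivity)]
      exact hLs
    refine h1.trans (mul_le_mul_of_nonneg_left (by linarith) (by positivity))
  · have h1 : α ^ 2 / (1 - l) ≤ 1 / L ^ 2 * r5 := by
      rw [h.eq5, div_le_iff₀ hδ]
      have e : 1 / L ^ 2 * (n / ((1 - l) * K)) * (1 - l) = 1 / (L ^ 2 * (K / n)) := by field_simp
      rw [e, le_div_iff₀ (by positivity), ← hs2]
      have := pow_le_pow_left₀ (by positivity) hLs 2
      linarith
    refine h1.trans (mul_le_mul_of_nonneg_left (by linarith) (by positivity))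

end Eta

end NormED

/-! ### Assembly of the rate and the transient time -/

namespace NormED

/-- The constant of the convergence rate. -/
noncomputable def rateConst (L ρ C₀ σ Δ : ℝ) : ℝ :=
  Real.exp (lfBound L ρ C₀ / L + 1) *
    (18 * initBound L ρ C₀ Δ * (114 * (C₀ + L) + etaBound L ρ C₀)
      + 180 * (2 * C₀ * Δ + σ ^ 2) * lfBound L ρ C₀ * (1 / L)
      + 1080 * (2 * C₀ * Δ + σ ^ 2) * lfBound L ρ C₀ ^ 2 * (1 / L ^ 2))

/-- The rate of norM-ED for a fixed horizon. -/
theorem statMeasure_edX_le {n p : ℕ} {G : SimpleGraph (Fin n)} {W B : Matrix (Fin n) (Fin n) ℝ}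
    {U : Matrix (Fin n) (Fin (n - 1)) ℝ} {μ : Fin (n - 1) → ℝ}
    {V : Matrix (Fin (n - 1) ⊕ Fin (n - 1)) (Fin (n - 1) ⊕ Fin (n - 1)) ℝ}
    {f : Fin n → EuclideanSpace ℝ (Fin p) → ℝ} {φ : EuclideanSpace ℝ (Fin p) → EReal}
    {S : Set (EuclideanSpace ℝ (Fin p))} {Ω Ξ : Type*} [MeasurableSpace Ω] [MeasurableSpace Ξ]
    {P : Measure Ω} [IsProbabilityMeasure P]
    {g : Fin n → EuclideanSpace ℝ (Fin p) → Ξ → EuclideanSpace ℝ (Fin p)}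
    {ξ : Fin n → ℕ → Ω → Ξ} {z₀ : Fin n → EuclideanSpace ℝ (Fin p)} {L ρ C₀ σ Δ : ℝ}
    (hL : 0 < L) (hρ : 0 < ρ) (hC₀ : 0 ≤ C₀)
    (hG : IsMixing G W) (hW : W.PosSemidef) (hlam : 0 < lam W) (hB : B.PosSemidef)
    (hBW : B * B = 1 - W) (hU : IsSpectralDecomp W U μ) (hV : IsEDTransform W U μ V)
    (hf : IsSmoothFamily f φ L S) (hφ : IsWeaklyConvex φ ρ)
    (hg : IsStochasticOracle f φ C₀ σ P g ξ) (h1 : sigmaF f φ ≤ Δ)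
    (h2 : psiGap f φ (prox φ (edGamma U μ V L ρ C₀) (mean z₀)) ≤ Δ)
    (h3 : ‖Fnor (avgFun f) φ (edGamma U μ V L ρ C₀) (mean z₀)‖ ^ 2 ≤ Δ)
    (h4 : specNorm V⁻¹ ^ 2 * (∑ i, ‖z₀ i - mean z₀‖ ^ 2) / n ≤ Δ) {K : ℕ} (hK : 1 ≤ K) :
    (∀ i k, Integrable (fun ω => ‖(edGamma U μ V L ρ C₀)⁻¹ •
      Fnat (avgFun f) φ (edGamma U μ V L ρ C₀)
        (edX W B (edAlpha U μ V L ρ C₀ K) (edGamma U μ V L ρ C₀) φ g ξ z₀ i k ω)‖ ^ 2) P) ∧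
    statMeasure P (avgFun f) φ (edGamma U μ V L ρ C₀)
      (edX W B (edAlpha U μ V L ρ C₀ K) (edGamma U μ V L ρ C₀) φ g ξ z₀) K
      ≤ |rateConst L ρ C₀ σ Δ| * edRate n K (lam W) := by
  have hn : 0 < n := by
    obtain ⟨i⟩ := hG.connected.nonempty
    exact i.pos
  have hl1 := hG.lam_lt_one hU hW hlam
  have hδ : 0 < 1 - lam W := by linarith
  have hΔ : 0 ≤ Δ := (sq_nonneg _).trans h3
  have hd10 : 0 ≤ D1 U μ V := mul_nonneg (specNorm_nonneg _) (specNorm_nonneg _)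
  have hd20 : 0 ≤ D2 U μ (edB μ) V := mul_nonneg (specNorm_nonneg _) (specNorm_nonneg _)
  have hd1 : D1 U μ V ≤ 1 :=
    (pow_le_pow_iff_left₀ hd10 zero_le_one two_ne_zero).1 (by simpa using hV.D1_sq_le)
  have hd1sq : D1 U μ V ^ 2 ≤ 1 := hV.D1_sq_le
  have hβ : edBeta μ V ^ 2 = lam W := by rw [hV.beta_eq, Real.sq_sqrt hlam.le]
  have hγ : 0 < gammaPar L ρ C₀ (D1 U μ V) := gammaPar_pos hL hρ hC₀
  have hγs := gammaPar_mul_le (d1 := D1 U μ V) hL hρ hC₀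
  have hγi := le_inv_gammaPar (L := L) (ρ := ρ) (d1 := D1 U μ V) hC₀
  have hLF := le_LF (d1 := D1 U μ V) hL hρ hC₀
  have hLFb := LF_le hL hρ hC₀ hd1sq
  have hLFT : LF L ρ (gammaPar L ρ C₀ (D1 U μ V))
      ≤ T2 L ρ C₀ (gammaPar L ρ C₀ (D1 U μ V)) (specNorm V) := LF_le_T2 hL hC₀ hγ
  have hsb := stepBounds_alphaPar (n := n) (K := K) (v := specNorm V) (β := edBeta μ V) hL hρ hC₀
    (specNorm_nonneg V) hd10 hd20 (by rw [hβ]; exact hl1)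
  rw [hβ] at hsb
  have hrt : IsRateTerms n K (lam W) _ _ _ _ _ := ⟨rfl, rfl, rfl, rfl, rfl, hn, hK, hlam.le, hl1⟩
  obtain ⟨q1, q2, q3⟩ := alphaPar_rates hrt hβ hL hρ hC₀ (specNorm_nonneg V) hV.norm_sq_le hd10 hd1
    hV.D2_sq_le (α := edAlpha U μ V L ρ C₀ K) rfl hsb.pos hsb.mul_sqrt_le
  rw [← hrt.edRate_eq] at q1 q2 q3
  have hrate : 0 ≤ edRate n K (lam W) := by
    rw [hrt.edRate_eq]
    linarith [hrt.pos1, hrt.pos2, hrt.pos3, hrt.pos4, hrt.pos5]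
  set R : Run n p Ω Ξ := ⟨W, B, U, μ, V, f, φ, g, ξ, z₀, edAlpha U μ V L ρ C₀ K,
    edGamma U μ V L ρ C₀, LF L ρ (edGamma U μ V L ρ C₀)⟩ with hR
  have hM0 : 0 < R.M := lt_of_lt_of_le (by positivity) hLF
  have hM7 : 7 * (C₀ + L) ≤ R.M := by
    have : R.M = LF L ρ (gammaPar L ρ C₀ (D1 U μ V)) := rfl
    linarith
  have hα0 : 0 < R.α := hsb.pos
  have hαM : 24 * (R.α * R.M) ≤ 1 - lam W := hsb.mul_LF_le
  have hαT : R.α * R.M ≤ R.α * T2 L ρ C₀ (gammaPar L ρ C₀ (D1 U μ V)) (specNorm V) :=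
    mul_le_mul_of_nonneg_left hLFT hα0.le
  have hαd : 294 * (D2 U μ (edB μ) V + 1) * (R.α * R.M) ≤ √(1 - lam W) :=
    (mul_le_mul_of_nonneg_left hαT (by positivity)).trans hsb.mul_d2_le
  have hα1 : 62208 * (R.α * R.M) ≤ 1 :=
    (mul_le_mul_of_nonneg_left hαT (by norm_num)).trans hsb.mul_T2_le
  have hval : R.Valid P L ρ C₀ σ G S :=
    { n_pos := hn
      L_pos := hL
      ρ_pos := hρ
      C₀_nonneg := hC₀
      γ_pos := hγ
      γ_le := hγs
      α_pos := hα0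
      -- Combine `62208 α M ≤ 1` with `M ≥ 7 γ⁻¹ / 4`.
      α_le := by
        have e1 : R.γ * (gammaPar L ρ C₀ (D1 U μ V))⁻¹ = 1 := mul_inv_cancel₀ hγ.ne'
        have e2 : 7 / 4 * (gammaPar L ρ C₀ (D1 U μ V))⁻¹ ≤ R.M := hLF
        have e3 : (0 : ℝ) < R.γ := hγ
        have e4 := mul_le_mul_of_nonneg_left e2 (mul_pos hα0 e3).le
        have e5 := mul_le_mul_of_nonneg_right hα1 e3.le
        have e6 : R.α * R.γ * (7 / 4 * (gammaPar L ρ C₀ (D1 U μ V))⁻¹) = 7 / 4 * R.α := by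
          linear_combination 7 / 4 * R.α * e1
        linarith
      M_eq := rfl
      M_pos := hM0
      αM_le := by linarith [mul_pos hα0 hM0]
      mixing := hG
      posSemidef := hW
      lam_pos := hlam
      sqrt_posSemidef := hB
      sqrt_mul_self := hBW
      spectral := hU
      transform := hV
      smooth := hf
      weaklyConvex := hφ
      oracle := hg }
  refine ⟨fun i k => hval.integrable_Fnat_sq k i, ?_⟩
  have key := hval.statMeasure_le h1 hΔ hd10 hd1 hd20 hαM hαd hM7 rfl K
  have hγL : R.γ * L ≤ 1 / 4 := by
    have : R.γ * (ρ + L) ≤ 1 / 4 := hγs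
    have : 0 < R.γ * ρ := mul_pos hγ hρ
    linarith
  have hn' : (0 : ℝ) < n := by exact_mod_cast hn
  have hK' : (0 : ℝ) < K := by exact_mod_cast hK
  have key2 := averaged_bound_le (σ := σ) hα0 hδ (by linarith) hd10 hd1 hd20 hL hC₀ hΔ hn' hK' hγL
    hαM hαd (by linarith : 7 * L ≤ R.M) hLFb hLFT (Run.uE_nonneg (R := R) (P := P) 0)
    (hval.hE_zero_le h2 h3) (hval.uE_zero_le h1 h2 h3 h4) hsb.mul_sqrt_le hsb.cube_le rfl
  refine (key.trans key2).trans ?_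
  refine le_trans ?_ (mul_le_mul_of_nonneg_right (le_abs_self _) hrate)
  have hMb : 0 ≤ lfBound L ρ C₀ := by rw [lfBound]; positivity
  have hF : 0 ≤ initBound L ρ C₀ Δ := by rw [initBound]; positivity
  rw [rateConst, mul_assoc (Real.exp _)]
  refine mul_le_mul_of_nonneg_left ?_ (Real.exp_pos _).le
  have k1 := mul_le_mul_of_nonneg_left q1 (by positivity : 0 ≤ 18 * initBound L ρ C₀ Δ)
  have k2 := mul_le_mul_of_nonneg_left q2
    (by positivity : 0 ≤ 180 * (2 * C₀ * Δ + σ ^ 2) * lfBound L ρ C₀)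
  have k3 := mul_le_mul_of_nonneg_left q3
    (by positivity : 0 ≤ 1080 * (2 * C₀ * Δ + σ ^ 2) * lfBound L ρ C₀ ^ 2)
  refine (add_le_add (add_le_add k1 k2) k3).trans (le_of_eq ?_)
  ring

/-- A rate bound implies a bound on the transient time. -/
theorem transientTime_le {n : ℕ} {S : ℕ → ℝ} {l c C : ℝ} (hn : 0 < n) (hl0 : 0 ≤ l) (hl1 : l < 1)
    (hc : 0 ≤ c) (hC : 5 * c ≤ C) (hC2 : 2 ≤ C)
    (hS : ∀ K : ℕ, 1 ≤ K → S K ≤ c * edRate n K l) :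
    transientTime n S C ≤ ((C * (n : ℝ) ^ 3 / (1 - l) ^ 2 : ℝ) : EReal) := by
  have hn1 : (1 : ℝ) ≤ n := by exact_mod_cast hn
  have hδ : 0 < 1 - l := by linarith
  have h1 : 1 ≤ (n : ℝ) ^ 3 / (1 - l) ^ 2 := by
    rw [le_div_iff₀ (by positivity), one_mul]
    exact (pow_le_one₀ hδ.le (by linarith)).trans (one_le_pow₀ hn1)
  set T := (n : ℝ) ^ 3 / (1 - l) ^ 2 with hT
  -- The witness is `⌈T⌉`. As `T ≥ 1`, rounding up costs at most a factor 2, absorbed by `C ≥ 2`.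
  have hceil : 1 ≤ ⌈T⌉₊ := Nat.one_le_ceil_iff.2 (by linarith)
  have hmem : ∀ k, ⌈T⌉₊ ≤ k → S k ≤ C / √((n : ℝ) * k) := fun k hk => by
    have hk1 : 1 ≤ k := hceil.trans hk
    have hrt : IsRateTerms n k l _ _ _ _ _ := ⟨rfl, rfl, rfl, rfl, rfl, hn, hk1, hl0, hl1⟩
    have h2 := hrt.le_of_transient ((Nat.le_ceil T).trans (by exact_mod_cast hk))
    have h3 := hS k hk1
    rw [← hrt.edRate_eq] at h2
    have h4 := mul_le_mul_of_nonneg_left h2 hc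
    have h5 := mul_le_mul_of_nonneg_right hC hrt.pos1.le
    rw [div_eq_mul_one_div]
    linarith
  have h2 := (Nat.ceil_lt_add_one (by linarith : 0 ≤ T)).le
  have h3 := mul_le_mul_of_nonneg_right hC2 (by linarith : 0 ≤ T)
  refine (iInf₂_le ⌈T⌉₊ ⟨hceil, hmem⟩).trans ?_
  rw [EReal.coe_le_coe_iff, mul_div_assoc, ← hT]
  linarith

end NormED

theorem corollary2 (L ρ C₀ σ Δ : ℝ) (hL : 0 < L) (hρ : 0 < ρ) (hC₀ : 0 ≤ C₀) (hσ : 0 ≤ σ) :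
    -- the matrix bounds
    (∀ (n : ℕ) (G : SimpleGraph (Fin n)) (W : Matrix (Fin n) (Fin n) ℝ)
      (U : Matrix (Fin n) (Fin (n - 1)) ℝ) (μ : Fin (n - 1) → ℝ),
      IsMixing G W → W.PosSemidef → 0 < lam W → IsSpectralDecomp W U μ →
      ∃ V, IsEDTransform W U μ V) ∧
    -- the convergence rate and the transient time, with a constant depending on
    -- `L, ρ, C₀, σ, Δ` only
    ∃ C : ℝ, 0 < C ∧
      ∀ (n p : ℕ) (G : SimpleGraph (Fin n)) (W B : Matrix (Fin n) (Fin n) ℝ)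
        (U : Matrix (Fin n) (Fin (n - 1)) ℝ) (μ : Fin (n - 1) → ℝ)
        (V : Matrix (Fin (n - 1) ⊕ Fin (n - 1)) (Fin (n - 1) ⊕ Fin (n - 1)) ℝ)
        (f : Fin n → EuclideanSpace ℝ (Fin p) → ℝ) (φ : EuclideanSpace ℝ (Fin p) → EReal)
        (S : Set (EuclideanSpace ℝ (Fin p)))
        (Ω Ξ : Type*) [MeasurableSpace Ω] [MeasurableSpace Ξ]
        (P : Measure Ω) [IsProbabilityMeasure P]
        (g : Fin n → EuclideanSpace ℝ (Fin p) → Ξ → EuclideanSpace ℝ (Fin p))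
        (ξ : Fin n → ℕ → Ω → Ξ) (z₀ : Fin n → EuclideanSpace ℝ (Fin p)),
        IsMixing G W → W.PosSemidef → 0 < lam W →
        B.PosSemidef → B * B = 1 - W →
        IsSpectralDecomp W U μ → IsEDTransform W U μ V →
        IsSmoothFamily f φ L S → IsWeaklyConvex φ ρ → IsStochasticOracle f φ C₀ σ P g ξ →
        -- `Δ` bounds the heterogeneity and the initial errors
        sigmaF f φ ≤ Δ →
        psiGap f φ (prox φ (edGamma U μ V L ρ C₀) (mean z₀)) ≤ Δ →
        ‖Fnor (avgFun f) φ (edGamma U μ V L ρ C₀) (mean z₀)‖ ^ 2 ≤ Δ →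
        specNorm V⁻¹ ^ 2 * (∑ i, ‖z₀ i - mean z₀‖ ^ 2) / n ≤ Δ →
        -- every horizon `K ≥ 1`, run with its own step size
        (∀ K : ℕ, 1 ≤ K →
          (∀ i k, Integrable (fun ω => ‖(edGamma U μ V L ρ C₀)⁻¹ •
            Fnat (avgFun f) φ (edGamma U μ V L ρ C₀)
              (edX W B (edAlpha U μ V L ρ C₀ K) (edGamma U μ V L ρ C₀) φ g ξ z₀ i k ω)‖ ^ 2) P) ∧
          statMeasure P (avgFun f) φ (edGamma U μ V L ρ C₀)
            (edX W B (edAlpha U μ V L ρ C₀ K) (edGamma U μ V L ρ C₀) φ g ξ z₀) K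
            ≤ C * edRate n K (lam W)) ∧
        transientTime n
          (fun K => statMeasure P (avgFun f) φ (edGamma U μ V L ρ C₀)
            (edX W B (edAlpha U μ V L ρ C₀ K) (edGamma U μ V L ρ C₀) φ g ξ z₀) K) C
          ≤ ((C * (n : ℝ) ^ 3 / (1 - lam W) ^ 2 : ℝ) : EReal) := by
  refine ⟨fun n G W U μ hG hW hlam hU => exists_isEDTransform hG hW hlam hU,
    -- The factor 5 counts the five rate terms that collapse to the first one after the transient;
    -- the summand 2 pays for rounding up. The absolute value gives positivity for every sign of
    -- `Δ`.
    5 * |rateConst L ρ C₀ σ Δ| + 2, by positivity, ?_⟩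
  intro n p G W B U μ V f φ S Ω Ξ _ _ P _ g ξ z₀ hG hW hlam hB hBW hU hV hf hφ hg h1 h2 h3 h4
  have hn : 0 < n := by
    obtain ⟨i⟩ := hG.connected.nonempty
    exact i.pos
  have hl1 := hG.lam_lt_one hU hW hlam
  have key := fun (K : ℕ) (hK : 1 ≤ K) =>
    statMeasure_edX_le hL hρ hC₀ hG hW hlam hB hBW hU hV hf hφ hg h1 h2 h3 h4 hK
  have hc := abs_nonneg (rateConst L ρ C₀ σ Δ)
  refine ⟨fun K hK => ⟨(key K hK).1, (key K hK).2.trans ?_⟩,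
    transientTime_le hn hlam.le hl1 hc (by linarith) (by linarith) fun K hK => (key K hK).2⟩
  have hrt : IsRateTerms n K (lam W) _ _ _ _ _ := ⟨rfl, rfl, rfl, rfl, rfl, hn, hK, hlam.le, hl1⟩
  refine mul_le_mul_of_nonneg_right (by linarith) ?_
  rw [hrt.edRate_eq]
  linarith [hrt.pos1, hrt.pos2, hrt.pos3, hrt.pos4, hrt.pos5]
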